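/- Let $\Omega\subseteq\mathbb{R}^d$ be open and convex, and let $X_N=\{x_1,\dots,x_N\}\subset\Omega$ ($N\in\mathbb{N}$) be sets of $N$ distinct points that are quasi-uniform in $\Omega$: with the fill distance $h_{X_N,\Omega}=\sup_{x\in\Omega}\min_i\|x-x_i\|$ and the separation radius $q_{X_N}=\frac12\min_{i\ne j}\|x_i-x_j\|$ there is a constant $C$ with $h_{X_N,\Omega}\le C\,q_{X_N}$ for all $N\ge2$. Fix a kernel $k$, a degree $q\ge0$ of vanishing moments with $m_q=\binom{q+d}{d}$, a threshold $1<\tau<m_q+1$, an admissibility parameter $\eta>0$, and $n$. Consider the following computation of the compressed kernel matrix $K^\Sigma_\eta$ of $X_N$ in samplet coordinates. 1. Cluster tree: starting from the cluster $X_N$, every cluster with at least $\tau$ points is split at the median, orthogonally to a longest edge of its bounding box (the smallest axis-parallel box $B_v$ containing the cluster $v$), into two sons of nearly equal cardinality. 2. Samplet transformations: the scaling functions of a leaf are the point evaluations at its points. For a non-leaf $v$ with sons $v_1,v_2$, an orthogonal matrix $Q^v$ is obtained from a QR decomposition of the transposed matrix of the moments of degree at most $q$ of the scaling functions $[\Phi^{v_1}\,|\,\Phi^{v_2}]$;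 the first $\min(m_q,\cdot)$ functions of $[\Phi^{v_1}\,|\,\Phi^{v_2}]Q^v=[\Phi^v\,|\,\Sigma^v]$ are the scaling functions $\Phi^v$ of $v$, the others its samplets $\Sigma^v$. 3. Multiscale cluster basis: each cluster $v$ has $n$ given interpolation points $\xi_1^v,\dots,\xi_n^v\in\Omega$, pairwise different in every coordinate. With the tensor Lagrange polynomials $\ell^v_\alpha$ and tensor points $\xi^v_\alpha$, $\alpha\in\{1,\dots,n\}^d$, put $V^\Phi_v=[\ell^v_\alpha(x)]_{x\in v,\alpha}$ for a leaf $v$, and recursively $\begin{bmatrix}V^\Phi_v\\V^\Sigma_v\end{bmatrix}=(Q^v)^T\begin{bmatrix}V^\Phi_{v_1}T_{v,v_1}\\V^\Phi_{v_2}T_{v,v_2}\end{bmatrix}$ with $T_{v,v_i}=[\ell^v_\alpha(\xi^{v_i}_\beta)]_{\beta,\alpha}$ for a non-leaf $v$. 4. Blocks: a pair $(v,w)$ is admissible if $\operatorname{dist}(B_v,B_w)\ge\eta\max\{\operatorname{diam}B_v,\operatorname{diam}B_w\}$. For each column cluster $w$, sons before parents, descend the tree of row clusters $v$ from the root without entering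 admissible pairs, and compute for every visited pair the block with parts $K^{\Phi,\Phi}_{v,w},K^{\Phi,\Sigma}_{v,w},K^{\Sigma,\Phi}_{v,w},K^{\Sigma,\Sigma}_{v,w}$: from the blocks of the sons of $v$ and $w$, multiplied by $(Q^v)^T$, if $v$ is not a leaf; as $[k(x,y)]_{x\in v,y\in w}$ if both are leaves; from the blocks of $v$ and the sons of $w$ (already computed if not admissible), multiplied by $Q^w$, otherwise. A block of an admissible pair $(v',w')$ that is needed here is computed as $\begin{bmatrix}V^\Phi_{v'}\\V^\Sigma_{v'}\end{bmatrix}[k(\xi^{v'}_\alpha,\xi^{w'}_\beta)]_{\alpha,\beta}\begin{bmatrix}V^\Phi_{w'}\\V^\Sigma_{w'}\end{bmatrix}^T$ and not stored. The part $K^{\Sigma,\Sigma}_{v,w}$ of every visited pair is stored as a block of the sparse matrix $K^\Sigma_\eta$. Then, counting real and integer arithmetic operations, square roots, comparisons, kernel evaluations and memory accesses as one step each, the whole computation takes $\mathcal{O}(N\log N)$ steps and uses $\mathcal{O}(N\log N)$ memory cells as $N\to\infty$, for fixed $\Omega$, $(X_N)_N$, $d$, $q$, $\tau$, $\eta$,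 $n$. -/

import Mathlib

open Filter Asymptotics
open scoped ENNReal NNReal

noncomputable section

namespace Samplet

/-! ## Point sets -/

/-- Points of `ℝ^d` with the Euclidean norm. -/
abbrev Pt (d : ℕ) : Type := EuclideanSpace ℝ (Fin d)

/-- Fill distance `h_{X,Ω} = sup_{x ∈ Ω} min_{y ∈ X} ‖x - y‖` (infinite if `Ω` is unbounded). -/
def fillDistance {d : ℕ} (Ω X : Set (Pt d)) : ℝ≥0∞ := ⨆ x ∈ Ω, Metric.infEDist x X

/-- Separation radius `q_X = (1/2) min_{x ≠ y ∈ X} ‖x - y‖`. -/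
def separationRadius {d : ℕ} (X : Set (Pt d)) : ℝ≥0∞ := X.einfsep / 2

/-- The sequence `X_N = {x_1, …, x_N}` is quasi-uniform in `Ω`: `h_{X_N,Ω} ≤ C q_{X_N}` with `C`
independent of `N` (for `N ≥ 2`, so that the separation radius is a minimum over a nonempty set). -/
def QuasiUniform {d : ℕ} (Ω : Set (Pt d)) (X : (N : ℕ) → Fin N → Pt d) : Prop :=
  ∃ C : ℝ≥0, ∀ N, 2 ≤ N →
    fillDistance Ω (Set.range (X N)) ≤ C * separationRadius (Set.range (X N))

/-! ## The machine model: a real RAM with unit costs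

A computation of type `Run α` has a result, a number of elementary steps, and a number of memory
cells that it writes. Memory is never released or reused, so `cells` bounds the storage in use at
any time. One step is: an arithmetic operation, square root or comparison of reals or integers, an
evaluation of the kernel, reading one coordinate of a point or one entry of an array or list, or
writing one memory cell. Following a pointer and the field accesses and jumps that go with a step
are part of that step. Tables that depend only on the dimension and the degrees (multi-indices) are
available. A cell holds a real, an integer, a point (whose dimension is fixed) or
a pointer. -/

structure Run (α : Type) where
  /-- result -/
  val : α
  /-- number of elementary steps -/
  time : ℕ
  /-- number of memory cells written -/
  cells : ℕ

instance : Monad Run where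
  pure a := ⟨a, 0, 0⟩
  bind x f := ⟨(f x.val).val, x.time + (f x.val).time, x.cells + (f x.val).cells⟩

/-- One elementary step with result `a`. -/
def op {α : Type} (a : α) : Run α := ⟨a, 1, 0⟩

/-- Writing an object that occupies `m` memory cells. -/
def store {α : Type} (m : ℕ) (a : α) : Run α := ⟨a, m, m⟩

def add (a b : ℝ) : Run ℝ := op (a + b)
def sub (a b : ℝ) : Run ℝ := op (a - b)
def mul (a b : ℝ) : Run ℝ := op (a * b)
def div (a b : ℝ) : Run ℝ := op (a / b)
def sqrt (a : ℝ) : Run ℝ := op (Real.sqrt a)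
def lt (a b : ℝ) : Run Bool := op (decide (a < b))
def le (a b : ℝ) : Run Bool := op (decide (a ≤ b))

/-- The loop `for i = 0, …, n-1` on a state. -/
def iter {σ : Type} (f : ℕ → σ → Run σ) : ℕ → σ → Run σ
  | 0, s => op s
  | n + 1, s => do
    let s ← iter f n s
    let s ← op s
    f n s

/-- Fill an array of length `n`. -/
def arr {α : Type} [Inhabited α] (f : ℕ → Run α) : ℕ → Run (ℕ → α)
  | 0 => op (fun _ => default)
  | n + 1 => do
    let a ← arr f n
    let x ← f n
    store 1 (Function.update a n x)

/-- `∑_{i < n} f i`. -/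
def sumTo (f : ℕ → Run ℝ) (n : ℕ) : Run ℝ :=
  iter (fun i s => do let a ← f i; add s a) n 0

/-- `∏_{i < n} f i`. -/
def prodTo (f : ℕ → Run ℝ) (n : ℕ) : Run ℝ :=
  iter (fun i s => do let a ← f i; mul s a) n 1

/-! ## Dense matrices: an array of arrays, the sizes are passed along -/

abbrev Mat : Type := ℕ → ℕ → ℝ

/-- Read an entry. -/
def get (A : Mat) (i j : ℕ) : Run ℝ := op (A i j)

/-- Fill an `r × c` matrix. -/
def build (r c : ℕ) (f : ℕ → ℕ → Run ℝ) : Run Mat := arr (fun i => arr (fun j => f i j) c) r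

/-- Product of an `r × m` and an `m × c` matrix. -/
def matMul (r m c : ℕ) (A B : Mat) : Run Mat :=
  build r c (fun i j => sumTo (fun l => do
    let a ← get A i l
    let b ← get B l j
    mul a b) m)

/-- Transpose of an `r × c` matrix. -/
def transpose (r c : ℕ) (A : Mat) : Run Mat := build c r (fun i j => get A j i)

/-- `[A; B]` from the first `r₁` rows of `A` and the first `r₂` rows of `B`. -/
def vcat (r₁ r₂ c : ℕ) (A B : Mat) : Run Mat :=
  build (r₁ + r₂) c (fun i j => do
    let t ← op (decide (i < r₁))
    if t then get A i j else get B (i - r₁) j)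

/-- `[A | B]` from the first `c₁` columns of `A` and the first `c₂` columns of `B`. -/
def hcat (r c₁ c₂ : ℕ) (A B : Mat) : Run Mat :=
  build r (c₁ + c₂) (fun i j => do
    let t ← op (decide (j < c₁))
    if t then get A i j else get B i (j - c₁))

/-- One Givens rotation of the rows `i - 1` and `i` of the `n × m` matrix `R` that annihilates
`R i j`; the inverse rotation is multiplied to `Q` from the right. The pair is `(Q, R)`. -/
def givens (n m j i : ℕ) (QR : Mat × Mat) : Run (Mat × Mat) := do
  let a ← get QR.2 (i - 1) j
  let b ← get QR.2 i j
  let aa ← mul a a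
  let bb ← mul b b
  let ss ← add aa bb
  let r ← sqrt ss
  let pos ← lt 0 r
  if pos then do
    let c ← div a r
    let s ← div b r
    let R ← build n m (fun x y => do
      let u ← get QR.2 (i - 1) y
      let w ← get QR.2 i y
      let t ← op (decide (x + 1 = i))
      let t' ← op (decide (x = i))
      if t then do
        let cu ← mul c u
        let sw ← mul s w
        add cu sw
      else if t' then do
        let cw ← mul c w
        let su ← mul s u
        sub cw su
      else get QR.2 x y)
    let Q ← build n n (fun x y => do
      let u ← get QR.1 x (i - 1)
      let w ← get QR.1 x i
      let t ← op (decide (y + 1 = i))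
      let t' ← op (decide (y = i))
      if t then do
        let cu ← mul c u
        let sw ← mul s w
        add cu sw
      else if t' then do
        let cw ← mul c w
        let su ← mul s u
        sub cw su
      else get QR.1 x y)
    pure (Q, R)
  else pure QR

/-- QR decomposition `A = Q R` of an `n × m` matrix by Givens rotations, with `Q` orthogonal of size
`n × n` and `R` upper triangular; returns `Q`. -/
def qr (n m : ℕ) (A : Mat) : Run Mat := do
  let I ← build n n (fun i j => op (if i = j then 1 else 0))
  let QR ← iter (fun j s => iter (fun t s => do
      let below ← op (decide (j < n - 1 - t))
      if below then givens n m j (n - 1 - t) s else pure s) n s) m (I, A)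
  pure QR.1

/-! ## Selection and median in linear time -/

/-- Length of a list. -/
def len {α : Type} : List α → Run ℕ
  | [] => op 0
  | _ :: l => do
    let n ← len l
    op (n + 1)

/-- Entry `k` of a list. -/
def nth : List ℝ → ℕ → Run ℝ
  | [], _ => op 0
  | a :: _, 0 => op a
  | _ :: l, k + 1 => do
    let l ← op l
    nth l k

/-- Insert into a sorted list. -/
def insert (a : ℝ) : List ℝ → Run (List ℝ)
  | [] => store 1 [a]
  | b :: l => do
    let t ← le a b
    if t then store 1 (a :: b :: l) else do
      let l' ← insert a l
      store 1 (b :: l')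

/-- Insertion sort (used on lists of bounded length only). -/
def isort : List ℝ → Run (List ℝ)
  | [] => op []
  | a :: l => do
    let l' ← isort l
    insert a l'

/-- Medians of consecutive groups of five; fewer than five last elements are left out. -/
def groupMedians : List ℝ → Run (List ℝ)
  | a :: b :: c :: e :: f :: l => do
    let s ← isort [a, b, c, e, f]
    let m ← nth s 2
    let ms ← groupMedians l
    store 1 (m :: ms)
  | _ => op []

/-- The elements smaller than, equal to, and larger than the pivot `p`. -/
def partition (p : ℝ) : List ℝ → Run (List ℝ × List ℝ × List ℝ)
  | [] => op ([], [], [])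
  | a :: l => do
    let r ← partition p l
    let t ← lt a p
    let t' ← lt p a
    if t then store 1 (a :: r.1, r.2.1, r.2.2)
    else if t' then store 1 (r.1, r.2.1, a :: r.2.2)
    else store 1 (r.1, a :: r.2.1, r.2.2)

/-- The element of rank `k` (counted from `0`) of a list, by the median of medians method. The first
argument bounds the depth of the recursion; the length of the list is always enough. -/
def select : ℕ → List ℝ → ℕ → Run ℝ
  | 0, _, _ => op 0
  | fuel + 1, l, k => do
    let n ← len l
    let small ← op (decide (n < 50))
    if small then do
      let s ← isort l
      nth s k
    else do
      let ms ← groupMedians l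
      let g ← len ms
      let h ← op (g / 2)
      let p ← select fuel ms h
      let r ← partition p l
      let a ← len r.1
      let b ← len r.2.1
      let t ← op (decide (k < a))
      let t' ← op (decide (k < a + b))
      if t then select fuel r.1 k
      else if t' then pure p
      else do
        let k' ← op (k - (a + b))
        select fuel r.2.2 k'

/-- Median; the mean of the two middle elements if the length is even. -/
def median (l : List ℝ) : Run ℝ := do
  let n ← len l
  let odd ← op (decide (n % 2 = 1))
  let h ← op (n / 2)
  if odd then select n l h
  else do
    let a ← select n l (h - 1)
    let b ← select n l h
    let s ← add a b
    div s 2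

/-! ## The cluster tree -/

/-- Coordinate `l < d` of a point. -/
def coord {d : ℕ} (x : Pt d) (l : ℕ) : Run ℝ := op (if h : l < d then x ⟨l, h⟩ else 0)

/-- The point with coordinates `c 0, …, c (d-1)`. -/
def mkPt (d : ℕ) (c : ℕ → ℝ) : Pt d := WithLp.toLp 2 (fun l : Fin d => c l)

/-- Axis-parallel box `∏ [lo l, hi l]`. -/
structure Box where
  lo : ℕ → ℝ
  hi : ℕ → ℝ

/-- The list of the coordinates `l` of the points. -/
def coords {d : ℕ} (l : ℕ) : List (Pt d) → Run (List ℝ)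
  | [] => op []
  | x :: v => do
    let a ← coord x l
    let r ← coords l v
    store 1 (a :: r)

/-- `min (a, b₁, b₂, …)`. -/
def minimum (a : ℝ) : List ℝ → Run ℝ
  | [] => op a
  | b :: l => do
    let t ← lt b a
    if t then minimum b l else minimum a l

/-- `max (a, b₁, b₂, …)`. -/
def maximum (a : ℝ) : List ℝ → Run ℝ
  | [] => op a
  | b :: l => do
    let t ← lt a b
    if t then maximum b l else maximum a l

/-- Bounding box of a cluster: the smallest axis-parallel box that contains its points. -/
def boundingBox {d : ℕ} (v : List (Pt d)) : Run Box := do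
  let lo ← arr (fun l => do
    let c ← coords l v
    match c with
    | [] => op 0
    | a :: r => minimum a r) d
  let hi ← arr (fun l => do
    let c ← coords l v
    match c with
    | [] => op 0
    | a :: r => maximum a r) d
  store 2 ⟨lo, hi⟩

/-- Length of edge `l` of a box. -/
def edge (B : Box) (l : ℕ) : Run ℝ := do
  let a ← op (B.hi l)
  let b ← op (B.lo l)
  sub a b

/-- Index of a longest edge of a box. -/
def longestEdge (d : ℕ) (B : Box) : Run ℕ := do
  let e ← edge B 0
  let r ← iter (fun l s => do
    let e ← edge B l
    let t ← lt s.2 e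
    if t then pure (l, e) else pure s) d ((0, e) : ℕ × ℝ)
  pure r.1

/-- The points with coordinate `l` larger than `m`. -/
def above {d : ℕ} (l : ℕ) (m : ℝ) : List (Pt d) → Run (List (Pt d))
  | [] => op []
  | x :: v => do
    let r ← above l m v
    let a ← coord x l
    let t ← lt m a
    if t then store 1 (x :: r) else pure r

/-- The second loop of the splitting of a cluster with `n` points. The state consists of the first
son, its cardinality, and the second son. -/
def distribute {d : ℕ} (l : ℕ) (m : ℝ) (n : ℕ) : List (Pt d) → (List (Pt d) × ℕ × List (Pt d)) →
    Run (List (Pt d) × ℕ × List (Pt d))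
  | [], s => op s
  | x :: v, s => do
    let a ← coord x l
    let room ← op (decide ((s.2.1 : ℝ) ≤ (n : ℝ) / 2))
    let eq ← op (decide (a = m))
    let below ← le a m
    let s' ← if room && eq then store 1 (x :: s.1, s.2.1 + 1, s.2.2)
      else if below then store 1 (s.1, s.2.1, x :: s.2.2)
      else pure s
    distribute l m n v s'

/-- Splitting of a cluster with bounding box `B`, orthogonally to a longest edge of `B`, at the
median. -/
def splitCluster {d : ℕ} (B : Box) (v : List (Pt d)) : Run (List (Pt d) × List (Pt d)) := do
  let l ← longestEdge d B
  let c ← coords l v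
  let m ← median c
  let u ← above l m v
  let k ← len u
  let n ← len v
  let s ← distribute l m n v (u, k, [])
  pure (s.1, s.2.2)

/-- Binary trees whose nodes carry data. -/
inductive Tree (α : Type) where
  | leaf (a : α) : Tree α
  | node (a : α) (l r : Tree α) : Tree α

/-- The data at the root. -/
def Tree.label {α : Type} : Tree α → α
  | .leaf a => a
  | .node a _ _ => a

/-- A cluster with its bounding box. -/
structure Cluster (d : ℕ) where
  pts : List (Pt d)
  box : Box

/-- Cluster tree: clusters with at least `τ` points are split. The first argument bounds the depth
of the recursion; the number of points is always enough (both sons of a cluster of distinct points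
are non-empty). -/
def clusterTree {d : ℕ} (τ : ℝ) : ℕ → List (Pt d) → Run (Tree (Cluster d))
  | fuel, v => do
    let n ← len v
    let B ← boundingBox v
    let c ← store (n + 3) (⟨v, B⟩ : Cluster d)
    let big ← le τ n
    match big, fuel with
    | true, fuel + 1 => do
      let s ← splitCluster B v
      let l ← clusterTree τ fuel s.1
      let r ← clusterTree τ fuel s.2
      store 3 (.node c l r)
    | _, _ => store 1 (.leaf c)

/-! ## The samplet basis -/

/-- `m_q = dim P_q(ℝ^d)`. -/
def mq (d q : ℕ) : ℕ := (q + d).choose d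

/-- The multi-indices `α ∈ ℕ^d` with `|α| ≤ q`. -/
def multiIndices : ℕ → ℕ → List (List ℕ)
  | 0, _ => [[]]
  | d + 1, q => (List.range (q + 1)).flatMap fun a => (multiIndices d (q - a)).map fun r => a :: r

/-- The monomial `x ^ α`. -/
def monomial {d : ℕ} (α : List ℕ) (x : Pt d) : Run ℝ :=
  prodTo (fun l => do
    let a ← coord x l
    let e ← op (α.getD l 0)
    prodTo (fun _ => op a) e) d

/-- A cluster `v` with its transformation. `nPhi` and `nSig` are the numbers of scaling functions
and of samplets of `v`; `Q` is the orthogonal matrix of size `nPhi + nSig` with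
`[Φ^v | Σ^v] = [Φ^{son 1} | Φ^{son 2}] Q` (not used for a leaf). -/
structure SampletCluster (d : ℕ) extends Cluster d where
  nPhi : ℕ
  nSig : ℕ
  Q : Mat

/-- Number of scaling functions and samplets. -/
def SampletCluster.dim {d : ℕ} (v : SampletCluster d) : ℕ := v.nPhi + v.nSig

/-- The transformations of all clusters, and the moments `(x^α, φ)`, `|α| ≤ q`, of the scaling
functions `φ` of the root. The scaling functions of a leaf are the point evaluations at its points;
for the other clusters `Q` is obtained from a QR decomposition of the transposed moment matrix, and
the first `m_q` of the resulting functions are the scaling functions. -/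
def sampletBasis {d : ℕ} (q : ℕ) : Tree (Cluster d) → Run (Tree (SampletCluster d) × Mat)
  | .leaf v => do
    let n ← len v.pts
    let x ← store n (fun i => v.pts.getD i 0)
    let M ← build (mq d q) n (fun i j => do
      let y ← op (x j)
      let α ← op ((multiIndices d q).getD i [])
      monomial α y)
    let c ← store 4 ({ toCluster := v, nPhi := n, nSig := 0, Q := 0 } : SampletCluster d)
    let t ← store 1 (Tree.leaf c)
    pure (t, M)
  | .node v l r => do
    let sl ← sampletBasis q l
    let sr ← sampletBasis q r
    let nl ← op sl.1.label.nPhi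
    let nr ← op sr.1.label.nPhi
    let n ← op (nl + nr)
    let M ← hcat (mq d q) nl nr sl.2 sr.2
    let A ← transpose (mq d q) n M
    let Q ← qr n (mq d q) A
    let nPhi ← op (min (mq d q) n)
    let nSig ← op (n - nPhi)
    let MPhi ← matMul (mq d q) n nPhi M Q
    let c ← store 4 ({ toCluster := v, nPhi := nPhi, nSig := nSig, Q := Q } : SampletCluster d)
    let t ← store 3 (Tree.node c sl.1 sr.1)
    pure (t, MPhi)

/-! ## Interpolation and the multiscale cluster basis -/

/-- Digit `l` of `a` in base `n`: the numbers `a < n ^ d` enumerate the multi-indices in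
`{0, …, n-1}^d`. -/
def digit (n a l : ℕ) : ℕ := a / n ^ l % n

/-- The tensor Lagrange polynomial with multi-index `a` for the interpolation points with
coordinates `xi i l` (`i < n`, `l < d`), at the point with coordinates `x 0, …, x (d-1)`. -/
def lagrange (d n : ℕ) (xi : Mat) (a : ℕ) (x : ℕ → Run ℝ) : Run ℝ :=
  prodTo (fun l => do
    let al ← op (digit n a l)
    prodTo (fun i => do
      let same ← op (decide (i = al))
      if same then op 1 else do
        let y ← x l
        let z ← get xi i l
        let w ← get xi al l
        let u ← sub y z
        let t ← sub w z
        div u t) n) d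

/-- Coordinate `l` of the tensor interpolation point with multi-index `a`. -/
def tensorCoord (n : ℕ) (xi : Mat) (a l : ℕ) : Run ℝ := do
  let al ← op (digit n a l)
  get xi al l

/-- A cluster with its interpolation points `xi`; for a leaf also the matrix `V^Φ = [ℓ_α(x)]`, for
the other clusters the transfer matrices `T₁`, `T₂` to the two sons. -/
structure InterpCluster (d : ℕ) extends SampletCluster d where
  xi : Mat
  V : Mat
  T₁ : Mat
  T₂ : Mat

/-- The matrix of the coordinates of the interpolation points of a cluster. -/
def interpolationPoints {d n : ℕ} (ξ : List (Pt d) → Fin n → Pt d) (v : List (Pt d)) : Run Mat :=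
  build n d (fun i l => if h : i < n then coord (ξ v ⟨i, h⟩) l else op 0)

/-- The transfer matrix `[ℓ_α^v(ξ_β^{son})]_{β, α}`. -/
def transferMatrix (d n : ℕ) (xi xison : Mat) : Run Mat :=
  build (n ^ d) (n ^ d) (fun b a => lagrange d n xi a (fun l => tensorCoord n xison b l))

/-- Supply all clusters with interpolation points, transfer matrices, and for leaves `V^Φ`. -/
def interpolation {d n : ℕ} (ξ : List (Pt d) → Fin n → Pt d) :
    Tree (SampletCluster d) → Run (Tree (InterpCluster d))
  | .leaf v => do
    let xi ← interpolationPoints ξ v.pts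
    let x ← store v.nPhi (fun i => v.pts.getD i 0)
    let V ← build v.nPhi (n ^ d) (fun i a => do
      let y ← op (x i)
      lagrange d n xi a (fun l => coord y l))
    let c ← store 5 ({ toSampletCluster := v, xi := xi, V := V, T₁ := 0, T₂ := 0 } :
      InterpCluster d)
    store 1 (.leaf c)
  | .node v l r => do
    let l' ← interpolation ξ l
    let r' ← interpolation ξ r
    let xi ← interpolationPoints ξ v.pts
    let T₁ ← transferMatrix d n xi l'.label.xi
    let T₂ ← transferMatrix d n xi r'.label.xi
    let c ← store 5 ({ toSampletCluster := v, xi := xi, V := 0, T₁ := T₁, T₂ := T₂ } :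
      InterpCluster d)
    store 3 (.node c l' r')

/-- A cluster with its interpolation points and its multiscale cluster basis matrix
`V = [V^Φ; V^Σ]` of size `(nPhi + nSig) × n ^ d`. -/
structure BasisCluster (d : ℕ) extends SampletCluster d where
  xi : Mat
  V : Mat

/-- The multiscale cluster basis:
`[V^Φ_v; V^Σ_v] = Qᵀ [V^Φ_{son 1} T₁; V^Φ_{son 2} T₂]`. -/
def multiscaleClusterBasis {d : ℕ} (n : ℕ) : Tree (InterpCluster d) → Run (Tree (BasisCluster d))
  | .leaf v => do
    let c ← store 3 ({ toSampletCluster := v.toSampletCluster, xi := v.xi, V := v.V } :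
      BasisCluster d)
    store 1 (.leaf c)
  | .node v l r => do
    let l' ← multiscaleClusterBasis n l
    let r' ← multiscaleClusterBasis n r
    let A ← matMul l'.label.nPhi (n ^ d) (n ^ d) l'.label.V v.T₁
    let B ← matMul r'.label.nPhi (n ^ d) (n ^ d) r'.label.V v.T₂
    let W ← vcat l'.label.nPhi r'.label.nPhi (n ^ d) A B
    let Qt ← transpose v.dim v.dim v.Q
    let V ← matMul v.dim v.dim (n ^ d) Qt W
    let c ← store 3 ({ toSampletCluster := v.toSampletCluster, xi := v.xi, V := V } :
      BasisCluster d)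
    store 3 (.node c l' r')

/-! ## The compressed kernel matrix -/

/-- Diameter of a box. -/
def boxDiam (d : ℕ) (B : Box) : Run ℝ := do
  let s ← sumTo (fun l => do
    let e ← edge B l
    mul e e) d
  sqrt s

/-- `max (0, a - b) ^ 2`. -/
def gapSq (a b : ℝ) : Run ℝ := do
  let c ← sub a b
  let t ← lt 0 c
  if t then mul c c else pure 0

/-- Distance of two boxes. -/
def boxDist (d : ℕ) (B B' : Box) : Run ℝ := do
  let s ← sumTo (fun l => do
    let a ← op (B.lo l)
    let b ← op (B.hi l)
    let a' ← op (B'.lo l)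
    let b' ← op (B'.hi l)
    let g ← gapSq a b'
    let g' ← gapSq a' b
    add g g') d
  sqrt s

/-- The admissibility condition `dist (B, B') ≥ η max (diam B, diam B')`. -/
def admissible (d : ℕ) (η : ℝ) (B B' : Box) : Run Bool := do
  let δ ← boxDist d B B'
  let a ← boxDiam d B
  let b ← boxDiam d B'
  let t ← lt a b
  let m ← mul η (if t then b else a)
  le m δ

/-- The kernel at two points given by their coordinates. -/
def kernelEval {d : ℕ} (k : Pt d → Pt d → ℝ) (x y : ℕ → Run ℝ) : Run ℝ := do
  let a ← arr x d
  let b ← arr y d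
  op (k (mkPt d a) (mkPt d b))

/-- The coupling matrix `S = [k(ξ_α^v, ξ_β^w)]_{α, β}`. -/
def couplingMatrix {d : ℕ} (n : ℕ) (k : Pt d → Pt d → ℝ) (v w : BasisCluster d) : Run Mat :=
  build (n ^ d) (n ^ d) (fun a b =>
    kernelEval k (fun l => tensorCoord n v.xi a l) (fun l => tensorCoord n w.xi b l))

/-- The approximation `[V^Φ_v; V^Σ_v] S [V^Φ_w; V^Σ_w]ᵀ` of the block of an admissible pair. -/
def admissibleBlock {d : ℕ} (n : ℕ) (k : Pt d → Pt d → ℝ) (v w : BasisCluster d) : Run Mat := do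
  let S ← couplingMatrix n k v w
  let A ← matMul v.dim (n ^ d) (n ^ d) v.V S
  let Vt ← transpose w.dim (n ^ d) w.V
  matMul v.dim (n ^ d) w.dim A Vt

/-- The block `[k(x, y)]_{x ∈ v, y ∈ w}` of two leaves. -/
def leafBlock {d : ℕ} (k : Pt d → Pt d → ℝ) (v w : BasisCluster d) : Run Mat := do
  let x ← store v.nPhi (fun i => v.pts.getD i 0)
  let y ← store w.nPhi (fun i => w.pts.getD i 0)
  build v.nPhi w.nPhi (fun i j => do
    let a ← op (x i)
    let b ← op (y j)
    op (k a b))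

/-- The blocks of one block column `w`, arranged like the row clusters `v`. `skip` stands for a
block of an admissible pair (and its descendants), which is not stored. A stored block has the full
block `[[ΦΦ, ΦΣ], [ΣΦ, ΣΣ]]` and its part `ΣΣ`, the block `(v, w)` of the compressed matrix. -/
inductive BlockColumn where
  | skip : BlockColumn
  | node (full sig : Mat) (l r : BlockColumn) : BlockColumn

/-- The full block on top of a block column. -/
def BlockColumn.full : BlockColumn → Mat
  | .skip => 0
  | .node A _ _ _ => A

/-- The part that belongs to the first son of the row cluster. -/
def BlockColumn.left : BlockColumn → BlockColumn
  | .skip => .skip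
  | .node _ _ l _ => l

/-- The part that belongs to the second son of the row cluster. -/
def BlockColumn.right : BlockColumn → BlockColumn
  | .skip => .skip
  | .node _ _ _ r => r

/-- Store a computed block and its part `ΣΣ`. -/
def storeBlock {d : ℕ} (v w : BasisCluster d) (A : Mat) (l r : BlockColumn) : Run BlockColumn := do
  let sig ← build v.nSig w.nSig (fun i j => get A (v.nPhi + i) (w.nPhi + j))
  store 5 (.node A sig l r)

/-- Compute the block of the row cluster at the root of the tree and the column cluster `w`, and the
blocks below it in the column of `w`. `sons` is `none` if `w` is a leaf; otherwise it contains the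
two sons of `w`, each with the (already computed) blocks of its column that belong to the row
cluster and its descendants. -/
def setupRow {d : ℕ} (n : ℕ) (η : ℝ) (k : Pt d → Pt d → ℝ) (w : BasisCluster d) :
    Tree (BasisCluster d) →
    Option ((BasisCluster d × BlockColumn) × (BasisCluster d × BlockColumn)) →
    Run BlockColumn
  | .node v t₁ t₂, sons => do
    let sons₁ ← op (sons.map fun s => ((s.1.1, s.1.2.left), (s.2.1, s.2.2.left)))
    let sons₂ ← op (sons.map fun s => ((s.1.1, s.1.2.right), (s.2.1, s.2.2.right)))
    let a₁ ← admissible d η t₁.label.box w.box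
    let r₁ ← if a₁ then do
        let A ← admissibleBlock n k t₁.label w
        pure (A, BlockColumn.skip)
      else do
        let c ← setupRow n η k w t₁ sons₁
        pure (c.full, c)
    let a₂ ← admissible d η t₂.label.box w.box
    let r₂ ← if a₂ then do
        let A ← admissibleBlock n k t₂.label w
        pure (A, BlockColumn.skip)
      else do
        let c ← setupRow n η k w t₂ sons₂
        pure (c.full, c)
    let W ← vcat t₁.label.nPhi t₂.label.nPhi w.dim r₁.1 r₂.1
    let Qt ← transpose v.dim v.dim v.Q
    let A ← matMul v.dim v.dim w.dim Qt W
    storeBlock v w A r₁.2 r₂.2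
  | .leaf v, none => do
    let A ← leafBlock k v w
    storeBlock v w A .skip .skip
  | .leaf v, some ((w₁, c₁), (w₂, c₂)) => do
    let a₁ ← admissible d η v.box w₁.box
    let A₁ ← if a₁ then admissibleBlock n k v w₁ else op c₁.full
    let a₂ ← admissible d η v.box w₂.box
    let A₂ ← if a₂ then admissibleBlock n k v w₂ else op c₂.full
    let W ← hcat v.dim w₁.nPhi w₂.nPhi A₁ A₂
    let A ← matMul v.dim w.dim w.dim W w.Q
    storeBlock v w A .skip .skip

/-- Compute the columns of the column clusters in the given tree, the sons first; `X` is the whole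
cluster tree. -/
def setupColumn {d : ℕ} (n : ℕ) (η : ℝ) (k : Pt d → Pt d → ℝ) (X : Tree (BasisCluster d)) :
    Tree (BasisCluster d) → Run (Tree BlockColumn)
  | .leaf w => do
    let c ← setupRow n η k w X none
    store 2 (.leaf c)
  | .node w l r => do
    let l' ← setupColumn n η k X l
    let r' ← setupColumn n η k X r
    let c ← setupRow n η k w X (some ((l.label, l'.label), (r.label, r'.label)))
    store 4 (.node c l' r')

/-- The whole computation from the points `x`: cluster tree, samplet basis, interpolation data,
multiscale cluster basis, and the blocks of the compressed kernel matrix. -/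
def compressedKernelMatrix {d n : ℕ} (q : ℕ) (τ η : ℝ) (k : Pt d → Pt d → ℝ)
    (ξ : List (Pt d) → Fin n → Pt d) (x : List (Pt d)) : Run (Tree BlockColumn) := do
  let N ← len x
  let t ← clusterTree τ N x
  let s ← sampletBasis q t
  let p ← interpolation ξ s.1
  let X ← multiscaleClusterBasis n p
  setupColumn n η k X X

end Samplet

end

/-! The cost is counted cluster by cluster and block by block, and then the clusters and blocks are
counted.

Cluster tree. Median of medians selects a median in linear time, so splitting a cluster costs a
constant multiple of its cardinality. The sons of a cluster have at most three quarters of its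
points (`splitCluster_spec`), hence the cardinalities of all clusters sum to `O(N log N)`
(`IsBisection.weight_le`). This is the only source of the logarithm.

Bases and blocks. Leaves have at most `m_q` points and every cluster has at most `m_q` scaling
functions and `2 * m_q` functions in all, so each cluster of the samplet basis and of the
multiscale cluster basis, and each visited pair of clusters, has bounded cost. Apart from the root,
only non-admissible row clusters are visited in the column of `w`. Thus the total cost is bounded by
the sum of the cardinalities plus the number of non-admissible pairs
(`exists_compressedKernelMatrix_cost_le`).

Non-admissible pairs. If `(v, w)` is not admissible and `v` has at most as many points as `w`, then
`v` lies in a ball about any point of `w` whose radius is a multiple of the larger of the two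
diameters. If the diameter of a cluster with `n` points is at most a multiple of `g * n ^ (1 / d)`,
where `g` is the separation distance, then by packing this ball contains `O(|w|)` points of `X_N`.
A binary tree of nonempty clusters has fewer than `2 * p` clusters within a set of `p` points,
so `w` has `O(|w|)` partners of at most its size, and all pairs together number `O(N log N)`
(`IsBisection.sum_countP_nonadmissible_le`).

Shape of the clusters. The diameter bound is the geometric core
(`ShapeConstants.width_pow_le`): it says that median splitting orthogonally to longest edges does
not produce long thin boxes. It is enough that the bounding box of a cluster `v` has edges of
comparable length, because then `Ω ∩ box` contains a ball of comparable radius by convexity of `Ω`,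
and by quasi-uniformity the points of `v` are as many as its volume requires. Comparability is
carried through the tree by an invariant (`IsShapeRegular`) with two ingredients.

* A cut does not shrink the longest edge by more than a constant factor
  (`mul_width_le_width_son`). The son has at least a quarter of the points. If it were thin, it would
  lie in a thin slab at the end of the convex body `Ω ∩ box`; such a slab has a small fraction of
  the volume, and so a small fraction of the points.
* If a set `S` of directions has not been cut since an ancestor `u` in which a direction `j` of `S`
  was long, then edge `j` is still not much shorter than some edge outside `S`
  (`exists_le_width`): the body of `u` shrunk towards a central point of `v`, by just enough to fit
  the box of `v` in the other directions, is still inside the body of `v`, by convexity. Here the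
  shrinking factor is the smallest ratio of an edge of `v` to the same edge of `u`.

For a set `S` take for `u` the last cluster produced by a cut in a direction of `S`, or the root.
Then no set of directions has edges much shorter than all others, so all edges are comparable
(`pow_mul_le_of_forall_exists`). Edges below a fixed multiple of `g`, on which the points of `X_N`
give no information, are treated separately throughout. -/

namespace Samplet

/-! ### Cost of a computation -/

/-- Number of steps plus number of memory cells. It bounds both, is additive along `>>=`, and so
replaces the two quantities in all estimates. -/
def Run.cost {α : Type} (x : Run α) : ℕ := x.time + x.cells

@[simp] lemma Run.val_pure {α : Type} (a : α) : (pure a : Run α).val = a := rfl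

@[simp] lemma Run.cost_pure {α : Type} (a : α) : (pure a : Run α).cost = 0 := rfl

@[simp] lemma Run.val_bind {α β : Type} (x : Run α) (f : α → Run β) :
    (x >>= f).val = (f x.val).val := rfl

@[simp] lemma Run.cost_bind {α β : Type} (x : Run α) (f : α → Run β) :
    (x >>= f).cost = x.cost + (f x.val).cost := by
  change x.time + (f x.val).time + (x.cells + (f x.val).cells) =
    x.time + x.cells + ((f x.val).time + (f x.val).cells)
  omega

@[simp] lemma Run.val_ite {α : Type} (p : Prop) [Decidable p] (x y : Run α) :
    (if p then x else y).val = if p then x.val else y.val := by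
  split_ifs <;> rfl

@[simp] lemma Run.cost_ite {α : Type} (p : Prop) [Decidable p] (x y : Run α) :
    (if p then x else y).cost = if p then x.cost else y.cost := by
  split_ifs <;> rfl

@[simp] lemma op_val {α : Type} (a : α) : (op a).val = a := rfl
@[simp] lemma op_cost {α : Type} (a : α) : (op a).cost = 1 := rfl
@[simp] lemma store_val {α : Type} (m : ℕ) (a : α) : (store m a).val = a := rfl

@[simp] lemma store_cost {α : Type} (m : ℕ) (a : α) : (store m a).cost = 2 * m := by
  change m + m = 2 * m
  omega

@[simp] lemma add_val (a b : ℝ) : (add a b).val = a + b := rfl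
@[simp] lemma add_cost (a b : ℝ) : (add a b).cost = 1 := rfl
@[simp] lemma sub_val (a b : ℝ) : (sub a b).val = a - b := rfl
@[simp] lemma sub_cost (a b : ℝ) : (sub a b).cost = 1 := rfl
@[simp] lemma mul_val (a b : ℝ) : (mul a b).val = a * b := rfl
@[simp] lemma mul_cost (a b : ℝ) : (mul a b).cost = 1 := rfl
@[simp] lemma div_val (a b : ℝ) : (div a b).val = a / b := rfl
@[simp] lemma div_cost (a b : ℝ) : (div a b).cost = 1 := rfl
@[simp] lemma sqrt_val (a : ℝ) : (sqrt a).val = Real.sqrt a := rfl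
@[simp] lemma sqrt_cost (a : ℝ) : (sqrt a).cost = 1 := rfl
@[simp] lemma lt_val (a b : ℝ) : (lt a b).val = decide (a < b) := rfl
@[simp] lemma lt_cost (a b : ℝ) : (lt a b).cost = 1 := rfl
@[simp] lemma le_val (a b : ℝ) : (le a b).val = decide (a ≤ b) := rfl
@[simp] lemma le_cost (a b : ℝ) : (le a b).cost = 1 := rfl
@[simp] lemma get_cost (A : Mat) (i j : ℕ) : (get A i j).cost = 1 := rfl

@[simp] lemma coord_cost {d : ℕ} (x : Pt d) (l : ℕ) : (coord x l).cost = 1 := rfl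

lemma coord_val {d : ℕ} (x : Pt d) {l : ℕ} (h : l < d) : (coord x l).val = x ⟨l, h⟩ := by
  simp [coord, h]

/-! ### Loops, arrays and dense matrices -/

lemma iter_cost_le {σ : Type} (f : ℕ → σ → Run σ) (c : ℕ) :
    ∀ (n : ℕ) (s : σ), (∀ i < n, ∀ s, (f i s).cost ≤ c) → (iter f n s).cost ≤ n * (c + 1) + 1
  | 0, s, _ => by simp [iter]
  | n + 1, s, h => by
    have h₁ := iter_cost_le f c n s fun i hi => h i (by omega)
    have h₂ := h n (by omega) (iter f n s).val
    simp only [iter, Run.cost_bind, op_cost, op_val]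
    rw [Nat.add_mul]
    omega

lemma arr_cost_le {α : Type} [Inhabited α] (f : ℕ → Run α) (c : ℕ) :
    ∀ n : ℕ, (∀ i < n, (f i).cost ≤ c) → (arr f n).cost ≤ n * (c + 2) + 1
  | 0, _ => by simp [arr]
  | n + 1, h => by
    have h₁ := arr_cost_le f c n fun i hi => h i (by omega)
    have h₂ := h n (by omega)
    simp only [arr, Run.cost_bind, store_cost]
    rw [Nat.add_mul]
    omega

lemma arr_val {α : Type} [Inhabited α] (f : ℕ → Run α) :
    ∀ {n i : ℕ}, i < n → (arr f n).val i = (f i).val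
  | n + 1, i, h => by
    simp only [arr, Run.val_bind, store_val, Function.update_apply]
    split_ifs with hi
    · rw [hi]
    · exact arr_val f (by omega)

lemma sumTo_cost_le (f : ℕ → Run ℝ) (c n : ℕ) (h : ∀ i < n, (f i).cost ≤ c) :
    (sumTo f n).cost ≤ n * (c + 2) + 1 :=
  iter_cost_le _ (c + 1) n 0 fun i hi s => by simp [h i hi]

lemma sumTo_val (f : ℕ → Run ℝ) (n : ℕ) :
    (sumTo f n).val = ∑ i ∈ Finset.range n, (f i).val := by
  unfold sumTo
  induction n with
  | zero => simp [iter]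
  | succ n ih =>
    simp only [iter, Run.val_bind, op_val, add_val]
    rw [ih, Finset.sum_range_succ]

lemma prodTo_cost_le (f : ℕ → Run ℝ) (c n : ℕ) (h : ∀ i < n, (f i).cost ≤ c) :
    (prodTo f n).cost ≤ n * (c + 2) + 1 :=
  iter_cost_le _ (c + 1) n 1 fun i hi s => by simp [h i hi]

lemma build_cost_le (r c a : ℕ) (f : ℕ → ℕ → Run ℝ) (h : ∀ i < r, ∀ j < c, (f i j).cost ≤ a) :
    (build r c f).cost ≤ r * (c * (a + 2) + 3) + 1 :=
  arr_cost_le _ (c * (a + 2) + 1) r fun i hi => arr_cost_le _ a c fun j hj => h i hi j hj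

/-- Cost bound of an `m × m` matrix whose entries cost at most `a` each. -/
def buildBound (m a : ℕ) : ℕ := m * (m * (a + 2) + 3) + 1

lemma build_cost_le_of_le {r c m a : ℕ} (hr : r ≤ m) (hc : c ≤ m) {f : ℕ → ℕ → Run ℝ}
    (h : ∀ i < r, ∀ j < c, (f i j).cost ≤ a) : (build r c f).cost ≤ buildBound m a := by
  refine (build_cost_le r c a f h).trans ?_
  unfold buildBound
  gcongr

lemma matMul_cost_le {r s t m : ℕ} (hr : r ≤ m) (hs : s ≤ m) (ht : t ≤ m) (A B : Mat) :
    (matMul r s t A B).cost ≤ buildBound m (m * 5 + 1) := by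
  refine build_cost_le_of_le hr ht fun i _ j _ => (sumTo_cost_le _ 3 s ?_).trans ?_
  · intro l _
    simp
  · omega

lemma transpose_cost_le {r c m : ℕ} (hr : r ≤ m) (hc : c ≤ m) (A : Mat) :
    (transpose r c A).cost ≤ buildBound m 1 :=
  build_cost_le_of_le hc hr fun _ _ _ _ => le_rfl

lemma vcat_cost_le {r₁ r₂ c m : ℕ} (hr : r₁ + r₂ ≤ m) (hc : c ≤ m) (A B : Mat) :
    (vcat r₁ r₂ c A B).cost ≤ buildBound m 2 := by
  refine build_cost_le_of_le hr hc fun i _ j _ => ?_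
  simp

lemma hcat_cost_le {r c₁ c₂ m : ℕ} (hr : r ≤ m) (hc : c₁ + c₂ ≤ m) (A B : Mat) :
    (hcat r c₁ c₂ A B).cost ≤ buildBound m 2 := by
  refine build_cost_le_of_le hr hc fun i _ j _ => ?_
  simp

lemma givens_cost_le {n m M : ℕ} (hn : n ≤ M) (hm : m ≤ M) (j i : ℕ) (QR : Mat × Mat) :
    (givens n m j i QR).cost ≤ 2 * buildBound M 7 + 9 := by
  have key : ∀ (b b' : Bool) (x y z : Run ℝ), x.cost ≤ 3 → y.cost ≤ 3 → z.cost ≤ 3 →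
      (if b = true then x else if b' = true then y else z).cost ≤ 3 := by
    intro b b' x y z hx hy hz
    split_ifs <;> assumption
  unfold givens
  simp only [Run.cost_bind, mul_cost, mul_val, add_cost, add_val, get_cost, sqrt_cost, lt_cost,
    Run.cost_ite, div_cost, Run.cost_pure]
  split_ifs
  · have h₁ : ∀ f : ℕ → ℕ → Run ℝ, (∀ x y, (f x y).cost ≤ 7) →
        (build n m f).cost ≤ buildBound M 7 := fun f hf =>
      build_cost_le_of_le hn hm fun x _ y _ => hf x y
    have h₂ : ∀ f : ℕ → ℕ → Run ℝ, (∀ x y, (f x y).cost ≤ 7) →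
        (build n n f).cost ≤ buildBound M 7 := fun f hf =>
      build_cost_le_of_le hn hn fun x _ y _ => hf x y
    grw [h₁, h₂]
    · omega
    all_goals
      intro x y
      simp only [Run.cost_bind, get_cost, op_cost]
      grw [key] <;> simp
  · simp

/-- Cost bound of a QR decomposition with sizes at most `m`. -/
def qrBound (m : ℕ) : ℕ :=
  buildBound m 1 + m * (m * (2 * buildBound m 7 + 11) + 2) + 1

lemma qr_cost_le {n m M : ℕ} (hn : n ≤ M) (hm : m ≤ M) (A : Mat) :
    (qr n m A).cost ≤ qrBound M := by
  unfold qr qrBound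
  simp only [Run.cost_bind, Run.cost_pure, add_zero]
  have h₁ : (build n n fun i j => op (if i = j then 1 else 0)).cost ≤ buildBound M 1 :=
    build_cost_le_of_le hn hn fun _ _ _ _ => le_rfl
  have h₂ : ∀ s, (iter (fun j s => iter (fun t s => do
      let below ← op (decide (j < n - 1 - t))
      if below then givens n m j (n - 1 - t) s else pure s) n s) m s).cost ≤
      m * (n * (2 * buildBound M 7 + 11) + 2) + 1 := by
    intro s
    refine iter_cost_le _ _ m s fun j _ s => iter_cost_le _ _ n s fun t _ s => ?_
    have := givens_cost_le hn hm j (n - 1 - t) s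
    simp only [Run.cost_bind, op_cost, op_val, decide_eq_true_eq, Run.cost_ite, Run.cost_pure]
    split_ifs <;> omega
  grw [h₁, h₂]
  have : m * (n * (2 * buildBound M 7 + 11) + 2) ≤ M * (M * (2 * buildBound M 7 + 11) + 2) := by
    gcongr
  omega

/-! ### Selection and median -/

@[simp] lemma len_val {α : Type} : ∀ l : List α, (len l).val = l.length
  | [] => rfl
  | _ :: l => by simp [len, len_val l]

@[simp] lemma len_cost {α : Type} : ∀ l : List α, (len l).cost = l.length + 1
  | [] => rfl
  | _ :: l => by simp [len, len_cost l]

lemma nth_val : ∀ (l : List ℝ) (k : ℕ), (nth l k).val = l.getD k 0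
  | [], _ => by simp [nth]
  | a :: _, 0 => rfl
  | _ :: l, k + 1 => by simpa [nth] using nth_val l k

lemma nth_cost_le : ∀ (l : List ℝ) (k : ℕ), (nth l k).cost ≤ l.length + 1
  | [], _ => by simp [nth]
  | a :: _, 0 => by simp [nth]
  | _ :: l, k + 1 => by
    have := nth_cost_le l k
    simp only [nth, Run.cost_bind, op_cost, op_val, List.length_cons]
    omega

lemma insert_val (a : ℝ) : ∀ l : List ℝ, (insert a l).val = l.orderedInsert (· ≤ ·) a
  | [] => rfl
  | b :: l => by simp [insert, insert_val a l]

lemma insert_cost_le (a : ℝ) : ∀ l : List ℝ, (insert a l).cost ≤ 3 * l.length + 3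
  | [] => by simp [insert]
  | b :: l => by
    have := insert_cost_le a l
    simp only [insert, Run.cost_bind, le_cost, le_val, decide_eq_true_eq, Run.cost_ite, store_cost,
      List.length_cons]
    split_ifs <;> omega

lemma isort_val : ∀ l : List ℝ, (isort l).val = l.insertionSort (· ≤ ·)
  | [] => rfl
  | a :: l => by simp [isort, isort_val l, insert_val]

lemma isort_cost_le : ∀ l : List ℝ, (isort l).cost ≤ l.length * (3 * l.length + 3) + 1
  | [] => by simp [isort]
  | a :: l => by
    have h₁ := isort_cost_le l
    have h₂ := insert_cost_le a (l.insertionSort (· ≤ ·))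
    simp only [isort, Run.cost_bind, isort_val, List.length_cons]
    rw [List.length_insertionSort] at h₂
    nlinarith

/-- `r` is an element of `l` of rank `k`, counted from `0`: it may stand at position `k` of the
sorted list. -/
def IsRank (l : List ℝ) (k : ℕ) (r : ℝ) : Prop :=
  r ∈ l ∧ l.countP (fun x => decide (x < r)) ≤ k ∧ k < l.countP (fun x => decide (x ≤ r))

lemma IsRank.perm {l l' : List ℝ} (h : l.Perm l') {k : ℕ} {r : ℝ} (hr : IsRank l k r) :
    IsRank l' k r :=
  ⟨h.mem_iff.1 hr.1, by rw [← h.countP_eq]; exact hr.2.1, by rw [← h.countP_eq]; exact hr.2.2⟩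

lemma isRank_getD_of_sorted : ∀ (l : List ℝ), l.Pairwise (· ≤ ·) → ∀ k < l.length,
    IsRank l k (l.getD k 0)
  | [], _, k, hk => by simp at hk
  | b :: l, hl, 0, _ => by
    rw [List.pairwise_cons] at hl
    refine ⟨by simp, ?_, ?_⟩
    · rw [Nat.le_zero, List.countP_eq_zero]
      simpa using hl.1
    · rw [List.countP_pos_iff]
      exact ⟨b, by simp⟩
  | b :: l, hl, k + 1, hk => by
    rw [List.pairwise_cons] at hl
    have hk' : k < l.length := by simpa using hk
    obtain ⟨h₁, h₂, h₃⟩ := isRank_getD_of_sorted l hl.2 k hk'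
    rw [List.getD_cons_succ]
    refine ⟨List.mem_cons_of_mem _ h₁, ?_, ?_⟩
    · rw [List.countP_cons]
      split_ifs <;> omega
    · rw [List.countP_cons_of_pos (by simpa using hl.1 _ h₁)]
      omega

lemma isRank_nth_isort (l : List ℝ) {k : ℕ} (hk : k < l.length) :
    IsRank l k (nth (isort l).val k).val := by
  rw [nth_val, isort_val]
  exact (isRank_getD_of_sorted _ (List.pairwise_insertionSort _ l) k
    (by rwa [List.length_insertionSort])).perm (List.perm_insertionSort _ l)

lemma countP_lt_add_countP_le (l : List ℝ) (r : ℝ) :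
    l.countP (fun x => decide (x < r)) + l.countP (fun x => decide (r ≤ x)) = l.length := by
  rw [List.length_eq_countP_add_countP (fun x => decide (x < r))]
  congr 1
  exact List.countP_congr fun x _ => by simp

lemma groupMedians_cost_le : ∀ l : List ℝ, (groupMedians l).cost ≤ 20 * l.length + 1
  | a :: b :: c :: e :: f :: l => by
    have h₁ := isort_cost_le [a, b, c, e, f]
    have h₂ := nth_cost_le (isort [a, b, c, e, f]).val 2
    have h₃ := groupMedians_cost_le l
    rw [isort_val, List.length_insertionSort, ← isort_val] at h₂
    simp only [groupMedians, Run.cost_bind, store_cost, List.length_cons, List.length_nil] at *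
    omega
  | [] => by simp [groupMedians]
  | [_] => by simp [groupMedians]
  | [_, _] => by simp [groupMedians]
  | [_, _, _] => by simp [groupMedians]
  | [_, _, _, _] => by simp [groupMedians]

lemma length_groupMedians : ∀ l : List ℝ, (groupMedians l).val.length = l.length / 5
  | a :: b :: c :: e :: f :: l => by
    have := length_groupMedians l
    simp only [groupMedians, Run.val_bind, store_val, List.length_cons]
    omega
  | [] => by simp [groupMedians]
  | [_] => by simp [groupMedians]
  | [_, _] => by simp [groupMedians]
  | [_, _, _] => by simp [groupMedians]
  | [_, _, _, _] => by simp [groupMedians]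

lemma mem_of_mem_groupMedians (p : ℝ) : ∀ l : List ℝ, p ∈ (groupMedians l).val → p ∈ l
  | a :: b :: c :: e :: f :: l => by
    have ih := mem_of_mem_groupMedians p l
    have hm := (isRank_nth_isort [a, b, c, e, f] (k := 2) (by simp)).1
    simp only [groupMedians, Run.val_bind, store_val, List.mem_cons]
    rintro (rfl | h)
    · simp only [List.mem_cons, List.not_mem_nil, or_false] at hm
      tauto
    · simp [ih h]
  | [] => by simp [groupMedians]
  | [_] => by simp [groupMedians]
  | [_, _] => by simp [groupMedians]
  | [_, _, _] => by simp [groupMedians]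
  | [_, _, _, _] => by simp [groupMedians]

/-- A group whose median is at most `p` contributes three elements that are at most `p`. -/
lemma three_mul_countP_groupMedians_le (p : ℝ) : ∀ l : List ℝ,
    3 * (groupMedians l).val.countP (fun x => decide (x ≤ p)) ≤
      l.countP (fun x => decide (x ≤ p))
  | a :: b :: c :: e :: f :: l => by
    have ih := three_mul_countP_groupMedians_le p l
    obtain ⟨-, -, hm⟩ := isRank_nth_isort [a, b, c, e, f] (k := 2) (by simp)
    have hl : a :: b :: c :: e :: f :: l = [a, b, c, e, f] ++ l := rfl
    have hg : (groupMedians ([a, b, c, e, f] ++ l)).val =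
        (nth (isort [a, b, c, e, f]).val 2).val :: (groupMedians l).val := rfl
    rw [hl, hg, List.countP_append, List.countP_cons]
    set m := (nth (isort [a, b, c, e, f]).val 2).val
    by_cases hp : m ≤ p
    · have : [a, b, c, e, f].countP (fun x => decide (x ≤ m)) ≤
          [a, b, c, e, f].countP (fun x => decide (x ≤ p)) :=
        List.countP_mono_left fun x _ hx => by
          simp only [decide_eq_true_eq] at hx ⊢
          exact hx.trans hp
      simp only [hp, decide_true, if_true]
      omega
    · simp only [hp, decide_false, Bool.false_eq_true, if_false]
      omega
  | [] => by simp [groupMedians]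
  | [_] => by simp [groupMedians]
  | [_, _] => by simp [groupMedians]
  | [_, _, _] => by simp [groupMedians]
  | [_, _, _, _] => by simp [groupMedians]

lemma three_mul_countP_groupMedians_ge (p : ℝ) : ∀ l : List ℝ,
    3 * (groupMedians l).val.countP (fun x => decide (p ≤ x)) ≤
      l.countP (fun x => decide (p ≤ x))
  | a :: b :: c :: e :: f :: l => by
    have ih := three_mul_countP_groupMedians_ge p l
    obtain ⟨-, hm, -⟩ := isRank_nth_isort [a, b, c, e, f] (k := 2) (by simp)
    have hl : a :: b :: c :: e :: f :: l = [a, b, c, e, f] ++ l := rfl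
    have hg : (groupMedians ([a, b, c, e, f] ++ l)).val =
        (nth (isort [a, b, c, e, f]).val 2).val :: (groupMedians l).val := rfl
    rw [hl, hg, List.countP_append, List.countP_cons]
    set m := (nth (isort [a, b, c, e, f]).val 2).val
    have h5 := countP_lt_add_countP_le [a, b, c, e, f] m
    have h5' : [a, b, c, e, f].length = 5 := rfl
    by_cases hp : p ≤ m
    · have : [a, b, c, e, f].countP (fun x => decide (m ≤ x)) ≤
          [a, b, c, e, f].countP (fun x => decide (p ≤ x)) :=
        List.countP_mono_left fun x _ hx => by
          simp only [decide_eq_true_eq] at hx ⊢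
          exact hp.trans hx
      simp only [hp, decide_true, if_true]
      omega
    · simp only [hp, decide_false, Bool.false_eq_true, if_false]
      omega
  | [] => by simp [groupMedians]
  | [_] => by simp [groupMedians]
  | [_, _] => by simp [groupMedians]
  | [_, _, _] => by simp [groupMedians]
  | [_, _, _, _] => by simp [groupMedians]

lemma partition_val (p : ℝ) : ∀ l : List ℝ, (partition p l).val =
    (l.filter (fun x => decide (x < p)), l.filter (fun x => decide (x = p)),
      l.filter (fun x => decide (p < x)))
  | [] => rfl
  | a :: l => by
    have ih := partition_val p l
    simp only [partition, Run.val_bind, ih, lt_val, Run.val_ite, store_val, decide_eq_true_eq]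
    rcases lt_trichotomy a p with h | h | h
    · simp [h, h.ne, h.not_gt]
    · simp [h]
    · simp [h, h.ne', h.not_gt]

lemma partition_cost (p : ℝ) : ∀ l : List ℝ, (partition p l).cost = 4 * l.length + 1
  | [] => rfl
  | a :: l => by
    simp only [partition, Run.cost_bind, partition_cost p l, lt_cost, Run.cost_ite, store_cost,
      ite_self, List.length_cons]
    omega

lemma length_filter_lt_add_eq (l : List ℝ) (p : ℝ) :
    (l.filter (fun x => decide (x < p))).length + (l.filter (fun x => decide (x = p))).length =
      l.countP (fun x => decide (x ≤ p)) := by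
  induction l with
  | nil => simp
  | cons a l ih =>
    rw [List.countP_cons, ← ih]
    rcases lt_trichotomy a p with h | h | h
    · simp [h, h.ne, h.le]
      omega
    · simp [h]
      omega
    · simp [h.not_ge, h.ne', h.not_gt]

lemma IsRank.of_filter_lt {l : List ℝ} {p r : ℝ} {k : ℕ}
    (h : IsRank (l.filter fun x => decide (x < p)) k r) : IsRank l k r := by
  obtain ⟨h₁, h₂, h₃⟩ := h
  rw [List.mem_filter, decide_eq_true_eq] at h₁
  rw [List.countP_filter] at h₂ h₃
  refine ⟨h₁.1, le_trans (le_of_eq ?_) h₂, h₃.trans_le (le_of_eq ?_)⟩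
  · refine List.countP_congr fun x _ => ?_
    simpa using fun h => h.trans h₁.2
  · refine List.countP_congr fun x _ => ?_
    simpa using fun h => h.trans_lt h₁.2

lemma IsRank.of_filter_gt {l : List ℝ} {p r : ℝ} {k : ℕ}
    (h : IsRank (l.filter fun x => decide (p < x)) k r) :
    IsRank l (l.countP (fun x => decide (x ≤ p)) + k) r := by
  obtain ⟨h₁, h₂, h₃⟩ := h
  rw [List.mem_filter, decide_eq_true_eq] at h₁
  have key : ∀ f : ℝ → Bool, (∀ x, x ≤ p → f x = true) → l.countP f =
      l.countP (fun x => decide (x ≤ p)) + (l.filter fun x => decide (p < x)).countP f := by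
    intro f hf
    rw [List.countP_eq_countP_filter_add l f (fun x => decide (x ≤ p)), List.countP_filter]
    congr 1
    · refine List.countP_congr fun x _ => ?_
      simpa using hf x
    · congr 1
      refine List.filter_congr fun x _ => ?_
      simp [← not_le]
  refine ⟨h₁.1, ?_, ?_⟩
  · rw [key (fun x => decide (x < r)) fun x hx => by simpa using hx.trans_lt h₁.2]
    omega
  · rw [key (fun x => decide (x ≤ r)) fun x hx => by simpa using hx.trans h₁.2.le]
    omega

/-- The pivot of the median of medians method leaves at most seven tenths of the elements, up to a
constant, on either side. -/
lemma length_filter_pivot_le {l : List ℝ} {p : ℝ}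
    (hp : IsRank (groupMedians l).val (l.length / 5 / 2) p) :
    (l.filter fun x => decide (x < p)).length + 3 * (l.length / 5 - l.length / 5 / 2) ≤ l.length ∧
    (l.filter fun x => decide (p < x)).length + 3 * (l.length / 5 / 2 + 1) ≤ l.length := by
  obtain ⟨-, h₁, h₂⟩ := hp
  have h₃ := three_mul_countP_groupMedians_le p l
  have h₄ := three_mul_countP_groupMedians_ge p l
  have h₅ := countP_lt_add_countP_le (groupMedians l).val p
  have h₆ := countP_lt_add_countP_le l p
  have h₇ : l.countP (fun x => decide (x ≤ p)) + l.countP (fun x => decide (p < x)) = l.length := by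
    rw [List.length_eq_countP_add_countP (fun x => decide (x ≤ p))]
    congr 1
    exact List.countP_congr fun x _ => by simp
  rw [length_groupMedians] at h₅
  rw [← List.countP_eq_length_filter, ← List.countP_eq_length_filter]
  omega

/-- Linear cost: the two recursive calls concern at most `n / 5` and about `7 * n / 10` elements, and
`1 / 5 + 7 / 10 < 1`; the additive constants are absorbed since lists shorter than `50` are
sorted. -/
lemma select_spec : ∀ (fuel : ℕ) (l : List ℝ) (k : ℕ), l.length ≤ fuel → k < l.length →
    IsRank l k (select fuel l k).val ∧ (select fuel l k).cost ≤ 500 * l.length + 4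
  | 0, l, k, hf, hk => by omega
  | fuel + 1, l, k, hf, hk => by
    unfold select
    by_cases hs : l.length < 50
    · simp only [Run.val_bind, Run.cost_bind, len_val, len_cost, op_val, op_cost, hs, decide_true,
        if_true]
      refine ⟨isRank_nth_isort l hk, ?_⟩
      have h₁ := isort_cost_le l
      have h₂ := nth_cost_le (isort l).val k
      rw [isort_val, List.length_insertionSort, ← isort_val] at h₂
      have h₃ : l.length * (3 * l.length + 3) ≤ l.length * 150 := by
        gcongr
        omega
      omega
    · have hg : (groupMedians l).val.length = l.length / 5 := length_groupMedians l
      obtain ⟨hp, hpc⟩ := select_spec fuel (groupMedians l).val (l.length / 5 / 2)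
        (by omega) (by omega)
      simp only [Run.val_bind, Run.cost_bind, len_val, len_cost, op_val, op_cost, hs, decide_false,
        Bool.false_eq_true, if_false, hg, partition_val, partition_cost, decide_eq_true_eq]
      set p := (select fuel (groupMedians l).val (l.length / 5 / 2)).val
      have hgc := groupMedians_cost_le l
      have hl := length_filter_pivot_le hp
      have he := length_filter_lt_add_eq l p
      have hle : l.countP (fun x => decide (x ≤ p)) ≤ l.length := List.countP_le_length
      rw [hg] at hpc
      simp only [Run.val_ite, Run.cost_ite, Run.val_bind, Run.cost_bind, op_val, op_cost,
        Run.val_pure, Run.cost_pure]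
      split_ifs with h₁ h₂
      · obtain ⟨hr, hc⟩ := select_spec fuel (l.filter fun x => decide (x < p)) k (by omega) h₁
        exact ⟨hr.of_filter_lt, by omega⟩
      · refine ⟨⟨mem_of_mem_groupMedians p l hp.1, ?_, ?_⟩, by omega⟩
        · rw [List.countP_eq_length_filter]
          omega
        · omega
      · have hsum : l.countP (fun x => decide (x ≤ p)) +
            (l.filter fun x => decide (p < x)).length = l.length := by
          rw [← List.countP_eq_length_filter,
            List.length_eq_countP_add_countP (l := l) (fun x => decide (x ≤ p))]
          congr 1
          exact List.countP_congr fun x _ => by simp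
        obtain ⟨hr, hc⟩ := select_spec fuel (l.filter fun x => decide (p < x))
          (k - l.countP (fun x => decide (x ≤ p))) (by omega) (by omega)
        rw [he]
        refine ⟨?_, by omega⟩
        have := hr.of_filter_gt
        rwa [Nat.add_sub_cancel' (by omega)] at this

lemma median_cost_le {l : List ℝ} (hl : 2 ≤ l.length) :
    (median l).cost ≤ 1001 * l.length + 14 := by
  have h₁ := (select_spec l.length l (l.length / 2) le_rfl (by omega)).2
  have h₂ := (select_spec l.length l (l.length / 2 - 1) le_rfl (by omega)).2
  simp only [median, Run.cost_bind, len_cost, len_val, op_cost, op_val, decide_eq_true_eq,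
    Run.cost_ite, add_cost, div_cost]
  split_ifs <;> omega

/-- At most half of the elements lie on either side of the median. -/
lemma median_balanced {l : List ℝ} (hl : 2 ≤ l.length) :
    2 * l.countP (fun x => decide ((median l).val < x)) ≤ l.length ∧
    2 * l.countP (fun x => decide (x < (median l).val)) ≤ l.length := by
  have hcompl : ∀ r : ℝ, l.countP (fun x => decide (x ≤ r)) +
      l.countP (fun x => decide (r < x)) = l.length := by
    intro r
    rw [List.length_eq_countP_add_countP (fun x => decide (x ≤ r))]
    congr 1
    exact List.countP_congr fun x _ => by simp
  obtain ⟨-, b₁, b₂⟩ := (select_spec l.length l (l.length / 2) le_rfl (by omega)).1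
  simp only [median, Run.val_bind, len_val, op_val, Run.val_ite, add_val, div_val,
    decide_eq_true_eq]
  split_ifs with h
  · have := hcompl (select l.length l (l.length / 2)).val
    omega
  · obtain ⟨-, a₁, a₂⟩ := (select_spec l.length l (l.length / 2 - 1) le_rfl (by omega)).1
    set b := (select l.length l (l.length / 2)).val
    set a := (select l.length l (l.length / 2 - 1)).val
    have hab : a ≤ b := by
      by_contra! hba
      have : l.countP (fun x => decide (x ≤ b)) ≤ l.countP (fun x => decide (x < a)) :=
        List.countP_mono_left fun x _ hx => by
          simp only [decide_eq_true_eq] at hx ⊢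
          exact hx.trans_lt hba
      omega
    have h₁ : l.countP (fun x => decide ((a + b) / 2 < x)) ≤ l.countP (fun x => decide (a < x)) :=
      List.countP_mono_left fun x _ hx => by
        simp only [decide_eq_true_eq] at hx ⊢
        linarith
    have h₂ : l.countP (fun x => decide (x < (a + b) / 2)) ≤ l.countP (fun x => decide (x < b)) :=
      List.countP_mono_left fun x _ hx => by
        simp only [decide_eq_true_eq] at hx ⊢
        linarith
    have := hcompl a
    omega

/-- The median of two different numbers lies strictly between them. -/
lemma median_pair_ne {x y : ℝ} (h : x ≠ y) :
    (median [x, y]).val ≠ x ∧ (median [x, y]).val ≠ y := by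
  obtain ⟨ha, -, a₁⟩ := (select_spec 2 [x, y] 0 le_rfl (by simp)).1
  obtain ⟨hb, -, b₁⟩ := (select_spec 2 [x, y] 1 le_rfl (by simp)).1
  obtain ⟨-, a₂, -⟩ := (select_spec 2 [x, y] 0 le_rfl (by simp)).1
  have hm : (median [x, y]).val =
      ((select 2 [x, y] 0).val + (select 2 [x, y] 1).val) / 2 := by
    simp [median]
  rw [hm]
  set a := (select 2 [x, y] 0).val
  set b := (select 2 [x, y] 1).val
  simp only [List.mem_cons, List.not_mem_nil, or_false] at ha hb
  simp only [List.countP_cons, List.countP_nil, decide_eq_true_eq] at a₂ b₁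
  have hab : a ≠ b := by
    intro hab
    rw [← hab] at b₁
    rcases ha with ha | ha <;> rw [ha] at a₂ b₁ <;> rcases lt_or_gt_of_ne h with h' | h' <;>
      simp [h', h'.not_ge] at a₂ b₁
  rcases ha with ha | ha <;> rcases hb with hb | hb <;>
    first
    | exact absurd (ha.trans hb.symm) hab
    | rw [ha, hb]
      constructor <;> intro he <;> exact h (by linarith)

/-! ### Splitting a cluster -/

variable {d : ℕ}

lemma coords_val {l : ℕ} (h : l < d) : ∀ v : List (Pt d),
    (coords l v).val = v.map fun x => x ⟨l, h⟩
  | [] => rfl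
  | x :: v => by simp [coords, coords_val h v, coord_val x h]

lemma length_coords (l : ℕ) : ∀ v : List (Pt d), (coords l v).val.length = v.length
  | [] => rfl
  | x :: v => by simp [coords, length_coords l v]

lemma coords_cost (l : ℕ) : ∀ v : List (Pt d), (coords l v).cost = 3 * v.length + 1
  | [] => rfl
  | x :: v => by
    simp only [coords, Run.cost_bind, coord_cost, coords_cost l v, store_cost, List.length_cons]
    omega

lemma minimum_cost : ∀ (l : List ℝ) (a : ℝ), (minimum a l).cost = l.length + 1
  | [], _ => rfl
  | b :: l, a => by
    simp only [minimum, Run.cost_bind, lt_cost, lt_val, decide_eq_true_eq, Run.cost_ite,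
      minimum_cost l, ite_self, List.length_cons]
    omega

lemma maximum_cost : ∀ (l : List ℝ) (a : ℝ), (maximum a l).cost = l.length + 1
  | [], _ => rfl
  | b :: l, a => by
    simp only [maximum, Run.cost_bind, lt_cost, lt_val, decide_eq_true_eq, Run.cost_ite,
      maximum_cost l, ite_self, List.length_cons]
    omega

lemma minimum_spec : ∀ (l : List ℝ) (a : ℝ),
    (minimum a l).val ∈ a :: l ∧ ∀ b ∈ a :: l, (minimum a l).val ≤ b
  | [], a => by simp [minimum]
  | b :: l, a => by
    obtain ⟨ha₁, ha₂⟩ := minimum_spec l a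
    obtain ⟨hb₁, hb₂⟩ := minimum_spec l b
    simp only [minimum, Run.val_bind, lt_val, decide_eq_true_eq, Run.val_ite]
    simp only [List.mem_cons, forall_eq_or_imp] at *
    split_ifs with h
    · exact ⟨by tauto, by linarith [hb₂.1], hb₂⟩
    · exact ⟨by tauto, ha₂.1, by linarith [ha₂.1], ha₂.2⟩

lemma maximum_spec : ∀ (l : List ℝ) (a : ℝ),
    (maximum a l).val ∈ a :: l ∧ ∀ b ∈ a :: l, b ≤ (maximum a l).val
  | [], a => by simp [maximum]
  | b :: l, a => by
    obtain ⟨ha₁, ha₂⟩ := maximum_spec l a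
    obtain ⟨hb₁, hb₂⟩ := maximum_spec l b
    simp only [maximum, Run.val_bind, lt_val, decide_eq_true_eq, Run.val_ite]
    simp only [List.mem_cons, forall_eq_or_imp] at *
    split_ifs with h
    · exact ⟨by tauto, by linarith [hb₂.1], hb₂⟩
    · exact ⟨by tauto, ha₂.1, by linarith [ha₂.1], ha₂.2⟩

/-- `B` is the smallest axis-parallel box containing `v`: the bounds hold and are attained. -/
structure IsBoundingBox (B : Box) (v : List (Pt d)) : Prop where
  lo_le : ∀ i : Fin d, ∀ x ∈ v, B.lo i ≤ x i
  le_hi : ∀ i : Fin d, ∀ x ∈ v, x i ≤ B.hi i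
  exists_eq_lo : ∀ i : Fin d, ∃ x ∈ v, x i = B.lo i
  exists_eq_hi : ∀ i : Fin d, ∃ x ∈ v, x i = B.hi i

lemma boundingBox_spec {v : List (Pt d)} (hv : v ≠ []) : IsBoundingBox (boundingBox v).val v := by
  obtain ⟨a, r, hr⟩ := List.exists_cons_of_ne_nil hv
  have key : ∀ i : Fin d, (∀ x ∈ v, (boundingBox v).val.lo i ≤ x i) ∧
      (∃ x ∈ v, x i = (boundingBox v).val.lo i) ∧ (∀ x ∈ v, x i ≤ (boundingBox v).val.hi i) ∧
      (∃ x ∈ v, x i = (boundingBox v).val.hi i) := by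
    intro i
    have hc : (coords (i : ℕ) v).val = a i :: r.map fun x => x i := by
      rw [coords_val i.2, hr]
      rfl
    have hlo : (boundingBox v).val.lo i = (minimum (a i) (r.map fun x => x i)).val := by
      simp only [boundingBox, Run.val_bind, store_val]
      rw [arr_val _ i.2, Run.val_bind, hc]
    have hhi : (boundingBox v).val.hi i = (maximum (a i) (r.map fun x => x i)).val := by
      simp only [boundingBox, Run.val_bind, store_val]
      rw [arr_val _ i.2, Run.val_bind, hc]
    have hm : a i :: (r.map fun x => x i) = v.map fun x => x i := by rw [hr]; rfl
    obtain ⟨h₁, h₂⟩ := minimum_spec (r.map fun x => x i) (a i)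
    obtain ⟨h₃, h₄⟩ := maximum_spec (r.map fun x => x i) (a i)
    rw [hm] at h₁ h₂ h₃ h₄
    rw [← hlo] at h₁ h₂
    rw [← hhi] at h₃ h₄
    exact ⟨fun x hx => h₂ _ (List.mem_map_of_mem hx), List.mem_map.1 h₁,
      fun x hx => h₄ _ (List.mem_map_of_mem hx), List.mem_map.1 h₃⟩
  exact ⟨fun i => (key i).1, fun i => (key i).2.2.1, fun i => (key i).2.1, fun i => (key i).2.2.2⟩

lemma boundingBox_cost_le (v : List (Pt d)) :
    (boundingBox v).cost ≤ 2 * (d * (4 * v.length + 4) + 1) + 4 := by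
  simp only [boundingBox, Run.cost_bind, store_cost]
  grw [arr_cost_le _ (4 * v.length + 2), arr_cost_le _ (4 * v.length + 2)]
  · linarith
  all_goals
    intro l _
    have := length_coords l v
    rw [Run.cost_bind, coords_cost]
    split <;> simp_all [minimum_cost, maximum_cost] <;> omega

lemma longestEdge_cost_le (B : Box) : (longestEdge d B).cost ≤ 5 * d + 4 := by
  have : ∀ s, (iter (fun l s => do
      let e ← edge B l
      let t ← lt s.2 e
      if t then pure (l, e) else pure s) d (s : ℕ × ℝ)).cost ≤ d * (4 + 1) + 1 := by
    intro s
    refine iter_cost_le _ _ _ _ fun l _ s => ?_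
    simp [edge]
  simp only [longestEdge, Run.cost_bind, edge, Run.val_bind, op_cost, sub_cost, op_val, sub_val,
    Run.cost_pure] at this ⊢
  grw [this]
  omega

lemma longestEdge_spec (hd : 0 < d) (B : Box) :
    (longestEdge d B).val < d ∧ ∀ l < d, B.hi l - B.lo l ≤
      B.hi (longestEdge d B).val - B.lo (longestEdge d B).val := by
  have key : ∀ n ≤ d, ∀ s : ℕ × ℝ, s = (iter (fun l s => do
      let e ← edge B l
      let t ← lt s.2 e
      if t then pure (l, e) else pure s) n ((0, B.hi 0 - B.lo 0) : ℕ × ℝ)).val →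
      s.1 < d ∧ s.2 = B.hi s.1 - B.lo s.1 ∧ ∀ l < n, B.hi l - B.lo l ≤ s.2 := by
    intro n
    induction n with
    | zero =>
      rintro - s rfl
      exact ⟨hd, rfl, by simp⟩
    | succ n ih =>
      intro hn s hs
      obtain ⟨h₁, h₂, h₃⟩ := ih (by omega) _ rfl
      simp only [iter, Run.val_bind, op_val, edge, sub_val, lt_val, decide_eq_true_eq, Run.val_ite,
        Run.val_pure] at hs h₁ h₂ h₃
      split_ifs at hs with h <;> subst hs
      · refine ⟨hn, rfl, fun l hl => ?_⟩
        rcases Nat.lt_succ_iff_lt_or_eq.1 hl with hl | rfl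
        · exact (h₃ l hl).trans h.le
        · exact le_rfl
      · refine ⟨h₁, h₂, fun l hl => ?_⟩
        rcases Nat.lt_succ_iff_lt_or_eq.1 hl with hl | rfl
        · exact h₃ l hl
        · exact not_lt.1 h
  obtain ⟨h₁, h₂, h₃⟩ := key d le_rfl _ rfl
  rw [h₂] at h₃
  exact ⟨h₁, h₃⟩

lemma above_val (l : ℕ) (m : ℝ) : ∀ v : List (Pt d),
    (above l m v).val = v.filter fun x => decide (m < (coord x l).val)
  | [] => rfl
  | x :: v => by
    simp only [above, Run.val_bind, above_val l m v, lt_val, decide_eq_true_eq, Run.val_ite,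
      store_val, Run.val_pure, List.filter_cons]

lemma above_cost_le (l : ℕ) (m : ℝ) : ∀ v : List (Pt d), (above l m v).cost ≤ 4 * v.length + 1
  | [] => by simp [above]
  | x :: v => by
    have := above_cost_le l m v
    simp only [above, Run.cost_bind, coord_cost, lt_cost, lt_val, decide_eq_true_eq, Run.cost_ite,
      store_cost, Run.cost_pure, List.length_cons]
    split_ifs <;> omega

lemma distribute_cost_le (l : ℕ) (m : ℝ) (n : ℕ) : ∀ (v : List (Pt d))
    (s : List (Pt d) × ℕ × List (Pt d)), (distribute l m n v s).cost ≤ 6 * v.length + 1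
  | [], s => by simp [distribute]
  | x :: v, s => by
    have := distribute_cost_le l m n v
    simp only [distribute, Run.cost_bind, coord_cost, op_cost, le_cost, Run.cost_ite,
      store_cost, Run.cost_pure, List.length_cons, op_val, le_val, decide_eq_true_eq,
      Bool.and_eq_true, store_val, Run.val_pure]
    split_ifs <;> grw [this] <;> omega

/-- The two sons returned by the second loop. The first one is filled up to just above `n / 2`
elements with points on the splitting hyperplane; if it stays below, the second one has only points
strictly below the hyperplane. -/
lemma distribute_spec {l : ℕ} {m : ℝ} {n : ℕ} : ∀ (v F S : List (Pt d)),
    let s := (distribute l m n v (F, F.length, S)).val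
    (s.1 ++ s.2.2).Perm (F ++ S ++ v.filter fun x => decide ((coord x l).val ≤ m)) ∧
    (∀ x ∈ s.1, x ∈ F ∨ (coord x l).val = m) ∧ (∀ x ∈ s.2.2, x ∈ S ∨ (coord x l).val ≤ m) ∧
    F.length ≤ s.1.length ∧ (2 * F.length ≤ n + 2 → 2 * s.1.length ≤ n + 2) ∧
    (2 * s.1.length ≤ n → s.2.2.length = S.length +
      v.countP fun x => decide ((coord x l).val < m))
  | [], F, S => by simp [distribute]; tauto
  | x :: v, F, S => by
    have hroom : ((F.length : ℝ) ≤ (n : ℝ) / 2) ↔ 2 * F.length ≤ n := by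
      rw [le_div_iff₀ two_pos, mul_comm]
      exact_mod_cast Iff.rfl
    have hval : (distribute l m n (x :: v) (F, F.length, S)).val =
        if 2 * F.length ≤ n ∧ (coord x l).val = m then
          (distribute l m n v (x :: F, (x :: F).length, S)).val
        else if (coord x l).val ≤ m then (distribute l m n v (F, F.length, x :: S)).val
        else (distribute l m n v (F, F.length, S)).val := by
      simp only [distribute, Run.val_bind, op_val, le_val, decide_eq_true_eq, Bool.and_eq_true,
        Run.val_ite, store_val, Run.val_pure, hroom, List.length_cons]
    rw [hval]
    split_ifs with h₁ h₂
    · obtain ⟨i₁, i₂, i₃, i₄, i₅, i₆⟩ := distribute_spec v (x :: F) S (l := l) (m := m) (n := n)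
      set s := (distribute l m n v (x :: F, (x :: F).length, S)).val
      simp only [List.length_cons] at i₄ i₅ i₆
      refine ⟨?_, ?_, i₃, by omega, fun _ => i₅ (by omega), ?_⟩
      · rw [List.filter_cons_of_pos (by simp [h₁.2])]
        refine i₁.trans ?_
        rw [List.cons_append, List.cons_append]
        exact List.perm_middle.symm
      · intro y hy
        rcases i₂ y hy with h | h
        · rcases List.mem_cons.1 h with rfl | h
          · exact Or.inr h₁.2
          · exact Or.inl h
        · exact Or.inr h
      · rw [List.countP_cons_of_neg (by simp [h₁.2])]
        exact i₆
    · obtain ⟨i₁, i₂, i₃, i₄, i₅, i₆⟩ := distribute_spec v F (x :: S) (l := l) (m := m) (n := n)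
      set s := (distribute l m n v (F, F.length, x :: S)).val
      simp only [List.length_cons] at i₆
      refine ⟨?_, i₂, ?_, i₄, i₅, ?_⟩
      · rw [List.filter_cons_of_pos (by simpa using h₂)]
        refine i₁.trans ?_
        rw [List.append_assoc, List.append_assoc]
        exact List.Perm.append_left F (by simpa using List.perm_middle.symm)
      · intro y hy
        rcases i₃ y hy with h | h
        · rcases List.mem_cons.1 h with rfl | h
          · exact Or.inr h₂
          · exact Or.inl h
        · exact Or.inr h
      · intro hs
        have : (coord x l).val < m := lt_of_le_of_ne h₂ fun he => h₁ ⟨by omega, he⟩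
        rw [List.countP_cons_of_pos (by simpa using this)]
        have := i₆ hs
        omega
    · obtain ⟨i₁, i₂, i₃, i₄, i₅, i₆⟩ := distribute_spec v F S (l := l) (m := m) (n := n)
      set s := (distribute l m n v (F, F.length, S)).val
      refine ⟨?_, i₂, i₃, i₄, i₅, ?_⟩
      · rw [List.filter_cons_of_neg (by simpa using h₂)]
        exact i₁
      · rw [List.countP_cons_of_neg (by simpa using le_of_not_ge h₂)]
        exact i₆

/-- The sons of a cluster of at least two distinct points partition it, are separated by a
hyperplane orthogonal to a longest edge, and have at most three quarters of its points each. -/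
lemma splitCluster_spec (hd : 0 < d) {B : Box} {v : List (Pt d)} (hB : IsBoundingBox B v)
    (hv : v.Nodup) (h2 : 2 ≤ v.length) :
    ((splitCluster B v).val.1 ++ (splitCluster B v).val.2).Perm v ∧
    4 * (splitCluster B v).val.1.length ≤ 3 * v.length ∧
    4 * (splitCluster B v).val.2.length ≤ 3 * v.length ∧
    ∃ c : Fin d, (∀ i : Fin d, B.hi i - B.lo i ≤ B.hi c - B.lo c) ∧
      ∀ x ∈ (splitCluster B v).val.1, ∀ y ∈ (splitCluster B v).val.2, y c ≤ x c := by
  obtain ⟨hc, hmax⟩ := longestEdge_spec hd B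
  set c : Fin d := ⟨(longestEdge d B).val, hc⟩ with hcdef
  have hco : ∀ x : Pt d, (coord x (longestEdge d B).val).val = x c := fun x => coord_val x hc
  have hlong : ∀ i : Fin d, B.hi i - B.lo i ≤ B.hi c - B.lo c := fun i => hmax i i.2
  have hmap : (coords (longestEdge d B).val v).val = v.map fun x => x c := coords_val hc v
  set m := (median (coords (longestEdge d B).val v).val).val with hm
  have hbal := median_balanced (l := (coords (longestEdge d B).val v).val)
    (by rwa [length_coords])
  rw [← hm, length_coords, hmap, List.countP_map, List.countP_map] at hbal
  set u := v.filter fun x => decide (m < (coord x (longestEdge d B).val).val) with hu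
  have hlu : 2 * u.length ≤ v.length := by
    rw [hu, ← List.countP_eq_length_filter]
    refine le_trans (le_of_eq ?_) hbal.1
    congr 1
    exact List.countP_congr fun x _ => by simp [hco]
  have hval : (splitCluster B v).val =
      ((distribute (longestEdge d B).val m v.length v (u, u.length, [])).val.1,
      (distribute (longestEdge d B).val m v.length v (u, u.length, [])).val.2.2) := by
    simp only [splitCluster, Run.val_bind, above_val, len_val, Run.val_pure, ← hm, ← hu]
  obtain ⟨i₁, i₂, i₃, i₄, i₅, i₆⟩ :=
    distribute_spec (l := (longestEdge d B).val) (m := m) (n := v.length) v u []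
  rw [hval]
  set s := (distribute (longestEdge d B).val m v.length v (u, u.length, [])).val
  have hperm : (s.1 ++ s.2.2).Perm v := by
    refine i₁.trans ?_
    rw [List.append_nil]
    have h := List.filter_append_perm
      (fun x : Pt d => decide (m < (coord x (longestEdge d B).val).val)) v
    refine List.Perm.trans (List.Perm.of_eq ?_) h
    rw [hu]
    congr 1
    exact List.filter_congr fun x _ => by simp [← not_lt]
  have hlen : s.1.length + s.2.2.length = v.length := by
    rw [← List.length_append, hperm.length_eq]
  have hgt : ∀ x ∈ s.1, m < x c ∨ x c = m := by
    intro x hx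
    rcases i₂ x hx with h | h
    · rw [hu, List.mem_filter, decide_eq_true_eq, hco] at h
      exact Or.inl h.2
    · rw [hco] at h
      exact Or.inr h
  have hle : ∀ x ∈ s.2.2, x c ≤ m := by
    intro x hx
    rcases i₃ x hx with h | h
    · simp at h
    · rwa [hco] at h
  refine ⟨hperm, ?_, ?_, c, hlong, ?_⟩
  · change 4 * s.1.length ≤ 3 * v.length
    have hs := i₅ (by omega)
    -- The first son has at most `n / 2 + 1` points; this is at most `3 * n / 4` unless `n = 2`.
    rcases Nat.lt_or_ge 2 v.length with h3 | h3
    · omega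
    -- Two distinct points: the median is not attained, so only points above it come first.
    · have h2' : v.length = 2 := by omega
      obtain ⟨x, y, hxy⟩ := List.length_eq_two.1 h2'
      have hne : x ≠ y := by
        rw [hxy] at hv
        simpa using hv
      have hcne : x c ≠ y c := by
        intro he
        refine hne ?_
        ext i
        obtain ⟨a, ha, ha'⟩ := hB.exists_eq_lo c
        obtain ⟨b, hb, hb'⟩ := hB.exists_eq_hi c
        have h0 : B.hi c - B.lo c = 0 := by
          rw [hxy] at ha hb
          simp only [List.mem_cons, List.not_mem_nil, or_false] at ha hb
          rcases ha with rfl | rfl <;> rcases hb with rfl | rfl <;> linarith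
        have hx : x ∈ v := by simp [hxy]
        have hy : y ∈ v := by simp [hxy]
        linarith [hlong i, hB.lo_le i x hx, hB.le_hi i x hx, hB.lo_le i y hy, hB.le_hi i y hy]
      have hmne := median_pair_ne hcne
      have hmne' : m ≠ x c ∧ m ≠ y c := by
        have : m = (median [x c, y c]).val := by rw [hm, hmap, hxy]; rfl
        rwa [this]
      have hall : s.1.countP (fun z => decide (m < z c)) = s.1.length := by
        rw [List.countP_eq_length]
        intro z hz
        rcases hgt z hz with h | h
        · simpa using h
        · have : z ∈ v := hperm.mem_iff.1 (List.mem_append_left _ hz)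
          rw [hxy] at this
          simp only [List.mem_cons, List.not_mem_nil, or_false] at this
          rcases this with rfl | rfl
          · exact absurd h.symm hmne'.1
          · exact absurd h.symm hmne'.2
      have hcnt := hperm.countP_eq (fun z => decide (m < z c))
      rw [List.countP_append, hall] at hcnt
      have h1 : 2 * v.countP (fun z => decide (m < z c)) ≤ v.length := hbal.1
      omega
  · change 4 * s.2.2.length ≤ 3 * v.length
    by_cases hs : 2 * s.1.length ≤ v.length
    · have h₁ := i₆ hs
      have h₂ : v.countP (fun x => decide ((coord x (longestEdge d B).val).val < m)) =
          v.countP ((fun x => decide (x < m)) ∘ fun x : Pt d => x c) :=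
        List.countP_congr fun x _ => by simp [hco]
      rw [h₂] at h₁
      simp only [List.length_nil] at h₁
      omega
    · omega
  · intro x hx y hy
    have := hle y hy
    rcases hgt x hx with h | h <;> linarith

lemma splitCluster_cost_le (B : Box) {v : List (Pt d)} (h2 : 2 ≤ v.length) :
    (splitCluster B v).cost ≤ 1016 * v.length + 5 * d + 30 := by
  have h₁ := longestEdge_cost_le (d := d) B
  have h₂ := median_cost_le (l := (coords (longestEdge d B).val v).val) (by rwa [length_coords])
  rw [length_coords] at h₂
  simp only [splitCluster, Run.cost_bind, coords_cost, len_cost, len_val, Run.cost_pure, above_val]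
  grw [above_cost_le, distribute_cost_le, List.length_filter_le]
  omega

/-! ### The cluster tree -/

/-- The data of all nodes. -/
def Tree.toList {α : Type} : Tree α → List α
  | .leaf a => [a]
  | .node a l r => a :: (l.toList ++ r.toList)

/-- Apply a function to the data of all nodes. -/
def Tree.map {α β : Type} (f : α → β) : Tree α → Tree β
  | .leaf a => .leaf (f a)
  | .node a l r => .node (f a) (l.map f) (r.map f)

/-- The sum of the cardinalities of all clusters of a tree. -/
def Tree.weight (t : Tree (Cluster d)) : ℕ := (t.toList.map fun c => c.pts.length).sum

/-- The cluster trees that median splitting yields: leaves have at most `m` points, the sons of any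
other cluster partition it into parts with at most three quarters of its points, separated by a
hyperplane orthogonal to a longest edge of its bounding box. -/
def IsBisection (m : ℕ) : Tree (Cluster d) → Prop
  | .leaf c => c.pts ≠ [] ∧ c.pts.Nodup ∧ IsBoundingBox c.box c.pts ∧ c.pts.length ≤ m
  | .node c l r => c.pts ≠ [] ∧ c.pts.Nodup ∧ IsBoundingBox c.box c.pts ∧
      (l.label.pts ++ r.label.pts).Perm c.pts ∧
      4 * l.label.pts.length ≤ 3 * c.pts.length ∧ 4 * r.label.pts.length ≤ 3 * c.pts.length ∧
      (∃ i : Fin d, (∀ j : Fin d, c.box.hi j - c.box.lo j ≤ c.box.hi i - c.box.lo i) ∧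
        ∀ x ∈ l.label.pts, ∀ y ∈ r.label.pts, y i ≤ x i) ∧
      IsBisection m l ∧ IsBisection m r

lemma IsBisection.label {m : ℕ} : ∀ {t : Tree (Cluster d)}, IsBisection m t →
    t.label.pts ≠ [] ∧ t.label.pts.Nodup ∧ IsBoundingBox t.label.box t.label.pts
  | .leaf _, h => ⟨h.1, h.2.1, h.2.2.1⟩
  | .node _ _ _, h => ⟨h.1, h.2.1, h.2.2.1⟩

lemma clusterTree_succ (τ : ℝ) (fuel : ℕ) (v : List (Pt d)) : clusterTree τ (fuel + 1) v = (do
    let n ← len v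
    let B ← boundingBox v
    let c ← store (n + 3) (⟨v, B⟩ : Cluster d)
    let big ← le τ n
    match big with
    | true => do
      let s ← splitCluster B v
      let l ← clusterTree τ fuel s.1
      let r ← clusterTree τ fuel s.2
      store 3 (.node c l r)
    | false => store 1 (.leaf c)) := by
  delta clusterTree clusterTree._f
  dsimp only
  refine congrArg (Bind.bind _) (funext fun n => congrArg (Bind.bind _) (funext fun B =>
    congrArg (Bind.bind _) (funext fun c => congrArg (Bind.bind _) (funext fun big => ?_))))
  cases big <;> rfl

lemma clusterTree_spec (hd : 0 < d) {τ : ℝ} (hτ : 1 < τ) {m : ℕ} (hm : τ < m + 1) :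
    ∀ (fuel : ℕ) (v : List (Pt d)), v ≠ [] → v.Nodup → v.length ≤ fuel →
      IsBisection m (clusterTree τ fuel v).val ∧ (clusterTree τ fuel v).val.label.pts = v ∧
      (clusterTree τ fuel v).cost ≤ (1100 + 21 * d) * (clusterTree τ fuel v).val.weight
  | 0, v, hv, _, hf => absurd (List.length_eq_zero_iff.1 (by omega)) hv
  | fuel + 1, v, hv, hn, hf => by
    have hpos : 0 < v.length := List.length_pos_iff.2 hv
    have hB := boundingBox_spec hv
    have hBc := boundingBox_cost_le v
    have hdl : d ≤ d * v.length := Nat.le_mul_of_pos_right d hpos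
    rw [clusterTree_succ]
    by_cases hbig : τ ≤ v.length
    · have h2 : 2 ≤ v.length := by
        have : (1 : ℝ) < v.length := hτ.trans_le hbig
        exact_mod_cast this
      obtain ⟨hperm, hl, hr, hsep⟩ := splitCluster_spec hd hB hn h2
      have hsc := splitCluster_cost_le (boundingBox v).val h2
      have hlen := hperm.length_eq
      rw [List.length_append] at hlen
      have hnd := hperm.symm.nodup hn
      have ihl := clusterTree_spec hd hτ hm fuel (splitCluster (boundingBox v).val v).val.1
        (List.length_pos_iff.1 (by omega)) hnd.of_append_left (by omega)
      have ihr := clusterTree_spec hd hτ hm fuel (splitCluster (boundingBox v).val v).val.2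
        (List.length_pos_iff.1 (by omega)) hnd.of_append_right (by omega)
      simp only [Run.val_bind, Run.cost_bind, len_val, len_cost, store_val, store_cost, le_val,
        le_cost, hbig, decide_true]
      obtain ⟨hl₁, hl₂, hl₃⟩ := ihl
      obtain ⟨hr₁, hr₂, hr₃⟩ := ihr
      refine ⟨⟨hv, hn, hB, ?_, ?_, ?_, ?_, hl₁, hr₁⟩, rfl, ?_⟩
      · rwa [hl₂, hr₂]
      · rwa [hl₂]
      · rwa [hr₂]
      · rwa [hl₂, hr₂]
      · simp only [Tree.weight, Tree.toList, List.map_cons, List.sum_cons, List.map_append,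
          List.sum_append] at hl₃ hr₃ ⊢
        have hK : ∀ a b : ℕ, (1100 + 21 * d) * (v.length + (a + b)) = 1100 * v.length +
            21 * (d * v.length) + (1100 + 21 * d) * a + (1100 + 21 * d) * b := by
          intro a b
          ring
        rw [hK]
        have : d * (4 * v.length + 4) = 4 * (d * v.length) + 4 * d := by ring
        omega
    · simp only [Run.val_bind, Run.cost_bind, len_val, len_cost, store_val, store_cost, le_val,
        le_cost, hbig, decide_false]
      refine ⟨⟨hv, hn, hB, ?_⟩, rfl, ?_⟩
      · have : (v.length : ℝ) < (m : ℝ) + 1 := (not_le.1 hbig).trans hm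
        exact Nat.lt_succ_iff.1 (by exact_mod_cast this)
      · simp only [Tree.weight, Tree.toList, List.map_cons, List.map_nil, List.sum_cons,
          List.sum_nil, add_zero]
        have : (1100 + 21 * d) * v.length = 1100 * v.length + 21 * (d * v.length) := by ring
        have : d * (4 * v.length + 4) = 4 * (d * v.length) + 4 * d := by ring
        omega

/-! ### Samplet basis and multiscale cluster basis: bounded cost per cluster -/

lemma Tree.label_map {α β : Type} (f : α → β) (t : Tree α) : (t.map f).label = f t.label := by
  cases t <;> rfl

lemma Tree.toList_map {α β : Type} (f : α → β) : ∀ t : Tree α,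
    (t.map f).toList = t.toList.map f
  | .leaf _ => rfl
  | .node _ l r => by simp [Tree.map, Tree.toList, toList_map f l, toList_map f r]

lemma Tree.toList_eq_cons {α : Type} (t : Tree α) : t.toList = t.label :: t.toList.tail := by
  cases t <;> rfl

lemma Tree.label_mem_toList {α : Type} (t : Tree α) : t.label ∈ t.toList := by
  rw [Tree.toList_eq_cons]
  exact List.mem_cons_self

lemma exists_monomial_cost_le (d q : ℕ) : ∃ K, ∀ i < mq d q, ∀ x : Pt d,
    (monomial ((multiIndices d q).getD i []) x).cost ≤ K := by
  set E := (Finset.range (mq d q) ×ˢ Finset.range d).sup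
    fun p => ((multiIndices d q).getD p.1 []).getD p.2 0 with hE
  refine ⟨d * (E * 3 + 5) + 1, fun i hi x => ?_⟩
  refine (prodTo_cost_le _ (E * 3 + 3) d fun l hl => ?_).trans le_rfl
  have hle : ((multiIndices d q).getD i []).getD l 0 ≤ E :=
    Finset.le_sup (f := fun p : ℕ × ℕ => ((multiIndices d q).getD p.1 []).getD p.2 0)
      (b := (i, l)) (by simp [hi, hl])
  have hp := prodTo_cost_le (fun _ => op (coord x l).val) 1
    (((multiIndices d q).getD i []).getD l 0) fun _ _ => le_rfl
  simp only [Run.cost_bind, coord_cost, op_cost, op_val]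
  omega

/-- The numbers of scaling functions and of all functions of every cluster are at most `M` and
`2 * M`. -/
def BoundedDim (M : ℕ) (v : SampletCluster d) : Prop := v.nPhi ≤ M ∧ v.dim ≤ 2 * M

lemma exists_sampletBasis_cost_le (d q : ℕ) : ∃ K, ∀ t : Tree (Cluster d),
    IsBisection (mq d q) t →
      (sampletBasis q t).val.1.map SampletCluster.toCluster = t ∧
      (∀ v ∈ (sampletBasis q t).val.1.toList, BoundedDim (mq d q) v) ∧
      (sampletBasis q t).cost ≤ K * t.toList.length := by
  obtain ⟨E, hE⟩ := exists_monomial_cost_le d q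
  set M := mq d q with hM
  refine ⟨3 * M + 11 + buildBound M (E + 2) + (buildBound (2 * M) 2 + buildBound (2 * M) 1 +
    qrBound (2 * M) + buildBound (2 * M) (2 * M * 5 + 1) + 20), ?_⟩
  intro t
  induction t with
  | leaf c =>
    rintro ⟨-, -, -, hlen⟩
    refine ⟨rfl, ?_, ?_⟩
    · simp only [sampletBasis, Run.val_bind, Run.val_pure, store_val, Tree.toList,
        List.mem_singleton, forall_eq, BoundedDim, SampletCluster.dim, len_val]
      omega
    · have hb := build_cost_le_of_le (r := M) (c := c.pts.length) (m := M) (a := E + 2) le_rfl hlen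
        (f := fun i j => do
          let y ← op (c.pts.getD j 0)
          let α ← op ((multiIndices d q).getD i [])
          monomial α y) (fun i hi j _ => by
            have := hE i hi (c.pts.getD j 0)
            simp only [Run.cost_bind, op_cost, op_val]
            omega)
      simp only [sampletBasis, Run.cost_bind, len_cost, len_val, store_cost, store_val,
        Run.cost_pure, Tree.toList, List.length_singleton, ← hM]
      omega
  | node c l r ihl ihr =>
    rintro ⟨-, -, -, -, -, -, -, hl, hr⟩
    obtain ⟨hl₁, hl₂, hl₃⟩ := ihl hl
    obtain ⟨hr₁, hr₂, hr₃⟩ := ihr hr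
    have hnl := (hl₂ _ (Tree.label_mem_toList _)).1
    have hnr := (hr₂ _ (Tree.label_mem_toList _)).1
    refine ⟨?_, ?_, ?_⟩
    · simp only [sampletBasis, Run.val_bind, Run.val_pure, store_val, Tree.map, hl₁, hr₁]
    · simp only [sampletBasis, Run.val_bind, Run.val_pure, store_val, op_val, Tree.toList,
        List.mem_cons, List.mem_append, ← hM]
      rintro v (rfl | hv | hv)
      · simp only [BoundedDim, SampletCluster.dim]
        omega
      · exact hl₂ v hv
      · exact hr₂ v hv
    · simp only [sampletBasis, Run.cost_bind, op_cost, op_val, store_cost, store_val,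
        Run.cost_pure, Tree.toList, List.length_cons, List.length_append, ← hM]
      grw [hcat_cost_le (m := 2 * M) (by omega) (by omega),
        transpose_cost_le (m := 2 * M) (by omega) (by omega),
        qr_cost_le (M := 2 * M) (by omega) (by omega),
        matMul_cost_le (m := 2 * M) (by omega) (by omega) (by omega), hl₃, hr₃]
      linarith

lemma lagrange_cost_le (d n : ℕ) (xi : Mat) (a : ℕ) (x : ℕ → Run ℝ) (hx : ∀ l, (x l).cost ≤ 2) :
    (lagrange d n xi a x).cost ≤ d * (n * 10 + 4) + 1 := by
  refine prodTo_cost_le _ (n * 10 + 2) d fun l _ => ?_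
  have h : ∀ al : ℕ, (prodTo (fun i => do
      let same ← op (decide (i = al))
      if same then op 1 else do
        let y ← x l
        let z ← get xi i l
        let w ← get xi al l
        let u ← sub y z
        let t ← sub w z
        div u t) n).cost ≤ n * (8 + 2) + 1 := by
    intro al
    refine prodTo_cost_le _ 8 n fun i _ => ?_
    have := hx l
    simp only [Run.cost_bind, op_cost, op_val, decide_eq_true_eq, Run.cost_ite, get_cost,
      sub_cost, div_cost]
    split_ifs <;> omega
  rw [Run.cost_bind, op_cost]
  grw [h]
  omega

lemma tensorCoord_cost (n : ℕ) (xi : Mat) (a l : ℕ) : (tensorCoord n xi a l).cost = 2 := rfl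

lemma interpolationPoints_cost_le {n : ℕ} (ξ : List (Pt d) → Fin n → Pt d) (v : List (Pt d)) :
    (interpolationPoints ξ v).cost ≤ buildBound (n + d) 1 :=
  build_cost_le_of_le (by omega) (by omega) fun i _ l _ => by
    split_ifs
    simp

lemma transferMatrix_cost_le (d n : ℕ) (xi xison : Mat) :
    (transferMatrix d n xi xison).cost ≤ buildBound (n ^ d) (d * (n * 10 + 4) + 1) :=
  build_cost_le_of_le le_rfl le_rfl fun _ _ _ _ =>
    lagrange_cost_le d n _ _ _ fun _ => (tensorCoord_cost n _ _ _).le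

lemma exists_interpolation_cost_le (d n M : ℕ) : ∃ K, ∀ (ξ : List (Pt d) → Fin n → Pt d)
    (t : Tree (SampletCluster d)), (∀ v ∈ t.toList, BoundedDim M v) →
      (interpolation ξ t).val.map InterpCluster.toSampletCluster = t ∧
      (interpolation ξ t).cost ≤ K * t.toList.length := by
  set L := d * (n * 10 + 4) + 1
  refine ⟨buildBound (n + d) 1 + 2 * M + buildBound (M + n ^ d) (L + 1) + 20 +
    2 * buildBound (n ^ d) L, fun ξ t => ?_⟩
  induction t with
  | leaf c =>
    intro h
    obtain ⟨hM, -⟩ := h c (by simp [Tree.toList])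
    refine ⟨rfl, ?_⟩
    simp only [interpolation, Run.cost_bind, store_cost, store_val, Tree.toList,
      List.length_singleton]
    grw [interpolationPoints_cost_le, build_cost_le_of_le (m := M + n ^ d) (a := L + 1)
      (by omega) (by omega)]
    · omega
    · intro i _ a _
      rw [Run.cost_bind, op_cost]
      grw [lagrange_cost_le]
      · omega
      · exact fun l => by rw [coord_cost]; omega
  | node c l r ihl ihr =>
    intro h
    obtain ⟨hl₁, hl₂⟩ := ihl fun v hv => h v (by simp [Tree.toList, hv])
    obtain ⟨hr₁, hr₂⟩ := ihr fun v hv => h v (by simp [Tree.toList, hv])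
    refine ⟨?_, ?_⟩
    · simp only [interpolation, Run.val_bind, store_val, Tree.map, hl₁, hr₁]
    · simp only [interpolation, Run.cost_bind, store_cost, store_val, Tree.toList,
        List.length_cons, List.length_append]
      grw [interpolationPoints_cost_le, transferMatrix_cost_le, transferMatrix_cost_le, hl₂, hr₂]
      linarith

lemma exists_multiscaleClusterBasis_cost_le (d n M : ℕ) : ∃ K, ∀ t : Tree (InterpCluster d),
    (∀ v ∈ t.toList, BoundedDim M v.toSampletCluster) →
      (multiscaleClusterBasis n t).val.map BasisCluster.toSampletCluster =
        t.map InterpCluster.toSampletCluster ∧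
      (multiscaleClusterBasis n t).cost ≤ K * t.toList.length := by
  set P := 2 * M + n ^ d with hP
  refine ⟨2 * buildBound P (P * 5 + 1) + buildBound P 2 + buildBound P 1 +
    buildBound P (P * 5 + 1) + 20, fun t => ?_⟩
  induction t with
  | leaf c =>
    refine fun _ => ⟨rfl, ?_⟩
    simp only [multiscaleClusterBasis, Run.cost_bind, store_cost, Tree.toList,
      List.length_singleton]
    omega
  | node c l r ihl ihr =>
    intro h
    obtain ⟨hl₁, hl₂⟩ := ihl fun v hv => h v (by simp [Tree.toList, hv])
    obtain ⟨hr₁, hr₂⟩ := ihr fun v hv => h v (by simp [Tree.toList, hv])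
    have hc : c.dim ≤ 2 * M := (h c (by simp [Tree.toList])).2
    have hl : (multiscaleClusterBasis n l).val.label.nPhi ≤ M := by
      have he := congrArg Tree.label hl₁
      rw [Tree.label_map, Tree.label_map] at he
      rw [he]
      exact (h _ (by simp [Tree.toList, Tree.label_mem_toList])).1
    have hr : (multiscaleClusterBasis n r).val.label.nPhi ≤ M := by
      have he := congrArg Tree.label hr₁
      rw [Tree.label_map, Tree.label_map] at he
      rw [he]
      exact (h _ (by simp [Tree.toList, Tree.label_mem_toList])).1
    refine ⟨?_, ?_⟩
    · simp only [multiscaleClusterBasis, Run.val_bind, store_val, Tree.map, hl₁, hr₁]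
    · simp only [multiscaleClusterBasis, Run.cost_bind, store_cost, store_val, Tree.toList,
        List.length_cons, List.length_append]
      grw [matMul_cost_le (m := P) (by omega) (by omega) (by omega),
        matMul_cost_le (m := P) (by omega) (by omega) (by omega),
        vcat_cost_le (m := P) (by omega) (by omega), transpose_cost_le (m := P) (by omega) (by omega),
        matMul_cost_le (m := P) (by omega) (by omega) (by omega), hl₂, hr₂]
      linarith

/-! ### Blocks: bounded cost per visited pair -/

lemma edge_cost (B : Box) (l : ℕ) : (edge B l).cost = 3 := rfl

lemma boxDiam_cost_le (d : ℕ) (B : Box) : (boxDiam d B).cost ≤ d * 6 + 2 := by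
  simp only [boxDiam, Run.cost_bind, sqrt_cost]
  grw [sumTo_cost_le _ 4 d fun l _ => by simp [edge_cost]]

lemma gapSq_cost_le (a b : ℝ) : (gapSq a b).cost ≤ 3 := by
  simp only [gapSq, Run.cost_bind, sub_cost, lt_cost, lt_val, decide_eq_true_eq, Run.cost_ite,
    mul_cost, Run.cost_pure]
  split_ifs <;> omega

lemma boxDist_cost_le (d : ℕ) (B B' : Box) : (boxDist d B B').cost ≤ d * 13 + 2 := by
  simp only [boxDist, Run.cost_bind, sqrt_cost]
  grw [sumTo_cost_le _ 11 d fun l _ => by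
    simp only [Run.cost_bind, op_cost, add_cost]
    grw [gapSq_cost_le, gapSq_cost_le]]

lemma admissible_cost_le (d : ℕ) (η : ℝ) (B B' : Box) :
    (admissible d η B B').cost ≤ d * 25 + 9 := by
  simp only [admissible, Run.cost_bind, lt_cost, mul_cost, le_cost]
  grw [boxDiam_cost_le, boxDiam_cost_le, boxDist_cost_le]
  omega

lemma kernelEval_cost_le (k : Pt d → Pt d → ℝ) (x y : ℕ → Run ℝ) (hx : ∀ l, (x l).cost ≤ 2)
    (hy : ∀ l, (y l).cost ≤ 2) : (kernelEval k x y).cost ≤ d * 8 + 3 := by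
  simp only [kernelEval, Run.cost_bind, op_cost]
  grw [arr_cost_le _ 2 d fun l _ => hx l, arr_cost_le _ 2 d fun l _ => hy l]
  omega

lemma exists_admissibleBlock_cost_le (d n M : ℕ) : ∃ K, ∀ (k : Pt d → Pt d → ℝ)
    (v w : BasisCluster d), BoundedDim M v.toSampletCluster → BoundedDim M w.toSampletCluster →
      (admissibleBlock n k v w).cost ≤ K := by
  set P := 2 * M + n ^ d with hP
  refine ⟨buildBound P (d * 8 + 3) + 2 * buildBound P (P * 5 + 1) + buildBound P 1,
    fun k v w hv hw => ?_⟩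
  obtain ⟨-, hv⟩ := hv
  obtain ⟨-, hw⟩ := hw
  have hS : (couplingMatrix n k v w).cost ≤ buildBound P (d * 8 + 3) :=
    build_cost_le_of_le (by omega) (by omega) fun a _ b _ =>
      kernelEval_cost_le k _ _ (fun l => (tensorCoord_cost n _ _ l).le)
        fun l => (tensorCoord_cost n _ _ l).le
  simp only [admissibleBlock, Run.cost_bind]
  grw [hS, matMul_cost_le (m := P) (by omega) (by omega) (by omega),
    transpose_cost_le (m := P) (by omega) (by omega),
    matMul_cost_le (m := P) (by omega) (by omega) (by omega)]
  omega

lemma leafBlock_cost_le {M : ℕ} (k : Pt d → Pt d → ℝ) (v w : BasisCluster d) (hv : v.nPhi ≤ M)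
    (hw : w.nPhi ≤ M) : (leafBlock k v w).cost ≤ 4 * M + buildBound M 3 := by
  simp only [leafBlock, Run.cost_bind, store_cost]
  grw [build_cost_le_of_le (m := M) (a := 3) hv hw fun i _ j _ => by simp]
  omega

lemma storeBlock_cost_le {M : ℕ} (v w : BasisCluster d) (hv : BoundedDim M v.toSampletCluster)
    (hw : BoundedDim M w.toSampletCluster) (A : Mat) (l r : BlockColumn) :
    (storeBlock v w A l r).cost ≤ buildBound (2 * M) 1 + 10 := by
  obtain ⟨-, hv⟩ := hv
  obtain ⟨-, hw⟩ := hw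
  unfold SampletCluster.dim at hv hw
  simp only [storeBlock, Run.cost_bind, store_cost]
  grw [build_cost_le_of_le (m := 2 * M) (a := 1) (by omega) (by omega) fun i _ j _ => by simp]

/-- The row cluster `v` is not admissible for the column cluster `w`. -/
noncomputable def nonadmissible (η : ℝ) (w v : Cluster d) : Bool := !(admissible d η v.box w.box).val

/-- Only the root and non-admissible pairs are visited. -/
lemma exists_setupRow_cost_le (d n M : ℕ) : ∃ K, ∀ (η : ℝ) (k : Pt d → Pt d → ℝ)
    (w : BasisCluster d) (t : Tree (BasisCluster d))
    (sons : Option ((BasisCluster d × BlockColumn) × (BasisCluster d × BlockColumn))),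
    BoundedDim M w.toSampletCluster → (∀ v ∈ t.toList, BoundedDim M v.toSampletCluster) →
    (∀ s ∈ sons, BoundedDim M s.1.1.toSampletCluster ∧ BoundedDim M s.2.1.toSampletCluster) →
    (setupRow n η k w t sons).cost ≤
      K * (1 + t.toList.tail.countP fun v => nonadmissible η w.toCluster v.toCluster) := by
  obtain ⟨E, hE⟩ := exists_admissibleBlock_cost_le d n M
  set K := 2 * (d * 25 + 9) + 2 * E + buildBound (2 * M) 2 + buildBound (2 * M) 1 +
    buildBound (2 * M) (2 * M * 5 + 1) + buildBound (2 * M) 1 + (4 * M + buildBound M 3) + 20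
    with hK
  refine ⟨K, fun η k w t => ?_⟩
  induction t with
  | leaf v =>
    rintro (_ | ⟨⟨w₁, c₁⟩, w₂, c₂⟩) hw ht hs
    · have hv := ht v (by simp [Tree.toList])
      simp only [setupRow, Run.cost_bind]
      grw [leafBlock_cost_le k v w hv.1 hw.1, storeBlock_cost_le v w hv hw]
      simp only [Tree.toList, List.tail_cons, List.countP_nil]
      omega
    · have hv := ht v (by simp [Tree.toList])
      obtain ⟨hs₁, hs₂⟩ := hs _ rfl
      have hw₁ : w₁.nPhi ≤ M := hs₁.1
      have hw₂ : w₂.nPhi ≤ M := hs₂.1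
      have h₁ := hE k v w₁ hv hs₁
      have h₂ := hE k v w₂ hv hs₂
      have hv2 := hv.2
      have hw2 := hw.2
      have hrest : ∀ A₁ A₂ : Mat, (do
          let W ← hcat v.dim w₁.nPhi w₂.nPhi A₁ A₂
          let A ← matMul v.dim w.dim w.dim W w.Q
          storeBlock v w A .skip .skip : Run BlockColumn).cost ≤ buildBound (2 * M) 2 +
            buildBound (2 * M) (2 * M * 5 + 1) + (buildBound (2 * M) 1 + 10) := by
        intro A₁ A₂
        simp only [Run.cost_bind]
        grw [hcat_cost_le (m := 2 * M) (by omega) (by omega),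
          matMul_cost_le (m := 2 * M) (by omega) (by omega) (by omega),
          storeBlock_cost_le v w hv hw]
        omega
      simp only [Run.cost_bind] at hrest
      have ha₁ := admissible_cost_le d η v.box w₁.box
      have ha₂ := admissible_cost_le d η v.box w₂.box
      simp only [setupRow, Tree.toList, List.tail_cons, List.countP_nil]
      rw [Run.cost_bind]
      cases (admissible d η v.box w₁.box).val <;>
      · simp only [Bool.false_eq_true, if_false, if_true, Run.cost_bind, op_cost, op_val]
        cases (admissible d η v.box w₂.box).val <;>
        · simp only [Bool.false_eq_true, if_false, if_true, Run.cost_bind, op_cost, op_val]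
          grw [hrest]
          omega
  | node v l r ihl ihr =>
    intro sons hw ht hs
    have hv := ht v (by simp [Tree.toList])
    have hlM : ∀ v ∈ l.toList, BoundedDim M v.toSampletCluster := fun v hv =>
      ht v (by simp [Tree.toList, hv])
    have hrM : ∀ v ∈ r.toList, BoundedDim M v.toSampletCluster := fun v hv =>
      ht v (by simp [Tree.toList, hv])
    have hl := hlM _ (Tree.label_mem_toList l)
    have hr := hrM _ (Tree.label_mem_toList r)
    have h₁ := hE k l.label w hl hw
    have h₂ := hE k r.label w hr hw
    have hv2 := hv.2
    have hw2 := hw.2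
    have hl1 := hl.1
    have hr1 := hr.1
    have hrest : ∀ (A₁ A₂ : Mat) (c₁ c₂ : BlockColumn), (do
        let W ← vcat l.label.nPhi r.label.nPhi w.dim A₁ A₂
        let Qt ← transpose v.dim v.dim v.Q
        let A ← matMul v.dim v.dim w.dim Qt W
        storeBlock v w A c₁ c₂ : Run BlockColumn).cost ≤ buildBound (2 * M) 2 +
          buildBound (2 * M) 1 + buildBound (2 * M) (2 * M * 5 + 1) +
          (buildBound (2 * M) 1 + 10) := by
      intro A₁ A₂ c₁ c₂
      simp only [Run.cost_bind]
      grw [vcat_cost_le (m := 2 * M) (by omega) (by omega),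
        transpose_cost_le (m := 2 * M) (by omega) (by omega),
        matMul_cost_le (m := 2 * M) (by omega) (by omega) (by omega),
        storeBlock_cost_le v w hv hw]
      omega
    simp only [Run.cost_bind] at hrest
    have ha₁ := admissible_cost_le d η l.label.box w.box
    have ha₂ := admissible_cost_le d η r.label.box w.box
    have hl₃ := ihl (sons.map fun s => ((s.1.1, s.1.2.left), (s.2.1, s.2.2.left))) hw hlM (by
      rintro s hs'
      obtain ⟨s', h, rfl⟩ := Option.mem_map.1 hs'
      exact hs s' h)
    have hr₃ := ihr (sons.map fun s => ((s.1.1, s.1.2.right), (s.2.1, s.2.2.right))) hw hrM (by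
      rintro s hs'
      obtain ⟨s', h, rfl⟩ := Option.mem_map.1 hs'
      exact hs s' h)
    have hcount : ∀ t : Tree (BasisCluster d),
        t.toList.countP (fun v => nonadmissible η w.toCluster v.toCluster) =
        t.toList.tail.countP (fun v => nonadmissible η w.toCluster v.toCluster) +
          if (admissible d η t.label.box w.box).val then 0 else 1 := by
      intro t
      rw [Tree.toList_eq_cons t, List.countP_cons, List.tail_cons]
      cases h : (admissible d η t.label.box w.box).val <;> simp [nonadmissible, h]
    simp only [setupRow, Tree.toList, List.tail_cons, List.countP_append, hcount]
    generalize l.toList.tail.countP (fun v => nonadmissible η w.toCluster v.toCluster) = a at *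
    generalize r.toList.tail.countP (fun v => nonadmissible η w.toCluster v.toCluster) = b at *
    rw [Run.cost_bind, op_val, Run.cost_bind, op_val, Run.cost_bind, op_cost, op_cost]
    cases (admissible d η l.label.box w.box).val <;>
    · simp only [Bool.false_eq_true, if_false, if_true, Run.cost_bind, Run.cost_pure, Run.val_pure]
      cases (admissible d η r.label.box w.box).val <;>
      · simp only [Bool.false_eq_true, if_false, if_true, Run.cost_bind, Run.cost_pure,
          Run.val_pure]
        grw [hrest]
        have := Nat.zero_le (K * a)
        have := Nat.zero_le (K * b)
        simp only [Nat.mul_add] at *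
        omega

lemma exists_setupColumn_cost_le (d n M : ℕ) : ∃ K, ∀ (η : ℝ) (k : Pt d → Pt d → ℝ)
    (X : Tree (BasisCluster d)), (∀ v ∈ X.toList, BoundedDim M v.toSampletCluster) →
    ∀ T : Tree (BasisCluster d), (∀ w ∈ T.toList, BoundedDim M w.toSampletCluster) →
      (setupColumn n η k X T).cost ≤ K * (T.toList.map fun w =>
        1 + X.toList.countP fun v => nonadmissible η w.toCluster v.toCluster).sum := by
  obtain ⟨K, hK⟩ := exists_setupRow_cost_le d n M
  refine ⟨K + 8, fun η k X hX T => ?_⟩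
  have hrow : ∀ w sons, BoundedDim M w.toSampletCluster →
      (∀ s ∈ sons, BoundedDim M s.1.1.toSampletCluster ∧ BoundedDim M s.2.1.toSampletCluster) →
      (setupRow n η k w X sons).cost + 8 ≤ (K + 8) *
        (1 + X.toList.countP fun v => nonadmissible η w.toCluster v.toCluster) := by
    intro w sons hw hs
    have h₁ := hK η k w X sons hw hX hs
    have h₂ : X.toList.tail.countP (fun v => nonadmissible η w.toCluster v.toCluster) ≤
        X.toList.countP (fun v => nonadmissible η w.toCluster v.toCluster) :=
      (List.tail_sublist _).countP_le
    grw [h₁, h₂]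
    rw [Nat.add_mul]
    omega
  induction T with
  | leaf w =>
    intro hT
    have := hrow w none (hT w (by simp [Tree.toList])) (by simp)
    simp only [setupColumn, Run.cost_bind, store_cost, Tree.toList, List.map_cons, List.map_nil,
      List.sum_cons, List.sum_nil, Nat.add_zero]
    omega
  | node w l r ihl ihr =>
    intro hT
    have hl : ∀ v ∈ l.toList, BoundedDim M v.toSampletCluster := fun v hv =>
      hT v (by simp [Tree.toList, hv])
    have hr : ∀ v ∈ r.toList, BoundedDim M v.toSampletCluster := fun v hv =>
      hT v (by simp [Tree.toList, hv])
    have h := hrow w (some ((l.label, (setupColumn n η k X l).val.label),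
      (r.label, (setupColumn n η k X r).val.label))) (hT w (by simp [Tree.toList])) (by
        rintro s hs
        obtain rfl := Option.mem_some_iff.1 hs
        exact ⟨hl _ (Tree.label_mem_toList l), hr _ (Tree.label_mem_toList r)⟩)
    have h₁ := ihl hl
    have h₂ := ihr hr
    simp only [setupColumn, Run.cost_bind, store_cost, Tree.toList, List.map_cons, List.map_append,
      List.sum_cons, List.sum_append]
    rw [Nat.mul_add, Nat.mul_add (K + 8) (List.sum _)]
    omega

/-- The whole computation is bounded by the sum of the cardinalities of all clusters and the number
of non-admissible pairs of clusters. -/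
lemma exists_compressedKernelMatrix_cost_le (hd : 0 < d) (q n : ℕ) {τ : ℝ} (hτ₁ : 1 < τ)
    (hτ₂ : τ < mq d q + 1) : ∃ K, ∀ (η : ℝ) (k : Pt d → Pt d → ℝ) (ξ : List (Pt d) → Fin n → Pt d)
    (x : List (Pt d)), x ≠ [] → x.Nodup → ∃ t : Tree (Cluster d),
      IsBisection (mq d q) t ∧ t.label.pts = x ∧
      (compressedKernelMatrix q τ η k ξ x).cost ≤ K * (t.weight + (t.toList.map fun w =>
        t.toList.countP (nonadmissible η w)).sum) := by
  obtain ⟨K₁, h₁⟩ := exists_sampletBasis_cost_le d q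
  obtain ⟨K₂, h₂⟩ := exists_interpolation_cost_le d n (mq d q)
  obtain ⟨K₃, h₃⟩ := exists_multiscaleClusterBasis_cost_le d n (mq d q)
  obtain ⟨K₄, h₄⟩ := exists_setupColumn_cost_le d n (mq d q)
  refine ⟨2 + (1100 + 21 * d) + K₁ + K₂ + K₃ + K₄, fun η k ξ x hx hn => ?_⟩
  obtain ⟨ht, hl, hc⟩ := clusterTree_spec hd hτ₁ hτ₂ x.length x hx hn le_rfl
  refine ⟨(clusterTree τ x.length x).val, ht, hl, ?_⟩
  simp only [compressedKernelMatrix, Run.cost_bind, len_cost, len_val]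
  set t := (clusterTree τ x.length x).val
  obtain ⟨hs₁, hs₂, hs₃⟩ := h₁ t ht
  set s := (sampletBasis q t).val.1
  obtain ⟨hp₁, hp₂⟩ := h₂ ξ s hs₂
  set p := (interpolation ξ s).val
  have hpM : ∀ v ∈ p.toList, BoundedDim (mq d q) v.toSampletCluster := by
    intro v hv
    refine hs₂ _ ?_
    rw [← hp₁, Tree.toList_map]
    exact List.mem_map_of_mem hv
  obtain ⟨hX₁, hX₂⟩ := h₃ p hpM
  set X := (multiscaleClusterBasis n p).val
  have hXs : X.map BasisCluster.toSampletCluster = s := hX₁.trans hp₁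
  have hXM : ∀ v ∈ X.toList, BoundedDim (mq d q) v.toSampletCluster := by
    intro v hv
    refine hs₂ _ ?_
    rw [← hXs, Tree.toList_map]
    exact List.mem_map_of_mem hv
  have hfin := h₄ η k X hXM X hXM
  have hXl : t.toList = X.toList.map fun v => v.toCluster := by
    rw [← hs₁, ← hXs, Tree.toList_map, Tree.toList_map, List.map_map]
    rfl
  have hpl : p.toList.length = t.toList.length := by
    rw [← hs₁, ← hp₁, Tree.toList_map, Tree.toList_map]
    simp
  have hsl : s.toList.length = t.toList.length := by
    rw [← hs₁, Tree.toList_map]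
    simp
  have hpairs : (X.toList.map fun w => 1 + X.toList.countP fun v =>
      nonadmissible η w.toCluster v.toCluster).sum = t.toList.length +
        (t.toList.map fun w => t.toList.countP (nonadmissible η w)).sum := by
    rw [hXl, List.map_map, List.length_map, List.sum_map_add]
    simp [List.countP_map, Function.comp_def]
  rw [hpairs] at hfin
  rw [hsl] at hp₂
  rw [hpl] at hX₂
  have hw₁ : t.toList.length ≤ t.weight := by
    have hpos : ∀ t : Tree (Cluster d), IsBisection (mq d q) t → ∀ c ∈ t.toList,
        1 ≤ c.pts.length := by
      intro t
      induction t with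
      | leaf c =>
        rintro h c' hc'
        obtain rfl := List.mem_singleton.1 hc'
        exact List.length_pos_iff.2 h.1
      | node c l r ihl ihr =>
        rintro ⟨h, -, -, -, -, -, -, hl, hr⟩ c' hc'
        simp only [Tree.toList, List.mem_cons, List.mem_append] at hc'
        rcases hc' with rfl | hc' | hc'
        · exact List.length_pos_iff.2 h
        · exact ihl hl _ hc'
        · exact ihr hr _ hc'
    have := List.card_nsmul_le_sum (t.toList.map fun c => c.pts.length) 1 (by
      intro a ha
      obtain ⟨c, hc, rfl⟩ := List.mem_map.1 ha
      exact hpos t ht c hc)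
    simpa [Tree.weight] using this
  have hw₂ : x.length + 1 ≤ 2 * t.weight := by
    have h1 : t.label.pts.length ≤ t.weight := by
      rw [Tree.weight, Tree.toList_eq_cons t, List.map_cons, List.sum_cons]
      omega
    have h2 : 0 < x.length := List.length_pos_iff.2 hx
    rw [hl] at h1
    omega
  grw [hw₂, hc, hs₃, hp₂, hX₂, hfin, hw₁]
  generalize (t.toList.map fun w => t.toList.countP (nonadmissible η w)).sum = P
  nlinarith [Nat.zero_le ((2 + (1100 + 21 * d) + K₁ + K₂ + K₃) * P)]

open MeasureTheory

/-! ### Packing, covering and slabs of convex bodies -/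

lemma abs_apply_sub_le_dist (x y : Pt d) (i : Fin d) : |x i - y i| ≤ dist x y := by
  rw [dist_eq_norm, ← Real.norm_eq_abs]
  exact PiLp.norm_apply_le (x - y) i

/-- Volume of the unit ball. -/
noncomputable def unitBallVolume (d : ℕ) : ℝ := volume.real (Metric.ball (0 : Pt d) 1)

lemma unitBallVolume_pos : 0 < unitBallVolume d :=
  ENNReal.toReal_pos (Metric.measure_ball_pos _ _ one_pos).ne' measure_ball_lt_top.ne

lemma volume_ball_eq (x : Pt d) {r : ℝ} (hr : 0 < r) :
    volume.real (Metric.ball x r) = r ^ d * unitBallVolume d := by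
  rw [Measure.real, Measure.addHaar_ball_of_pos _ _ hr, ENNReal.toReal_mul,
    ENNReal.toReal_ofReal (by positivity), finrank_euclideanSpace_fin]
  rfl

lemma volume_closedBall_eq (x : Pt d) {r : ℝ} (hr : 0 ≤ r) :
    volume.real (Metric.closedBall x r) = r ^ d * unitBallVolume d := by
  rw [Measure.addHaar_real_closedBall _ _ hr, finrank_euclideanSpace_fin]
  rfl

lemma volume_homothety (p : Pt d) {r : ℝ} (hr : 0 ≤ r) (K : Set (Pt d)) :
    volume.real (AffineMap.homothety p r '' K) = r ^ d * volume.real K := by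
  rw [Measure.real, Measure.addHaar_image_homothety, ENNReal.toReal_mul,
    ENNReal.toReal_ofReal (abs_nonneg _), finrank_euclideanSpace_fin, abs_of_nonneg (by positivity)]
  rfl

lemma volume_homothety_ne_top (p : Pt d) (r : ℝ) {K : Set (Pt d)} (hK : volume K ≠ ∞) :
    volume (AffineMap.homothety p r '' K) ≠ ∞ := by
  rw [Measure.addHaar_image_homothety]
  exact ENNReal.mul_ne_top ENNReal.ofReal_ne_top hK

/-- Disjoint balls of radius `g / 2` about `g`-separated points fit into `A`. -/
lemma card_mul_le_volume {s : Finset (Pt d)} {g : ℝ} (hg : 0 < g)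
    (hs : ∀ x ∈ s, ∀ y ∈ s, x ≠ y → g ≤ dist x y) {A : Set (Pt d)} (hA : volume A ≠ ∞)
    (hsA : ∀ x ∈ s, Metric.ball x (g / 2) ⊆ A) :
    s.card * ((g / 2) ^ d * unitBallVolume d) ≤ volume.real A := by
  have h : volume.real (⋃ x ∈ s, Metric.ball x (g / 2)) =
      s.card * ((g / 2) ^ d * unitBallVolume d) := by
    rw [measureReal_biUnion_finset]
    · rw [Finset.sum_congr rfl fun x _ => volume_ball_eq x (half_pos hg), Finset.sum_const,
        nsmul_eq_mul]
    · intro x hx y hy hxy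
      exact Metric.ball_disjoint_ball (by linarith [hs x hx y hy hxy])
    · exact fun _ _ => measurableSet_ball
  rw [← h]
  exact measureReal_mono (Set.iUnion₂_subset hsA) hA

/-- Points that come within `h` of every point whose `ρ / 2`-ball lies in `K` are not fewer than the
volume of `K` requires, if the convex set `K` contains a ball of radius `ρ`. -/
lemma volume_le_card_mul {K : Set (Pt d)} (hK : Convex ℝ K) {p : Pt d} {ρ h : ℝ}
    (hρ0 : 0 < ρ) (hρ : Metric.ball p ρ ⊆ K) (hh : 0 ≤ h) (s : Finset (Pt d))
    (hs : ∀ y, Metric.ball y (ρ / 2) ⊆ K → y ∈ K → ∃ x ∈ s, dist y x ≤ h) :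
    volume.real K ≤ 2 ^ d * (s.card * (h ^ d * unitBallVolume d)) := by
  have hsub : AffineMap.homothety p (1 / 2 : ℝ) '' K ⊆ ⋃ x ∈ s, Metric.closedBall x h := by
    rintro _ ⟨z, hz, rfl⟩
    set y := AffineMap.homothety p (1 / 2 : ℝ) z with hy
    have hyz : y = (1 / 2 : ℝ) • z + (1 / 2 : ℝ) • p := by
      rw [hy, AffineMap.homothety_apply, vsub_eq_sub, vadd_eq_add]
      module
    have hball : Metric.ball y (ρ / 2) ⊆ K := by
      intro w hw
      have hw' : p + (2 : ℝ) • (w - y) ∈ K := by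
        refine hρ ?_
        rw [mem_ball_iff_norm, add_sub_cancel_left, norm_smul, Real.norm_ofNat]
        rw [mem_ball_iff_norm] at hw
        linarith
      have : w = (1 / 2 : ℝ) • z + (1 / 2 : ℝ) • (p + (2 : ℝ) • (w - y)) := by
        rw [hyz]
        module
      rw [this]
      exact hK hz hw' (by norm_num) (by norm_num) (by norm_num)
    obtain ⟨x, hx, hxy⟩ := hs y hball (hball (Metric.mem_ball_self (by linarith)))
    exact Set.mem_iUnion₂.2 ⟨x, hx, hxy⟩
  have h₁ := measureReal_mono hsub
    (measure_biUnion_lt_top s.finite_toSet fun x _ => measure_closedBall_lt_top).ne (μ := volume)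
  rw [volume_homothety p (by norm_num)] at h₁
  have h₂ := measureReal_biUnion_finset_le (μ := volume) s fun x : Pt d => Metric.closedBall x h
  rw [Finset.sum_congr rfl fun x _ => volume_closedBall_eq x hh, Finset.sum_const,
    nsmul_eq_mul] at h₂
  have h₃ : volume.real K = 2 ^ d * ((1 / 2) ^ d * volume.real K) := by
    rw [← mul_assoc, ← mul_pow]
    norm_num
  rw [h₃]
  exact mul_le_mul_of_nonneg_left (h₁.trans h₂) (by positivity)

/-- A slab at the end of a convex body: if the homothety with ratio `1 - θ` about a point of `K`
moves `K` out of the slab `S`, then `S` contains at most the fraction `d * θ` of `K`. -/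
lemma volume_slab_le {K S : Set (Pt d)} (hK : Convex ℝ K) (hKv : volume K ≠ ∞)
    (hS : MeasurableSet S) {a : Pt d} (ha : a ∈ K) {θ : ℝ} (h0 : 0 ≤ θ) (h1 : θ ≤ 1)
    (h : ∀ y ∈ K, AffineMap.homothety a (1 - θ) y ∉ S) :
    volume.real (K ∩ S) ≤ d * θ * volume.real K := by
  have hsub : AffineMap.homothety a (1 - θ) '' K ⊆ K \ S := by
    rintro _ ⟨y, hy, rfl⟩
    refine ⟨?_, h y hy⟩
    have : AffineMap.homothety a (1 - θ) y = (1 - θ) • y + θ • a := by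
      rw [AffineMap.homothety_apply, vsub_eq_sub, vadd_eq_add]
      module
    rw [this]
    exact hK hy ha (by linarith) h0 (by ring)
  have h₁ := measureReal_mono hsub (measure_ne_top_of_subset Set.sdiff_subset hKv) (μ := volume)
  rw [volume_homothety a (by linarith)] at h₁
  have h₂ := measureReal_inter_add_sdiff (μ := volume) (s := K) hS hKv
  have h₃ : 1 + (d : ℝ) * (-θ) ≤ (1 + -θ) ^ d := one_add_mul_le_pow (by linarith) d
  have h₄ : 0 ≤ volume.real K := measureReal_nonneg
  have h₅ : (1 + (d : ℝ) * (-θ)) * volume.real K ≤ (1 - θ) ^ d * volume.real K := by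
    gcongr
    simpa [sub_eq_add_neg] using h₃
  linarith

/-- Separated points `s` of a convex body `K` that lie within `w` of its top, measured by the signed
coordinate `σ * x c`: their number is at most the fraction `d * θ`, up to a constant, of the number
that the volume of `K` allows. Here `L` is the height of `K`, and `θ` is `w / L` plus terms that
account for the radius `g / 2` of the balls about the points. -/
lemma card_slab_le {K : Set (Pt d)} (hK : Convex ℝ K) (hKv : volume K ≠ ∞) {p : Pt d} {ρ g : ℝ}
    (hg : 0 < g) (hgρ : g ≤ 2 * ρ) (hρ : Metric.ball p ρ ⊆ K) {σ : ℝ} (hσ : |σ| = 1) (c : Fin d)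
    {L w : ℝ} (hL : 0 < L) (hw : 0 ≤ w) (hKL : ∀ z ∈ K, ∀ z' ∈ K, σ * (z c - z' c) ≤ L)
    {a b : Pt d} (ha : a ∈ K) (hab : L ≤ σ * (b c - a c)) {s : Finset (Pt d)} (hsK : ∀ x ∈ s, x ∈ K)
    (hs : ∀ x ∈ s, ∀ y ∈ s, x ≠ y → g ≤ dist x y) (hsw : ∀ x ∈ s, σ * (b c - x c) ≤ w)
    {θ : ℝ} (hθ : θ = w / L + g / (2 * L) + g / (2 * ρ)) (hθ1 : θ ≤ 1) :
    s.card * ((g / 2) ^ d * unitBallVolume d) ≤ d * θ * (2 ^ d * volume.real K) := by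
  have hρ0 : 0 < ρ := by linarith
  set ε := g / (2 * ρ) with hε
  have hε0 : 0 < ε := by positivity
  have hε1 : ε ≤ 1 := by
    rw [hε, div_le_one (by positivity)]
    exact hgρ
  have hpK : p ∈ K := hρ (Metric.mem_ball_self hρ0)
  set K' := AffineMap.homothety p (1 + ε) '' K with hK'
  have happ : ∀ z : Pt d, AffineMap.homothety p (1 + ε) z = z + ε • (z - p) := by
    intro z
    rw [AffineMap.homothety_apply, vsub_eq_sub, vadd_eq_add]
    module
  have hK'c : Convex ℝ K' := hK.affine_image _
  -- A point of `K` moved by less than `g / 2 = ε * ρ` stays in the enlarged body.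
  have hmem : ∀ z ∈ K, Metric.ball z (g / 2) ⊆ K' := by
    intro z hz y hy
    set u := p + (1 / ε) • (y - z) with hu
    have huK : u ∈ K := by
      refine hρ ?_
      rw [mem_ball_iff_norm, hu, add_sub_cancel_left, norm_smul, Real.norm_of_nonneg (by positivity)]
      rw [mem_ball_iff_norm] at hy
      have : (g / 2) = ε * ρ := by
        rw [hε]
        field_simp
      rw [this] at hy
      rw [one_div, inv_mul_lt_iff₀ hε0]
      exact hy
    refine ⟨(1 / (1 + ε)) • z + (ε / (1 + ε)) • u, hK hz huK (by positivity) (by positivity)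
      (by field_simp), ?_⟩
    have h₁ : (1 + ε) • ((1 / (1 + ε)) • z + (ε / (1 + ε)) • u) = z + ε • u := by
      rw [smul_add, smul_smul, smul_smul, mul_one_div_cancel (by positivity), one_smul,
        mul_div_cancel₀ _ (by positivity)]
    have h₂ : ε • u = ε • p + (y - z) := by
      rw [hu, smul_add, smul_smul, mul_one_div_cancel hε0.ne', one_smul]
    rw [AffineMap.homothety_apply, vsub_eq_sub, vadd_eq_add, smul_sub, h₁, h₂]
    module
  set T := σ * (a c) + L - w - g / 2 with hT
  set S : Set (Pt d) := {y | T < σ * y c} with hS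
  have hSm : MeasurableSet S := by
    refine measurableSet_lt measurable_const ?_
    fun_prop
  have hball : ∀ x ∈ s, Metric.ball x (g / 2) ⊆ K' ∩ S := by
    refine fun x hx y hy => ⟨hmem x (hsK x hx) hy, ?_⟩
    have h₁ : |σ * (y c - x c)| < g / 2 := by
      rw [abs_mul, hσ, one_mul]
      exact (abs_apply_sub_le_dist y x c).trans_lt hy
    have h₂ := (abs_lt.1 h₁).1
    have h₃ := hsw x hx
    change T < σ * y c
    rw [hT]
    linarith
  have hθ0 : 0 ≤ θ := by
    rw [hθ]
    positivity
  have hθL : θ * L = w + g / 2 + ε * L := by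
    rw [hθ]
    field_simp
  have hslab := volume_slab_le hK'c (volume_homothety_ne_top p _ hKv) hSm
    (hmem a ha (Metric.mem_ball_self (by linarith))) hθ0 hθ1 (by
      rintro _ ⟨z, hz, rfl⟩ hmemS
      rw [happ, AffineMap.homothety_apply, vsub_eq_sub, vadd_eq_add] at hmemS
      change T < σ * ((1 - θ) * (z c + ε * (z c - p c) - a c) + a c) at hmemS
      have h₁ := hKL z hz a ha
      have h₂ := hKL z hz p hpK
      have h₃ : σ * (z c - a c) + ε * (σ * (z c - p c)) ≤ L + ε * L := by gcongr
      have h₄ : (1 - θ) * (σ * (z c - a c) + ε * (σ * (z c - p c))) ≤ (1 - θ) * (L + ε * L) := by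
        gcongr
      have h₅ : 0 ≤ θ * ε * L := by positivity
      have h₆ : σ * ((1 - θ) * (z c + ε * (z c - p c) - a c) + a c) =
          (1 - θ) * (σ * (z c - a c) + ε * (σ * (z c - p c))) + σ * a c := by ring
      rw [h₆, hT] at hmemS
      nlinarith)
  have hcard := card_mul_le_volume hg hs
    (measure_ne_top_of_subset Set.inter_subset_left (volume_homothety_ne_top p _ hKv)) hball
  rw [volume_homothety p (by positivity)] at hslab
  refine hcard.trans (hslab.trans ?_)
  have : 0 ≤ volume.real K := measureReal_nonneg
  gcongr
  linarith

/-! ### Bounding boxes and bisection steps -/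

/-- Lower end of the bounding box of a finite set in direction `i`. -/
noncomputable def lower (v : Finset (Pt d)) (i : Fin d) : ℝ := sInf ((fun x : Pt d => x i) '' v)

/-- Upper end of the bounding box of a finite set in direction `i`. -/
noncomputable def upper (v : Finset (Pt d)) (i : Fin d) : ℝ := sSup ((fun x : Pt d => x i) '' v)

/-- Edge length of the bounding box of a finite set in direction `i`. -/
noncomputable def width (v : Finset (Pt d)) (i : Fin d) : ℝ := upper v i - lower v i

lemma lower_le {v : Finset (Pt d)} {x : Pt d} (hx : x ∈ v) (i : Fin d) : lower v i ≤ x i :=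
  csInf_le (v.finite_toSet.image _).bddBelow (Set.mem_image_of_mem _ hx)

lemma le_upper {v : Finset (Pt d)} {x : Pt d} (hx : x ∈ v) (i : Fin d) : x i ≤ upper v i :=
  le_csSup (v.finite_toSet.image _).bddAbove (Set.mem_image_of_mem _ hx)

lemma exists_eq_lower {v : Finset (Pt d)} (hv : v.Nonempty) (i : Fin d) :
    ∃ x ∈ v, x i = lower v i :=
  (Set.Nonempty.image _ (Finset.coe_nonempty.2 hv)).csInf_mem (v.finite_toSet.image _)

lemma exists_eq_upper {v : Finset (Pt d)} (hv : v.Nonempty) (i : Fin d) :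
    ∃ x ∈ v, x i = upper v i :=
  (Set.Nonempty.image _ (Finset.coe_nonempty.2 hv)).csSup_mem (v.finite_toSet.image _)

lemma width_nonneg {v : Finset (Pt d)} (hv : v.Nonempty) (i : Fin d) : 0 ≤ width v i := by
  obtain ⟨x, hx⟩ := hv
  have := lower_le hx i
  have := le_upper hx i
  unfold width
  linarith

lemma lower_anti {v v' : Finset (Pt d)} (h : v' ⊆ v) (hv' : v'.Nonempty) (i : Fin d) :
    lower v i ≤ lower v' i := by
  obtain ⟨x, hx, h'⟩ := exists_eq_lower hv' i
  rw [← h']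
  exact lower_le (h hx) i

lemma upper_mono {v v' : Finset (Pt d)} (h : v' ⊆ v) (hv' : v'.Nonempty) (i : Fin d) :
    upper v' i ≤ upper v i := by
  obtain ⟨x, hx, h'⟩ := exists_eq_upper hv' i
  rw [← h']
  exact le_upper (h hx) i

lemma width_mono {v v' : Finset (Pt d)} (h : v' ⊆ v) (hv' : v'.Nonempty) (i : Fin d) :
    width v' i ≤ width v i := by
  have := lower_anti h hv' i
  have := upper_mono h hv' i
  unfold width
  linarith

/-- The bounding box of a finite set. -/
def boxSet (v : Finset (Pt d)) : Set (Pt d) := {x | ∀ i, lower v i ≤ x i ∧ x i ≤ upper v i}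

lemma subset_boxSet (v : Finset (Pt d)) : (v : Set (Pt d)) ⊆ boxSet v :=
  fun _ hx i => ⟨lower_le hx i, le_upper hx i⟩

lemma boxSet_eq (v : Finset (Pt d)) :
    boxSet v = ⋂ i, (fun x : Pt d => x i) ⁻¹' Set.Icc (lower v i) (upper v i) := by
  ext x
  simp [boxSet]

lemma convex_boxSet (v : Finset (Pt d)) : Convex ℝ (boxSet v) := by
  rw [boxSet_eq]
  refine convex_iInter fun i => ?_
  exact (convex_Icc _ _).linear_preimage (EuclideanSpace.proj i : Pt d →L[ℝ] ℝ).toLinearMap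

/-- A point of the bounding box around which a whole ball lies in the box is strictly inside. -/
lemma lt_of_ball_subset_boxSet {v : Finset (Pt d)} {x : Pt d} {r : ℝ} (hr : 0 < r)
    (h : Metric.ball x r ⊆ boxSet v) (i : Fin d) : lower v i < x i ∧ x i < upper v i := by
  have hmem : ∀ s : ℝ, |s| < r → x + EuclideanSpace.single i s ∈ boxSet v := by
    intro s hs
    refine h ?_
    rw [mem_ball_iff_norm, add_sub_cancel_left, PiLp.norm_single]
    exact hs
  have h₁ := (hmem (r / 2) (by rw [abs_of_pos] <;> linarith) i).2
  have h₂ := (hmem (-(r / 2)) (by rw [abs_neg, abs_of_pos] <;> linarith) i).1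
  simp at h₁ h₂
  constructor <;> linarith

/-- The convex hull of a finite set contains a point whose distance from both faces of the bounding
box is at least a fixed fraction of the edge, in every direction: the mean of points on the faces. -/
lemma exists_center (hd : 0 < d) {v : Finset (Pt d)} (hv : v.Nonempty) :
    ∃ p ∈ convexHull ℝ (v : Set (Pt d)), ∀ i,
      lower v i + width v i / (2 * d) ≤ p i ∧ p i ≤ upper v i - width v i / (2 * d) := by
  have hd' : (0 : ℝ) < d := by exact_mod_cast hd
  choose a ha ha' using fun i => exists_eq_lower hv i
  choose b hb hb' using fun i => exists_eq_upper hv i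
  set c : Fin d → Pt d := fun j => (1 / 2 : ℝ) • a j + (1 / 2 : ℝ) • b j with hc
  have hcmem : ∀ j, c j ∈ convexHull ℝ (v : Set (Pt d)) := fun j =>
    convex_convexHull ℝ _ (subset_convexHull ℝ _ (ha j)) (subset_convexHull ℝ _ (hb j))
      (by norm_num) (by norm_num) (by norm_num)
  have hcj : ∀ j i, c j i = (a j i + b j i) / 2 := by
    intro j i
    simp only [hc, PiLp.add_apply, PiLp.smul_apply, smul_eq_mul]
    ring
  have hlo : ∀ i j, 0 ≤ c j i - lower v i := by
    intro i j
    rw [hcj]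
    linarith [lower_le (ha j) i, lower_le (hb j) i]
  have hhi : ∀ i j, 0 ≤ upper v i - c j i := by
    intro i j
    rw [hcj]
    linarith [le_upper (ha j) i, le_upper (hb j) i]
  refine ⟨∑ j, (1 / d : ℝ) • c j, (convex_convexHull ℝ _).sum_mem (fun _ _ => by positivity)
    (by simp [hd'.ne']) (fun j _ => hcmem j), fun i => ?_⟩
  have hp : (∑ j, (1 / d : ℝ) • c j) i = (1 / d : ℝ) * ∑ j, c j i := by
    rw [WithLp.ofLp_sum, Finset.sum_apply, Finset.mul_sum]
    rfl
  have h₁ : c i i - lower v i ≤ ∑ j, (c j i - lower v i) :=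
    Finset.single_le_sum (fun j _ => hlo i j) (Finset.mem_univ i)
  have h₂ : upper v i - c i i ≤ ∑ j, (upper v i - c j i) :=
    Finset.single_le_sum (fun j _ => hhi i j) (Finset.mem_univ i)
  rw [Finset.sum_sub_distrib, Finset.sum_const, Finset.card_univ, Fintype.card_fin,
    nsmul_eq_mul, hcj, ha', hb'] at h₁ h₂
  rw [hp]
  unfold width
  constructor
  · rw [← sub_nonneg]
    have : (1 / d : ℝ) * ∑ j, c j i - (lower v i + (upper v i - lower v i) / (2 * d)) =
        (1 / d : ℝ) * (∑ j, c j i - d * lower v i - ((lower v i + upper v i) / 2 - lower v i)) := by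
      field_simp
      ring
    rw [this]
    exact mul_nonneg (by positivity) (by linarith)
  · rw [← sub_nonneg]
    have : upper v i - (upper v i - lower v i) / (2 * d) - (1 / d : ℝ) * ∑ j, c j i =
        (1 / d : ℝ) * (d * upper v i - ∑ j, c j i - (upper v i - (lower v i + upper v i) / 2)) := by
      field_simp
      ring
    rw [this]
    exact mul_nonneg (by positivity) (by linarith)

/-- `v'` is a son of `v`: it contains at least a quarter of the points and is separated from the
rest by a hyperplane orthogonal to the longest edge `c` of the bounding box. -/
structure IsSon (v v' : Finset (Pt d)) (c : Fin d) : Prop where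
  subset : v' ⊆ v
  nonempty : v'.Nonempty
  card_le : v.card ≤ 4 * v'.card
  longest : ∀ i, width v i ≤ width v c
  separated : (∀ x ∈ v', ∀ y ∈ v, y ∉ v' → y c ≤ x c) ∨ (∀ x ∈ v', ∀ y ∈ v, y ∉ v' → x c ≤ y c)

/-- `v` arises from `u` by repeated splitting orthogonally to directions in `I`. -/
inductive Descendant (I : Set (Fin d)) (u : Finset (Pt d)) : Finset (Pt d) → Prop
  | refl : Descendant I u u
  | son {v v' : Finset (Pt d)} {c : Fin d} : Descendant I u v → IsSon v v' c → c ∈ I →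
      Descendant I u v'

lemma Descendant.subset {I : Set (Fin d)} {u v : Finset (Pt d)} (h : Descendant I u v) :
    v ⊆ u := by
  induction h with
  | refl => exact subset_rfl
  | son _ hs _ ih => exact hs.subset.trans ih

/-- A point of `u` lies in the descendant `v` if it is strictly inside the bounding box of `v` in
the directions of the cuts. -/
lemma Descendant.mem_of_lt {I : Set (Fin d)} {u v : Finset (Pt d)} (h : Descendant I u v)
    {x : Pt d} (hxu : x ∈ u) (hx : ∀ i ∈ I, lower v i < x i ∧ x i < upper v i) : x ∈ v := by
  induction h with
  | refl => exact hxu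
  | @son v v' c _ hs hc ih =>
    have hxv : x ∈ v := ih fun i hi =>
      ⟨(lower_anti hs.subset hs.nonempty i).trans_lt (hx i hi).1,
        (hx i hi).2.trans_le (upper_mono hs.subset hs.nonempty i)⟩
    by_contra hxv'
    obtain ⟨h₁, h₂⟩ := hx c hc
    rcases hs.separated with h | h
    · obtain ⟨y, hy, hy'⟩ := exists_eq_lower hs.nonempty c
      linarith [h y hy x hxv hxv']
    · obtain ⟨y, hy, hy'⟩ := exists_eq_upper hs.nonempty c
      linarith [h y hy x hxv hxv']

/-! ### Clusters of quasi-uniform points in a convex set -/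

/-- A finite subset `X` of the convex open set `Ω` is `g`-separated and comes within `C * g` of
every point of `Ω`; moreover `Ω` contains a ball of radius `r` and is contained in a cube of edge
length `D`. -/
structure IsQuasiUniform (Ω : Set (Pt d)) (X : Finset (Pt d)) (g C r D : ℝ) (x₀ : Pt d) :
    Prop where
  convex : Convex ℝ Ω
  subset : ∀ x ∈ X, x ∈ Ω
  pos : 0 < g
  one_le : 1 ≤ C
  sep : ∀ x ∈ X, ∀ y ∈ X, x ≠ y → g ≤ dist x y
  cover : ∀ z ∈ Ω, ∃ x ∈ X, dist z x ≤ C * g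
  r_pos : 0 < r
  ball_subset : Metric.ball x₀ r ⊆ Ω
  coord_le : ∀ x ∈ Ω, ∀ y ∈ Ω, ∀ i, |x i - y i| ≤ D

namespace IsQuasiUniform

variable {Ω : Set (Pt d)} {X v : Finset (Pt d)} {g C r D : ℝ} {x₀ : Pt d}

lemma width_le (h : IsQuasiUniform Ω X g C r D x₀) (hv : v ⊆ X) (hne : v.Nonempty) (i : Fin d) :
    width v i ≤ D := by
  obtain ⟨a, ha, ha'⟩ := exists_eq_lower hne i
  obtain ⟨b, hb, hb'⟩ := exists_eq_upper hne i
  rw [width, ← ha', ← hb']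
  exact (le_abs_self _).trans (h.coord_le _ (h.subset _ (hv hb)) _ (h.subset _ (hv ha)) i)

lemma r_le (h : IsQuasiUniform Ω X g C r D x₀) (hd : 0 < d) : r ≤ 2 * D := by
  set i : Fin d := ⟨0, hd⟩
  have hr := h.r_pos
  have hmem : x₀ + EuclideanSpace.single i (r / 2) ∈ Ω := by
    refine h.ball_subset ?_
    rw [mem_ball_iff_norm, add_sub_cancel_left, PiLp.norm_single, Real.norm_of_nonneg (by linarith)]
    linarith
  have := h.coord_le _ hmem _ (h.ball_subset (Metric.mem_ball_self hr)) i
  simp only [PiLp.add_apply, PiLp.single_apply, if_true, add_sub_cancel_left] at this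
  rw [abs_of_pos (by linarith)] at this
  linarith

lemma D_pos (h : IsQuasiUniform Ω X g C r D x₀) (hd : 0 < d) : 0 < D := by
  linarith [h.r_le hd, h.r_pos]

/-- The part of `Ω` in the bounding box of a cluster. -/
lemma convex_body (h : IsQuasiUniform Ω X g C r D x₀) : Convex ℝ (Ω ∩ boxSet v) :=
  h.convex.inter (convex_boxSet v)

lemma volume_body_ne_top (h : IsQuasiUniform Ω X g C r D x₀) : volume (Ω ∩ boxSet v) ≠ ∞ := by
  refine measure_ne_top_of_subset Set.inter_subset_left (Bornology.IsBounded.measure_lt_top ?_).ne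
  have hx₀ := h.ball_subset (Metric.mem_ball_self h.r_pos)
  refine (Metric.isBounded_iff_subset_closedBall x₀).2 ⟨√(d * D ^ 2), fun x hx => ?_⟩
  rw [Metric.mem_closedBall, EuclideanSpace.dist_eq]
  refine Real.sqrt_le_sqrt ?_
  calc ∑ i, dist (x i) (x₀ i) ^ 2 ≤ ∑ _i : Fin d, D ^ 2 := by
        refine Finset.sum_le_sum fun i _ => ?_
        gcongr
        exact h.coord_le x hx x₀ hx₀ i
    _ = d * D ^ 2 := by simp

/-- Shrinking `Ω` towards a central point of the convex hull of a cluster shows that the body of the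
cluster contains a ball whose radius is proportional to its shortest edge. -/
lemma exists_ball_subset (h : IsQuasiUniform Ω X g C r D x₀) (hd : 0 < d) (hv : v ⊆ X)
    (hne : v.Nonempty) {ω : ℝ} (hω : 0 < ω) (hωv : ∀ i, ω ≤ width v i) :
    ∃ p, Metric.ball p (r * ω / (2 * d * D)) ⊆ Ω ∩ boxSet v := by
  have hd' : (1 : ℝ) ≤ d := by exact_mod_cast hd
  have hD := h.D_pos hd
  have hr := h.r_pos
  obtain ⟨p, hp, hpb⟩ := exists_center hd hne
  have hpΩ : p ∈ Ω := convexHull_min (fun x hx => h.subset x (hv hx)) h.convex hp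
  set t := ω / (2 * d * D) with ht
  have ht0 : 0 < t := by positivity
  have ht1 : t ≤ 1 := by
    rw [ht, div_le_one (by positivity)]
    have := (hωv ⟨0, hd⟩).trans (h.width_le hv hne ⟨0, hd⟩)
    nlinarith
  have hrt : r * ω / (2 * d * D) = r * t := by rw [ht]; ring
  refine ⟨p + t • (x₀ - p), fun z hz => ?_⟩
  set z₀ := x₀ + (1 / t) • (z - (p + t • (x₀ - p))) with hz₀
  have hz₀Ω : z₀ ∈ Ω := by
    refine h.ball_subset ?_
    rw [mem_ball_iff_norm, hz₀, add_sub_cancel_left, norm_smul, Real.norm_of_nonneg (by positivity),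
      one_div, inv_mul_lt_iff₀ ht0, mul_comm, ← hrt]
    rwa [mem_ball_iff_norm] at hz
  have hzz₀ : z = (1 - t) • p + t • z₀ := by
    rw [hz₀, smul_add, smul_smul, mul_one_div_cancel ht0.ne', one_smul]
    module
  refine ⟨?_, fun i => ?_⟩
  · rw [hzz₀]
    exact h.convex hpΩ hz₀Ω (by linarith) ht0.le (by ring)
  · have h₁ : z i = p i + t * (z₀ i - p i) := by
      rw [hzz₀]
      simp only [PiLp.add_apply, PiLp.smul_apply, smul_eq_mul]
      ring
    have h₂ : |t * (z₀ i - p i)| ≤ ω / (2 * d) := by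
      rw [abs_mul, abs_of_pos ht0]
      calc t * |z₀ i - p i| ≤ t * D := by
            gcongr
            exact h.coord_le _ hz₀Ω _ hpΩ i
        _ = ω / (2 * d) := by
            rw [ht]
            field_simp
    have h₃ : ω / (2 * d) ≤ width v i / (2 * d) := by
      gcongr
      exact hωv i
    have h₄ := abs_le.1 h₂
    have h₅ := hpb i
    rw [h₁]
    constructor <;> linarith

/-- The volume of the body of a cluster is controlled by the number of its points. -/
lemma volume_body_le (h : IsQuasiUniform Ω X g C r D x₀) (hv : Descendant Set.univ X v)
    {p : Pt d} {ρ : ℝ} (hρ0 : 0 < ρ) (hρ : Metric.ball p ρ ⊆ Ω ∩ boxSet v) (hCρ : 4 * (C * g) ≤ ρ) :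
    volume.real (Ω ∩ boxSet v) ≤ 2 ^ d * (v.card * ((C * g) ^ d * unitBallVolume d)) := by
  have hCg : 0 ≤ C * g := mul_nonneg (by linarith [h.one_le]) h.pos.le
  refine volume_le_card_mul h.convex_body hρ0 hρ hCg v fun y hy hyK => ?_
  obtain ⟨x, hx, hyx⟩ := h.cover y hyK.1
  refine ⟨x, hv.mem_of_lt hx fun i _ => lt_of_ball_subset_boxSet (r := ρ / 4) (by linarith) ?_ i, hyx⟩
  intro z hz
  refine (hy ?_).2
  rw [Metric.mem_ball] at hz ⊢
  have := dist_triangle z x y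
  rw [dist_comm x y] at this
  linarith

end IsQuasiUniform

namespace IsQuasiUniform

variable {Ω : Set (Pt d)} {X u v v' : Finset (Pt d)} {g C r D : ℝ} {x₀ : Pt d}

/-- The cut edge does not shrink by more than a fixed factor `l`, which is independent of the shape
of the cluster: a thin slab at the end of a convex body cannot contain a quarter of the points. The
shape only enters in how large the body must be compared with `g`. -/
lemma mul_width_le_width_son (h : IsQuasiUniform Ω X g C r D x₀) (hd : 0 < d)
    (hv : Descendant Set.univ X v) {c : Fin d} (hs : IsSon v v' c) {p : Pt d} {ρ : ℝ} (hρ0 : 0 < ρ)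
    (hρ : Metric.ball p ρ ⊆ Ω ∩ boxSet v) (hCρ : 4 * (C * g) ≤ ρ) {l : ℝ} (hl : 0 < l)
    (hlC : 12 * d * (8 * C) ^ d * l ≤ 1) (hL : g ≤ 2 * l * width v c) (hlρ : g ≤ 2 * l * ρ) :
    l * width v c ≤ width v' c := by
  by_contra! hlt
  have hg := h.pos
  have hC := h.one_le
  have hd' : (1 : ℝ) ≤ d := by exact_mod_cast hd
  have hne : v.Nonempty := hs.nonempty.mono hs.subset
  have hvX := hv.subset
  have hv'X := hs.subset.trans hvX
  have hw := width_nonneg hs.nonempty c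
  set L := width v c with hLdef
  set w := width v' c with hwdef
  have hL0 : 0 < L := by
    by_contra! hL0
    nlinarith
  have hβ := unitBallVolume_pos (d := d)
  set β := unitBallVolume d
  have hVol := h.volume_body_le hv hρ0 hρ hCρ
  set θ := w / L + g / (2 * L) + g / (2 * ρ) with hθ
  have h1C : 1 ≤ (8 * C) ^ d := one_le_pow₀ (by linarith)
  have hl12 : 12 * l ≤ 1 := by
    refine le_trans ?_ hlC
    have : 1 ≤ (d : ℝ) * (8 * C) ^ d := one_le_mul_of_one_le_of_one_le hd' h1C
    nlinarith
  have hθl : θ < 3 * l := by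
    have h₁ : w / L < l := by rwa [div_lt_iff₀ hL0]
    have h₂ : g / (2 * L) ≤ l := by
      rw [div_le_iff₀ (by positivity)]
      linarith
    have h₃ : g / (2 * ρ) ≤ l := by
      rw [div_le_iff₀ (by positivity)]
      linarith
    rw [hθ]
    linarith
  have hsK : ∀ x ∈ v', x ∈ Ω ∩ boxSet v := fun x hx =>
    ⟨h.subset x (hv'X hx), subset_boxSet v (hs.subset hx)⟩
  have hsep : ∀ x ∈ v', ∀ y ∈ v', x ≠ y → g ≤ dist x y := fun x hx y hy =>
    h.sep x (hv'X hx) y (hv'X hy)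
  obtain ⟨a, ha, ha'⟩ := exists_eq_lower hne c
  obtain ⟨b, hb, hb'⟩ := exists_eq_upper hne c
  have haK : a ∈ Ω ∩ boxSet v := ⟨h.subset a (hvX ha), subset_boxSet v ha⟩
  have hbK : b ∈ Ω ∩ boxSet v := ⟨h.subset b (hvX hb), subset_boxSet v hb⟩
  have hgρ : g ≤ 2 * ρ := by nlinarith
  have hslab : v'.card * ((g / 2) ^ d * β) ≤ d * θ * (2 ^ d * volume.real (Ω ∩ boxSet v)) := by
    rcases hs.separated with hsp | hsp
    · refine card_slab_le h.convex_body h.volume_body_ne_top hg hgρ hρ (σ := 1) (by simp) c hL0 hw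
        (fun z hz z' hz' => ?_) haK (b := b) ?_ hsK hsep (fun x hx => ?_) hθ (by linarith)
      · have := (hz.2 c).2
        have := (hz'.2 c).1
        rw [hLdef, width]
        linarith
      · rw [ha', hb', hLdef, width]
        linarith
      · rw [one_mul]
        by_cases hbv : b ∈ v'
        · have := le_upper hbv c
          have := lower_le hx c
          rw [hwdef, width]
          linarith
        · linarith [hsp x hx b hb hbv]
    · refine card_slab_le h.convex_body h.volume_body_ne_top hg hgρ hρ (σ := -1) (by simp) c hL0 hw
        (fun z hz z' hz' => ?_) hbK (b := a) ?_ hsK hsep (fun x hx => ?_) hθ (by linarith)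
      · have := (hz'.2 c).2
        have := (hz.2 c).1
        rw [hLdef, width]
        linarith
      · rw [ha', hb', hLdef, width]
        linarith
      · by_cases hav : a ∈ v'
        · have := lower_le hav c
          have := le_upper hx c
          rw [hwdef, width]
          linarith
        · linarith [hsp x hx a ha hav]
  have hcard : (v.card : ℝ) ≤ 4 * v'.card := by exact_mod_cast hs.card_le
  have hpos : (0 : ℝ) < v'.card := by exact_mod_cast Finset.card_pos.2 hs.nonempty
  have hθ0 : 0 ≤ θ := by positivity
  have hCg : 0 < C * g := by positivity
  have hfin : v'.card * ((g / 2) ^ d * β) ≤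
      d * θ * (2 ^ d * (2 ^ d * (4 * v'.card * ((C * g) ^ d * β)))) := by
    refine hslab.trans ?_
    gcongr
    exact hVol.trans (by gcongr)
  have hid : d * θ * (2 ^ d * (2 ^ d * (4 * v'.card * ((C * g) ^ d * β)))) =
      (4 * d * θ * (8 * C) ^ d) * (v'.card * ((g / 2) ^ d * β)) := by
    have : (8 * C) ^ d * (g / 2) ^ d = 2 ^ d * 2 ^ d * (C * g) ^ d := by
      rw [← mul_pow, ← mul_pow, ← mul_pow]
      congr 1
      ring
    linear_combination (-(4 * d * θ * v'.card * β)) * this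
  rw [hid] at hfin
  have h1 : 1 ≤ 4 * d * θ * (8 * C) ^ d := by
    by_contra! hlt1
    have : 0 < v'.card * ((g / 2) ^ d * β) := by positivity
    nlinarith
  have h2 : 4 * d * θ * (8 * C) ^ d < 4 * d * (3 * l) * (8 * C) ^ d := by gcongr
  linarith

/-- The points of `u`, shrunk towards a point `p` deep inside the box of a descendant `v` and
shifted towards a point `m` deep inside the box of `u`, are close to points of `v`. -/
lemma exists_mem_near (h : IsQuasiUniform Ω X g C r D x₀) {I : Set (Fin d)}
    (hu : Descendant Set.univ X u) (huv : Descendant I u v) {p m : Pt d}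
    (hp : p ∈ convexHull ℝ (u : Set (Pt d))) (hm : m ∈ convexHull ℝ (u : Set (Pt d))) {t : ℝ}
    (ht0 : 0 ≤ t) (ht1 : t ≤ 1)
    (hmu : ∀ i, C * g < t / 2 * (m i - lower u i) ∧ C * g < t / 2 * (upper u i - m i))
    (hpv : ∀ i ∈ I, C * g + t * width u i < p i - lower v i ∧
      C * g + t * width u i < upper v i - p i) {a : Pt d} (ha : a ∈ u) :
    ∃ x ∈ v, ∀ i, |((1 - t) * p i + t / 2 * a i + t / 2 * m i) - x i| ≤ C * g := by
  have hau : a ∈ convexHull ℝ (u : Set (Pt d)) := subset_convexHull ℝ _ ha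
  have huΩ : convexHull ℝ (u : Set (Pt d)) ⊆ Ω :=
    convexHull_min (fun x hx => h.subset x (hu.subset hx)) h.convex
  have hubox : convexHull ℝ (u : Set (Pt d)) ⊆ boxSet u :=
    convexHull_min (subset_boxSet u) (convex_boxSet u)
  set A : Pt d := (1 - t) • p + t • ((1 / 2 : ℝ) • a + (1 / 2 : ℝ) • m) with hA
  have hAu : A ∈ convexHull ℝ (u : Set (Pt d)) :=
    convex_convexHull ℝ _ hp (convex_convexHull ℝ _ hau hm (by norm_num) (by norm_num)
      (by norm_num)) (by linarith) ht0 (by ring)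
  have hAi : ∀ i, A i = (1 - t) * p i + t / 2 * a i + t / 2 * m i := by
    intro i
    simp only [hA, PiLp.add_apply, PiLp.smul_apply, smul_eq_mul]
    ring
  obtain ⟨x, hx, hAx⟩ := h.cover A (huΩ hAu)
  have hxi : ∀ i, |(1 - t) * p i + t / 2 * a i + t / 2 * m i - x i| ≤ C * g := by
    intro i
    rw [← hAi]
    exact (abs_apply_sub_le_dist A x i).trans hAx
  have hxu : x ∈ u := by
    refine hu.mem_of_lt hx fun i _ => ?_
    have h₁ := hmu i
    have h₂ := abs_le.1 (hxi i)
    have h₄ := hubox hp i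
    have h₅ := hubox hau i
    have h₆ : 0 ≤ (1 - t) * (p i - lower u i) := mul_nonneg (by linarith) (by linarith)
    have h₇ : 0 ≤ (1 - t) * (upper u i - p i) := mul_nonneg (by linarith) (by linarith)
    have h₈ : 0 ≤ t * (a i - lower u i) := mul_nonneg ht0 (by linarith)
    have h₉ : 0 ≤ t * (upper u i - a i) := mul_nonneg ht0 (by linarith)
    constructor <;> linarith
  refine ⟨x, huv.mem_of_lt hxu fun i hi => ?_, hxi⟩
  have h₁ := hpv i hi
  have h₂ := abs_le.1 (hxi i)
  have h₄ := hubox hp i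
  have h₅ := hubox hau i
  have h₆ := hubox hm i
  rw [width] at h₁
  have e₁ : 0 ≤ t * (a i - lower u i) := mul_nonneg ht0 (by linarith)
  have e₂ : 0 ≤ t * (upper u i - a i) := mul_nonneg ht0 (by linarith)
  have e₃ : 0 ≤ t * (m i - lower u i) := mul_nonneg ht0 (by linarith)
  have e₄ : 0 ≤ t * (upper u i - m i) := mul_nonneg ht0 (by linarith)
  have e₅ : 0 ≤ t * (p i - lower u i) := mul_nonneg ht0 (by linarith)
  have e₆ : 0 ≤ t * (upper u i - p i) := mul_nonneg ht0 (by linarith)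
  constructor <;> linarith

/-- If `v` arises from `u` by cuts in directions in `I`, then a long edge of `u` in a direction `j`
leads to an edge of `v` that is not much shorter than some edge of `v` in `I`. The reason is that
`Ω` contains the convex hull of the points of `u` shrunk towards a central point of `v`, and after
a shift towards the centre of `u` the nearby points of `X` belong to `v`. -/
lemma exists_le_width (h : IsQuasiUniform Ω X g C r D x₀) (hd : 0 < d) {I : Set (Fin d)}
    (hu : Descendant Set.univ X u) (huv : Descendant I u v) (hv : v.Nonempty) (hI : I.Nonempty)
    {j : Fin d} {l κ H : ℝ} (hl : 0 < l) (hl1 : l ≤ 1) (hκ : 0 < κ) (hκ1 : κ ≤ 1)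
    (hpos : ∀ i, 0 < width u i) (hlong : ∀ i, l * width u i ≤ width u j)
    (hasp : ∀ i i', κ * width u i ≤ width u i') (hH : 34 * d ^ 2 * (C * g) ≤ κ * l * H) :
    ∃ i ∈ I, width v i ≤ H ∨ l / (16 * d) * width v i ≤ width v j := by
  by_contra! hcon
  have hg := h.pos
  have hC := h.one_le
  have hd' : (1 : ℝ) ≤ d := by exact_mod_cast hd
  have hvu := huv.subset
  have hne : u.Nonempty := hv.mono hvu
  set η := C * g with hη
  have hη0 : 0 < η := by positivity
  obtain ⟨k, hk, hkmin⟩ := Set.exists_min_image I (fun i => width v i / width u i) I.toFinite hI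
  -- The homothety with ratio `t` fits the box of `u` into that of `v` in all directions of `I`; the
  -- direction `k` with the smallest ratio of edges determines it.
  set t := width v k / (4 * d * width u k) with ht
  obtain ⟨hkH, hkj⟩ := hcon k hk
  have hH0 : 0 < H := by
    by_contra! hH0
    have h₁ : κ * l * H ≤ 0 := mul_nonpos_of_nonneg_of_nonpos (by positivity) hH0
    have h₂ : 0 < 34 * (d : ℝ) ^ 2 * η := by positivity
    linarith
  have hvk : 0 < width v k := hH0.trans hkH
  have ht0 : 0 < t := by
    have := hpos k
    positivity
  have ht1 : t ≤ 1 := by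
    rw [ht, div_le_one (by have := hpos k; positivity)]
    have := width_mono hvu hv k
    nlinarith [hpos k]
  have htI : ∀ i ∈ I, t * width u i ≤ width v i / (4 * d) := by
    intro i hi
    have h₁ := hkmin i hi
    have h₂ := hpos i
    have h₃ := hpos k
    rw [div_le_div_iff₀ h₃ h₂] at h₁
    rw [ht, div_mul_eq_mul_div, div_le_div_iff₀ (by positivity) (by positivity)]
    nlinarith
  obtain ⟨p, hp, hpb⟩ := exists_center hd hv
  obtain ⟨m, hm, hmb⟩ := exists_center hd hne
  have hpu : p ∈ convexHull ℝ (u : Set (Pt d)) := convexHull_mono (Finset.coe_subset.2 hvu) hp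
  have hηκ : ∀ i, η < t / 2 * (width u i / (2 * d)) := by
    intro i
    have h₁ := hasp k i
    have h₃ := hpos k
    have h₂ : t / 2 * (width u i / (2 * d)) = width v k * width u i / (16 * d ^ 2 * width u k) := by
      rw [ht]
      field_simp
      ring
    rw [h₂, lt_div_iff₀ (by positivity)]
    have h₄ : κ * l * H ≤ κ * H := by nlinarith [mul_pos hκ hH0]
    have h₅ : κ * H < κ * width v k := by gcongr
    have h₆ : 0 < (d : ℝ) ^ 2 * η := by positivity
    calc η * (16 * d ^ 2 * width u k) = 16 * d ^ 2 * η * width u k := by ring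
      _ < κ * width v k * width u k := mul_lt_mul_of_pos_right (by linarith) h₃
      _ = width v k * (κ * width u k) := by ring
      _ ≤ width v k * width u i := by gcongr
  have hηI : ∀ i ∈ I, η < width v i / (4 * d) := by
    intro i hi
    have h₈ : κ * l * H ≤ H := mul_le_of_le_one_left hH0.le (mul_le_one₀ hκ1 hl.le hl1)
    have h₉ := (hcon i hi).1
    rw [lt_div_iff₀ (by positivity)]
    have h₁₀ : (d : ℝ) * η ≤ d ^ 2 * η := by
      gcongr
      nlinarith
    have h₁₁ : 0 < (d : ℝ) * η := by positivity
    linarith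
  have hhalf : ∀ i, width v i / (2 * d) = 2 * (width v i / (4 * d)) := by
    intro i
    field_simp
    norm_num
  have key : ∀ a ∈ u, ∃ x ∈ v, ∀ i, |((1 - t) * p i + t / 2 * a i + t / 2 * m i) - x i| ≤ η := by
    intro a ha
    refine h.exists_mem_near hu huv hpu hm ht0.le ht1 (fun i => ?_) (fun i hi => ?_) ha
    · have h₁ := hηκ i
      have h₂ := hmb i
      have h₃ : t / 2 * (width u i / (2 * d)) ≤ t / 2 * (m i - lower u i) := by
        gcongr
        linarith
      have h₄ : t / 2 * (width u i / (2 * d)) ≤ t / 2 * (upper u i - m i) := by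
        gcongr
        linarith
      exact ⟨h₁.trans_le h₃, h₁.trans_le h₄⟩
    · have h₁ := htI i hi
      have h₂ := hηI i hi
      have h₃ := hpb i
      rw [hhalf] at h₃
      constructor <;> linarith
  -- The images of the two ends of `u` in direction `j` are `t / 2 * width u j` apart.
  obtain ⟨a, ha, ha'⟩ := exists_eq_lower hne j
  obtain ⟨b, hb, hb'⟩ := exists_eq_upper hne j
  obtain ⟨x, hx, hxa⟩ := key a ha
  obtain ⟨y, hy, hyb⟩ := key b hb
  have h₁ := abs_le.1 (hxa j)
  have h₂ := abs_le.1 (hyb j)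
  have h₃ := lower_le hx j
  have h₄ := le_upper hy j
  have h₅ : t / 2 * width u j - 2 * η ≤ width v j := by
    rw [width, width, ← ha', ← hb']
    linarith
  have h₆ : t / 2 * (l * width u k) ≤ t / 2 * width u j := by
    gcongr
    exact hlong k
  have h₇ : t / 2 * (l * width u k) = l / (8 * d) * width v k := by
    have := (hpos k).ne'
    rw [ht]
    field_simp
    norm_num
  have h₈ : l / (8 * d) * width v k = 2 * (l / (16 * d) * width v k) := by
    field_simp
    norm_num
  have h₉ : 2 * η ≤ l / (16 * d) * width v k := by
    rw [div_mul_eq_mul_div, le_div_iff₀ (by positivity)]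
    have h₁₀ : κ * l * H ≤ l * width v k := by
      calc κ * l * H ≤ 1 * l * width v k := by gcongr
        _ = l * width v k := by ring
    have : (d : ℝ) * η ≤ d ^ 2 * η := by
      gcongr
      nlinarith
    nlinarith
  linarith

end IsQuasiUniform

/-- If no set of indices has values much smaller than all values outside, then all values are
comparable. -/
lemma pow_mul_le_of_forall_exists {f : Fin d → ℝ} (hf : ∀ i, 0 ≤ f i) {c : ℝ} (hc : 0 < c)
    (hc1 : c ≤ 1)
    (h : ∀ S : Finset (Fin d), S.Nonempty → Sᶜ.Nonempty → ∃ j ∈ S, ∃ i ∈ Sᶜ, c * f i ≤ f j)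
    (i j : Fin d) : c ^ d * f i ≤ f j := by
  have key : ∀ k : ℕ, min (k + 1) d ≤ (Finset.univ.filter fun j => c ^ k * f i ≤ f j).card := by
    intro k
    induction k with
    | zero =>
      refine (min_le_left _ _).trans (Finset.card_pos.2 ⟨i, by simp⟩)
    | succ k ih =>
      set T := Finset.univ.filter fun j => c ^ k * f i ≤ f j with hT
      set T' := Finset.univ.filter fun j => c ^ (k + 1) * f i ≤ f j with hT'
      have hsub : T ⊆ T' := by
        intro j hj
        simp only [hT, hT', Finset.mem_filter, Finset.mem_univ, true_and] at hj ⊢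
        refine le_trans ?_ hj
        rw [pow_succ]
        have : 0 ≤ c ^ k * f i := mul_nonneg (by positivity) (hf i)
        nlinarith
      by_cases hne : (Tᶜ).Nonempty
      · have hTne : T.Nonempty := ⟨i, by
          simp only [hT, Finset.mem_filter, Finset.mem_univ, true_and]
          exact mul_le_of_le_one_left (hf i) (pow_le_one₀ hc.le hc1)⟩
        obtain ⟨j, hj, i', hi', hij⟩ := h Tᶜ hne (by rwa [compl_compl])
        rw [compl_compl] at hi'
        have hjT' : j ∈ T' := by
          simp only [hT, hT', Finset.mem_filter, Finset.mem_univ, true_and] at hi' ⊢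
          refine le_trans ?_ hij
          rw [pow_succ', mul_assoc]
          gcongr
        have hlt : T.card < T'.card := Finset.card_lt_card
          ⟨hsub, fun hs => Finset.mem_compl.1 hj (hs hjT')⟩
        omega
      · rw [Finset.not_nonempty_iff_eq_empty, Finset.compl_eq_empty_iff] at hne
        have : T'.card = d := by
          rw [hne, Finset.univ_subset_iff] at hsub
          rw [hsub, Finset.card_univ, Fintype.card_fin]
        omega
  have hd := key d
  rw [min_eq_right (by omega)] at hd
  have huniv : (Finset.univ.filter fun j => c ^ d * f i ≤ f j) = Finset.univ := by
    refine Finset.eq_univ_of_card _ (le_antisymm (Finset.card_le_univ _) ?_)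
    rwa [Fintype.card_fin]
  have := huniv ▸ Finset.mem_univ j
  simpa using this

/-! ### Shape regularity of the clusters -/

/-- All edges of the bounding box have comparable lengths. -/
def HasComparableEdges (κ : ℝ) (v : Finset (Pt d)) : Prop := ∀ i i', κ * width v i ≤ width v i'

/-- Constants for the shape regularity of clusters: `l` bounds the shrinking of a cut edge, `κ` the
ratio of two edges, and edges shorter than `M` times the separation distance are disregarded. The
inequalities are met by choosing `l`, then `κ`, then `M`. -/
structure ShapeConstants (d : ℕ) (C r D l κ M : ℝ) : Prop where
  l_pos : 0 < l
  l_le : 12 * d * (8 * C) ^ d * l ≤ 1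
  l_le' : 2 * D * l ≤ r
  κ_eq : κ = (l / (16 * d)) ^ d
  root_le : 4 * C * D ≤ M * r
  lt_M : 34 * d ^ 2 * C < κ ^ 2 * l * M
  cover_le : 8 * d * D * C ≤ r * κ * M
  ball_le : d * D ≤ l * r * κ * M
  one_le_M : 1 ≤ 2 * l * M

lemma exists_shapeConstants (hd : 0 < d) {C r D : ℝ} (hC : 1 ≤ C) (hr : 0 < r) (hD : 0 < D) :
    ∃ l κ M : ℝ, ShapeConstants d C r D l κ M := by
  have hd' : (1 : ℝ) ≤ d := by exact_mod_cast hd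
  have hC0 : 0 < C := by linarith
  set a := 12 * (d : ℝ) * (8 * C) ^ d with ha
  have ha0 : 0 < a := by positivity
  set l := min (1 / a) (r / (2 * D)) with hl
  have hl0 : 0 < l := lt_min (by positivity) (by positivity)
  set κ := (l / (16 * d)) ^ d with hκ
  have hκ0 : 0 < κ := by positivity
  set M := 4 * C * D / r + (34 * d ^ 2 * C + 1) / (κ ^ 2 * l) + 8 * d * D * C / (r * κ) +
    d * D / (l * r * κ) + 1 / (2 * l) with hM
  have hpos₁ : 0 ≤ 4 * C * D / r := by positivity
  have hpos₂ : 0 ≤ (34 * d ^ 2 * C + 1) / (κ ^ 2 * l) := by positivity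
  have hpos₃ : 0 ≤ 8 * d * D * C / (r * κ) := by positivity
  have hpos₄ : 0 ≤ d * D / (l * r * κ) := by positivity
  have hpos₅ : 0 ≤ 1 / (2 * l) := by positivity
  refine ⟨l, κ, M, hl0, ?_, ?_, hκ, ?_, ?_, ?_, ?_, ?_⟩
  · have := min_le_left (1 / a) (r / (2 * D))
    rw [← hl, le_div_iff₀ ha0] at this
    linarith
  · have := min_le_right (1 / a) (r / (2 * D))
    rw [← hl, le_div_iff₀ (by positivity)] at this
    linarith
  · rw [← div_le_iff₀ hr]
    linarith
  · have : 34 * d ^ 2 * C + 1 ≤ M * (κ ^ 2 * l) := by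
      rw [← div_le_iff₀ (by positivity)]
      linarith
    linarith
  · have : 8 * d * D * C ≤ M * (r * κ) := by
      rw [← div_le_iff₀ (by positivity)]
      linarith
    linarith
  · have : d * D ≤ M * (l * r * κ) := by
      rw [← div_le_iff₀ (by positivity)]
      linarith
    linarith
  · have : 1 ≤ M * (2 * l) := by
      rw [← div_le_iff₀ (by positivity)]
      linarith
    linarith

/-- The invariant of the splitting. A cluster with an edge of at least `M * g` has comparable edges;
moreover every set `S` of directions has a direction that was long in some ancestor and after which
no direction in `S` was cut: either the last cut in `S`, or the root. -/
def IsShapeRegular (X : Finset (Pt d)) (g l κ M : ℝ) (v : Finset (Pt d)) : Prop :=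
  Descendant Set.univ X v ∧ ((∃ i, M * g ≤ width v i) → HasComparableEdges κ v ∧
    ∀ S : Finset (Fin d), S.Nonempty → ∃ u, ∃ j ∈ S, Descendant (↑S)ᶜ u v ∧
      Descendant Set.univ X u ∧ (∀ i, l * width u i ≤ width u j) ∧
      (u = v ∨ HasComparableEdges κ u))

namespace ShapeConstants

variable {Ω : Set (Pt d)} {X v v' : Finset (Pt d)} {g C r D l κ M : ℝ} {x₀ : Pt d}

lemma l_le_one (hc : ShapeConstants d C r D l κ M) (hd : 0 < d) (hC : 1 ≤ C) : l ≤ 1 := by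
  have hd' : (1 : ℝ) ≤ d := by exact_mod_cast hd
  have h₁ : (1 : ℝ) ≤ d * (8 * C) ^ d :=
    one_le_mul_of_one_le_of_one_le hd' (one_le_pow₀ (by linarith))
  have := hc.l_le
  have := hc.l_pos
  nlinarith

lemma κ_pos (hc : ShapeConstants d C r D l κ M) (hd : 0 < d) : 0 < κ := by
  have hd' : (0 : ℝ) < d := by exact_mod_cast hd
  have := hc.l_pos
  rw [hc.κ_eq]
  positivity

lemma κ_le (hc : ShapeConstants d C r D l κ M) (hd : 0 < d) (hC : 1 ≤ C) : κ ≤ l := by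
  have hd' : (1 : ℝ) ≤ d := by exact_mod_cast hd
  have hl := hc.l_pos
  have hl1 := hc.l_le_one hd hC
  have h₁ : l / (16 * d) ≤ l := div_le_self hl.le (by linarith)
  rw [hc.κ_eq]
  calc (l / (16 * d)) ^ d ≤ (l / (16 * d)) ^ 1 :=
        pow_le_pow_of_le_one (by positivity) (h₁.trans hl1) hd
    _ ≤ l := by rwa [pow_one]

lemma M_pos (hc : ShapeConstants d C r D l κ M) : 0 < M := by
  have := hc.l_pos
  have := hc.one_le_M
  by_contra! h
  nlinarith

/-- A cluster with comparable edges and an edge of length `W ≥ M * g` contains a ball that is large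
compared with `g`. -/
lemma exists_large_ball (hc : ShapeConstants d C r D l κ M) (hd : 0 < d)
    (h : IsQuasiUniform Ω X g C r D x₀) (hv : v ⊆ X) (hne : v.Nonempty)
    (hκv : HasComparableEdges κ v) {i : Fin d} (hi : M * g ≤ width v i) :
    ∃ p, Metric.ball p (r * (κ * width v i) / (2 * d * D)) ⊆ Ω ∩ boxSet v ∧
      0 < r * (κ * width v i) / (2 * d * D) ∧
      4 * (C * g) ≤ r * (κ * width v i) / (2 * d * D) ∧
      g ≤ 2 * l * (r * (κ * width v i) / (2 * d * D)) := by
  have hd' : (1 : ℝ) ≤ d := by exact_mod_cast hd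
  have hg := h.pos
  have hr := h.r_pos
  have hD := h.D_pos hd
  have hκ := hc.κ_pos hd
  have hl := hc.l_pos
  have hW : 0 < width v i := (mul_pos hc.M_pos hg).trans_le hi
  obtain ⟨p, hp⟩ := h.exists_ball_subset hd hv hne (ω := κ * width v i) (by positivity) (hκv i)
  refine ⟨p, hp, by positivity, ?_, ?_⟩
  · rw [le_div_iff₀ (by positivity)]
    calc 4 * (C * g) * (2 * d * D) = 8 * d * D * C * g := by ring
      _ ≤ r * κ * M * g := by
          have := hc.cover_le
          gcongr
      _ = r * κ * (M * g) := by ring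
      _ ≤ r * κ * width v i := by gcongr
      _ = r * (κ * width v i) := by ring
  · rw [mul_div_assoc', le_div_iff₀ (by positivity)]
    calc g * (2 * d * D) = 2 * (d * D) * g := by ring
      _ ≤ 2 * (l * r * κ * M) * g := by
          have := hc.ball_le
          gcongr
      _ = 2 * (l * r * κ) * (M * g) := by ring
      _ ≤ 2 * (l * r * κ) * width v i := by gcongr
      _ = 2 * l * (r * (κ * width v i)) := by ring

/-- The second half of the invariant implies the first one. -/
lemma hasComparableEdges (hc : ShapeConstants d C r D l κ M) (hd : 0 < d)
    (h : IsQuasiUniform Ω X g C r D x₀) (hne : v.Nonempty) (hv : ∃ i, M * g ≤ width v i)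
    (hS : ∀ S : Finset (Fin d), S.Nonempty → ∃ u, ∃ j ∈ S, Descendant (↑S)ᶜ u v ∧
      Descendant Set.univ X u ∧ (∀ i, l * width u i ≤ width u j) ∧
      (u = v ∨ HasComparableEdges κ u)) : HasComparableEdges κ v := by
  have hd' : (1 : ℝ) ≤ d := by exact_mod_cast hd
  have hg := h.pos
  have hC := h.one_le
  have hl := hc.l_pos
  have hl1 := hc.l_le_one hd hC
  have hκ := hc.κ_pos hd
  have hκl := hc.κ_le hd hC
  obtain ⟨i₀, hi₀⟩ := hv
  have hW : 0 < width v i₀ := (mul_pos hc.M_pos hg).trans_le hi₀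
  set H := 34 * d ^ 2 * (C * g) / (κ * l) with hH
  have hH' : 34 * d ^ 2 * (C * g) = κ * l * H := by
    rw [hH]
    field_simp
  have hcl : l / (16 * d) ≤ l := div_le_self hl.le (by linarith)
  have hc0 : 0 < l / (16 * d) := by positivity
  -- Edges shorter than `H` are replaced by `H`; the conclusion below excludes them.
  have hcomp := pow_mul_le_of_forall_exists (f := fun i => max (width v i) H)
    (fun i => le_max_of_le_left (width_nonneg hne i)) hc0 (hcl.trans hl1) (by
      intro S hSne hSc
      obtain ⟨u, j, hj, huv, hu, hlong, hcase⟩ := hS S hSne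
      refine ⟨j, hj, ?_⟩
      rcases hcase with rfl | hκu
      · obtain ⟨i, hi⟩ := hSc
        refine ⟨i, hi, ?_⟩
        rw [mul_max_of_nonneg _ _ hc0.le]
        refine max_le_max ?_ ?_
        · have := width_nonneg hne i
          exact (mul_le_mul_of_nonneg_right hcl this).trans (hlong i)
        · exact mul_le_of_le_one_left (by positivity) (hcl.trans hl1)
      · have hpos : ∀ i, 0 < width u i := fun i => by
          have h₁ := hκu i₀ i
          have h₂ := width_mono huv.subset hne i₀
          have : 0 < κ * width u i₀ := mul_pos hκ (hW.trans_le h₂)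
          linarith
        obtain ⟨i, hi, hij⟩ := h.exists_le_width hd hu huv hne
          (by obtain ⟨i, hi⟩ := hSc; exact ⟨i, by simpa using hi⟩) hl hl1 hκ (hκl.trans hl1) hpos
          hlong hκu hH'.le
        refine ⟨i, by simpa using hi, ?_⟩
        have hH0 : 0 ≤ H := by positivity
        rcases hij with hij | hij
        · rw [max_eq_right hij]
          exact (mul_le_of_le_one_left hH0 (hcl.trans hl1)).trans (le_max_right _ _)
        · rw [mul_max_of_nonneg _ _ hc0.le]
          exact max_le_max hij (mul_le_of_le_one_left hH0 (hcl.trans hl1)))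
  rw [← hc.κ_eq] at hcomp
  have hbig : H < κ * width v i₀ := by
    refine lt_of_lt_of_le ?_ (mul_le_mul_of_nonneg_left hi₀ hκ.le)
    rw [hH, div_lt_iff₀ (by positivity)]
    have := mul_lt_mul_of_pos_right hc.lt_M hg
    calc 34 * d ^ 2 * (C * g) = 34 * d ^ 2 * C * g := by ring
      _ < κ ^ 2 * l * M * g := this
      _ = κ * (M * g) * (κ * l) := by ring
  intro i j
  have h₁ := hcomp i₀ j
  have h₂ := hcomp i j
  have h₃ : κ * width v i₀ ≤ κ * max (width v i₀) H := by gcongr; exact le_max_left _ _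
  have h₄ : κ * width v i ≤ κ * max (width v i) H := by gcongr; exact le_max_left _ _
  rcases le_max_iff.1 h₁ with h₅ | h₅
  · have h₆ : H ≤ width v j := by linarith
    rw [max_eq_left h₆] at h₂
    exact h₄.trans h₂
  · linarith

lemma isShapeRegular_root (hc : ShapeConstants d C r D l κ M) (hd : 0 < d)
    (h : IsQuasiUniform Ω X g C r D x₀) (hX : X.Nonempty) : IsShapeRegular X g l κ M X := by
  refine ⟨Descendant.refl, ?_⟩
  rintro ⟨i, hi⟩
  have hg := h.pos
  have hr := h.r_pos
  have hD := h.D_pos hd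
  have hC := h.one_le
  have hl := hc.l_pos
  have hκl := hc.κ_le hd hC
  have hκ := hc.κ_pos hd
  have hwD := fun j => h.width_le subset_rfl hX j
  have hη : 4 * (C * g) ≤ r := by
    have h₁ := hi.trans (hwD i)
    have h₂ := hc.root_le
    have h₃ : 4 * C * D * g ≤ D * r := by
      calc 4 * C * D * g ≤ M * r * g := by gcongr
        _ = M * g * r := by ring
        _ ≤ D * r := by gcongr
    nlinarith
  have hwr : ∀ j, r / 2 ≤ width X j := by
    intro j
    have hmem : ∀ s : ℝ, |s| < r → x₀ + EuclideanSpace.single j s ∈ Ω := by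
      intro s hs
      refine h.ball_subset ?_
      rw [mem_ball_iff_norm, add_sub_cancel_left, PiLp.norm_single]
      exact hs
    obtain ⟨x, hx, hx'⟩ := h.cover _ (hmem (r / 2) (by rw [abs_of_pos] <;> linarith))
    obtain ⟨y, hy, hy'⟩ := h.cover _ (hmem (-(r / 2)) (by rw [abs_neg, abs_of_pos] <;> linarith))
    have h₁ := abs_le.1 ((abs_apply_sub_le_dist _ x j).trans hx')
    have h₂ := abs_le.1 ((abs_apply_sub_le_dist _ y j).trans hy')
    simp at h₁ h₂
    have h₃ := lower_le hy j
    have h₄ := le_upper hx j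
    rw [width]
    linarith
  have hlong : ∀ i j, l * width X i ≤ width X j := by
    intro i j
    have h₁ : l * width X i ≤ l * D := by
      gcongr
      exact hwD i
    linarith [hwr j, hc.l_le']
  refine ⟨fun i j => le_trans ?_ (hlong i j), fun S hS => ?_⟩
  · have := width_nonneg hX i
    gcongr
  · obtain ⟨j, hj⟩ := hS
    exact ⟨X, j, hj, Descendant.refl, Descendant.refl, fun i => hlong i j, Or.inl rfl⟩

lemma isShapeRegular_son (hc : ShapeConstants d C r D l κ M) (hd : 0 < d)
    (h : IsQuasiUniform Ω X g C r D x₀) (hv : IsShapeRegular X g l κ M v) {c : Fin d}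
    (hs : IsSon v v' c) : IsShapeRegular X g l κ M v' := by
  refine ⟨hv.1.son hs (Set.mem_univ c), ?_⟩
  rintro ⟨i, hi⟩
  have hi' : M * g ≤ width v i := hi.trans (width_mono hs.subset hs.nonempty i)
  have hne : v.Nonempty := hs.nonempty.mono hs.subset
  obtain ⟨hκv, hS⟩ := hv.2 ⟨i, hi'⟩
  have hic : M * g ≤ width v c := hi'.trans (hs.longest i)
  have hl := hc.l_pos
  have hg := h.pos
  have hcut : l * width v c ≤ width v' c := by
    obtain ⟨p, hp, hρ0, hρ₁, hρ₂⟩ := hc.exists_large_ball hd h hv.1.subset hne hκv hic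
    refine h.mul_width_le_width_son hd hv.1 hs hρ0 hp hρ₁ hl hc.l_le ?_ hρ₂
    calc g ≤ 2 * l * M * g := le_mul_of_one_le_left hg.le hc.one_le_M
      _ = 2 * l * (M * g) := by ring
      _ ≤ 2 * l * width v c := by gcongr
  have hS' : ∀ S : Finset (Fin d), S.Nonempty → ∃ u, ∃ j ∈ S, Descendant (↑S)ᶜ u v' ∧
      Descendant Set.univ X u ∧ (∀ i, l * width u i ≤ width u j) ∧
      (u = v' ∨ HasComparableEdges κ u) := by
    intro S hSne
    by_cases hcS : c ∈ S
    · refine ⟨v', c, hcS, Descendant.refl, hv.1.son hs (Set.mem_univ c), fun i => ?_, Or.inl rfl⟩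
      refine le_trans ?_ hcut
      gcongr
      exact (width_mono hs.subset hs.nonempty i).trans (hs.longest i)
    · obtain ⟨u, j, hj, huv, hu, hlong, hcase⟩ := hS S hSne
      refine ⟨u, j, hj, huv.son hs (by simpa using hcS), hu, hlong, Or.inr ?_⟩
      rcases hcase with rfl | hκu
      · exact hκv
      · exact hκu
  exact ⟨hc.hasComparableEdges hd h hs.nonempty ⟨i, hi⟩ hS', hS'⟩

/-- The edges of the bounding box of a cluster are bounded in terms of the number of its points. -/
lemma width_pow_le (hc : ShapeConstants d C r D l κ M) (hd : 0 < d)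
    (h : IsQuasiUniform Ω X g C r D x₀) (hv : IsShapeRegular X g l κ M v) (hne : v.Nonempty)
    (i : Fin d) : width v i ^ d ≤ ((4 * C * d * D / (r * κ)) ^ d + M ^ d) * (g ^ d * v.card) := by
  have hg := h.pos
  have hC := h.one_le
  have hr := h.r_pos
  have hD := h.D_pos hd
  have hκ := hc.κ_pos hd
  have hM := hc.M_pos
  have hd' : (1 : ℝ) ≤ d := by exact_mod_cast hd
  have hcard : (1 : ℝ) ≤ v.card := by exact_mod_cast Finset.card_pos.2 hne
  have hw := width_nonneg hne i
  rcases le_total (width v i) (M * g) with hi | hi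
  · calc width v i ^ d ≤ (M * g) ^ d := by gcongr
      _ = M ^ d * (g ^ d * 1) := by ring
      _ ≤ ((4 * C * d * D / (r * κ)) ^ d + M ^ d) * (g ^ d * v.card) := by
          gcongr
          exact le_add_of_nonneg_left (by positivity)
  · obtain ⟨p, hp, hρ0, hρ₁, -⟩ := hc.exists_large_ball hd h hv.1.subset hne (hv.2 ⟨i, hi⟩).1 hi
    have h₁ := h.volume_body_le hv.1 hρ0 hp hρ₁
    have h₂ := measureReal_mono hp h.volume_body_ne_top
    rw [volume_ball_eq p hρ0] at h₂
    have h₃ := h₂.trans h₁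
    have hβ := unitBallVolume_pos (d := d)
    have h₄ : (r * (κ * width v i) / (2 * d * D)) ^ d ≤ (2 * C * g) ^ d * v.card := by
      refine le_of_mul_le_mul_right ?_ hβ
      calc _ ≤ _ := h₃
        _ = (2 * C * g) ^ d * v.card * unitBallVolume d := by
            rw [mul_assoc 2 C g, mul_pow 2 (C * g)]
            ring
    have h₅ : width v i = 2 * d * D / (r * κ) * (r * (κ * width v i) / (2 * d * D)) := by
      field_simp
    calc width v i ^ d
        = (2 * d * D / (r * κ)) ^ d * (r * (κ * width v i) / (2 * d * D)) ^ d := by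
          rw [← mul_pow, ← h₅]
      _ ≤ (2 * d * D / (r * κ)) ^ d * ((2 * C * g) ^ d * v.card) := by gcongr
      _ = (4 * C * d * D / (r * κ)) ^ d * (g ^ d * v.card) := by
          have : (2 * d * D / (r * κ)) ^ d * (2 * C * g) ^ d =
              (4 * C * d * D / (r * κ)) ^ d * g ^ d := by
            rw [← mul_pow, ← mul_pow]
            congr 1
            field_simp
            ring
          rw [← mul_assoc, this, mul_assoc]
      _ ≤ ((4 * C * d * D / (r * κ)) ^ d + M ^ d) * (g ^ d * v.card) := by
          exact mul_le_mul_of_nonneg_right (le_add_of_nonneg_right (by positivity))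
            (mul_nonneg (by positivity) (Nat.cast_nonneg _))

end ShapeConstants

/-! ### Clusters of the tree as finite sets -/

open Classical in
/-- The points of a cluster as a finite set. -/
noncomputable def Cluster.points (c : Cluster d) : Finset (Pt d) := c.pts.toFinset

lemma Cluster.mem_points {c : Cluster d} {x : Pt d} : x ∈ c.points ↔ x ∈ c.pts := by
  simp [Cluster.points]

lemma Cluster.card_points {c : Cluster d} (hc : c.pts.Nodup) : c.points.card = c.pts.length :=
  List.toFinset_card_of_nodup hc

lemma Cluster.points_nonempty {c : Cluster d} (hc : c.pts ≠ []) : c.points.Nonempty := by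
  obtain ⟨x, hx⟩ := List.exists_mem_of_ne_nil _ hc
  exact ⟨x, Cluster.mem_points.2 hx⟩

lemma IsBoundingBox.sub_eq_width {c : Cluster d} (h : IsBoundingBox c.box c.pts) (i : Fin d) :
    c.box.hi i - c.box.lo i = width c.points i := by
  obtain ⟨a, ha, ha'⟩ := h.exists_eq_lo i
  obtain ⟨b, hb, hb'⟩ := h.exists_eq_hi i
  have hne : c.points.Nonempty := ⟨a, Cluster.mem_points.2 ha⟩
  obtain ⟨a₁, ha₁, ha₁'⟩ := exists_eq_lower hne i
  obtain ⟨b₁, hb₁, hb₁'⟩ := exists_eq_upper hne i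
  have h₁ := h.lo_le i a₁ (Cluster.mem_points.1 ha₁)
  have h₂ := h.le_hi i b₁ (Cluster.mem_points.1 hb₁)
  have h₃ := lower_le (Cluster.mem_points.2 ha) i
  have h₄ := le_upper (Cluster.mem_points.2 hb) i
  rw [width]
  linarith

lemma IsBisection.isSon {m : ℕ} {c : Cluster d} {l r : Tree (Cluster d)}
    (h : IsBisection m (.node c l r)) :
    ∃ i, IsSon c.points l.label.points i ∧ IsSon c.points r.label.points i := by
  obtain ⟨-, hn, hB, hperm, hl, hr, ⟨i, hi, hsep⟩, hbl, hbr⟩ := h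
  have hmem : ∀ x, x ∈ c.pts ↔ x ∈ l.label.pts ∨ x ∈ r.label.pts := fun x => by
    rw [← hperm.mem_iff, List.mem_append]
  have hlen := hperm.length_eq
  rw [List.length_append] at hlen
  have hlong : ∀ j, width c.points j ≤ width c.points i := fun j => by
    rw [← hB.sub_eq_width, ← hB.sub_eq_width]
    exact hi j
  refine ⟨i, ⟨fun x hx => ?_, Cluster.points_nonempty hbl.label.1, ?_, hlong, Or.inl ?_⟩,
    ⟨fun x hx => ?_, Cluster.points_nonempty hbr.label.1, ?_, hlong, Or.inr ?_⟩⟩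
  · exact Cluster.mem_points.2 ((hmem x).2 (Or.inl (Cluster.mem_points.1 hx)))
  · rw [Cluster.card_points hn, Cluster.card_points hbl.label.2.1]
    omega
  · intro x hx y hy hy'
    rw [Cluster.mem_points] at hx hy hy'
    exact hsep x hx y (((hmem y).1 hy).resolve_left hy')
  · exact Cluster.mem_points.2 ((hmem x).2 (Or.inr (Cluster.mem_points.1 hx)))
  · rw [Cluster.card_points hn, Cluster.card_points hbr.label.2.1]
    omega
  · intro x hx y hy hy'
    rw [Cluster.mem_points] at hx hy hy'
    exact hsep y (((hmem y).1 hy).resolve_right hy') x hx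

lemma IsBisection.forall_mem {m : ℕ} {P : Finset (Pt d) → Prop}
    (hP : ∀ v v' i, P v → IsSon v v' i → P v') : ∀ {t : Tree (Cluster d)}, IsBisection m t →
      P t.label.points → ∀ c ∈ t.toList, P c.points
  | .leaf c, _, hp, c', hc' => by
    obtain rfl := List.mem_singleton.1 hc'
    exact hp
  | .node c l r, h, hp, c', hc' => by
    obtain ⟨i, hl, hr⟩ := h.isSon
    simp only [Tree.toList, List.mem_cons, List.mem_append] at hc'
    rcases hc' with rfl | hc' | hc'
    · exact hp
    · exact forall_mem hP h.2.2.2.2.2.2.2.1 (hP _ _ _ hp hl) c' hc'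
    · exact forall_mem hP h.2.2.2.2.2.2.2.2 (hP _ _ _ hp hr) c' hc'

lemma IsBisection.mem {m : ℕ} : ∀ {t : Tree (Cluster d)}, IsBisection m t → ∀ c ∈ t.toList,
    c.pts ≠ [] ∧ c.pts.Nodup ∧ IsBoundingBox c.box c.pts
  | .leaf c, h, c', hc' => by
    obtain rfl := List.mem_singleton.1 hc'
    exact h.label
  | .node c l r, h, c', hc' => by
    simp only [Tree.toList, List.mem_cons, List.mem_append] at hc'
    rcases hc' with rfl | hc' | hc'
    · exact h.label
    · exact h.2.2.2.2.2.2.2.1.mem c' hc'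
    · exact h.2.2.2.2.2.2.2.2.mem c' hc'

/-! ### Counting clusters -/

/-- The tree has logarithmic depth, and the clusters of one level are disjoint. -/
lemma IsBisection.weight_le {m : ℕ} : ∀ {t : Tree (Cluster d)}, IsBisection m t →
    (t.weight : ℝ) ≤
      t.label.pts.length * (1 + Real.log t.label.pts.length / Real.log (4 / 3))
  | .leaf c, h => by
    have h₁ : 0 < Real.log (4 / 3) := Real.log_pos (by norm_num)
    have h₂ : 0 ≤ Real.log c.pts.length := Real.log_natCast_nonneg _
    have : 0 ≤ (c.pts.length : ℝ) * (Real.log c.pts.length / Real.log (4 / 3)) := by positivity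
    simp only [Tree.weight, Tree.toList, List.map_cons, List.map_nil, List.sum_cons, List.sum_nil,
      add_zero, Tree.label]
    linarith
  | .node c l r, h => by
    obtain ⟨hc, -, -, hperm, hl, hr, -, hbl, hbr⟩ := h
    have ihl := hbl.weight_le
    have ihr := hbr.weight_le
    have hlen := hperm.length_eq
    rw [List.length_append] at hlen
    have hL : 0 < Real.log (4 / 3) := Real.log_pos (by norm_num)
    have hn : (0 : ℝ) < c.pts.length := by exact_mod_cast List.length_pos_iff.2 hc
    have key : ∀ s : Tree (Cluster d), s.label.pts ≠ [] →
        4 * s.label.pts.length ≤ 3 * c.pts.length →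
        1 + Real.log s.label.pts.length / Real.log (4 / 3) ≤
          Real.log c.pts.length / Real.log (4 / 3) := by
      intro s hs hsl
      have hs' : (0 : ℝ) < s.label.pts.length := by exact_mod_cast List.length_pos_iff.2 hs
      have hsl' : (4 : ℝ) * s.label.pts.length ≤ 3 * c.pts.length := by exact_mod_cast hsl
      rw [← sub_nonneg, show Real.log c.pts.length / Real.log (4 / 3) -
        (1 + Real.log s.label.pts.length / Real.log (4 / 3)) = (Real.log c.pts.length -
          (Real.log (4 / 3) + Real.log s.label.pts.length)) / Real.log (4 / 3) by field_simp,
        ← Real.log_mul (by norm_num) hs'.ne']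
      refine div_nonneg (sub_nonneg.2 (Real.log_le_log (by positivity) ?_)) hL.le
      linarith
    have hkl := key l hbl.label.1 hl
    have hkr := key r hbr.label.1 hr
    have hw : ((Tree.node c l r).weight : ℝ) = c.pts.length + (l.weight + r.weight) := by
      simp [Tree.weight, Tree.toList]
    have hlen' : (l.label.pts.length : ℝ) + r.label.pts.length = c.pts.length := by
      exact_mod_cast hlen
    rw [hw]
    change _ ≤ (c.pts.length : ℝ) * (1 + Real.log c.pts.length / Real.log (4 / 3))
    set Y := Real.log c.pts.length / Real.log (4 / 3)
    have h₁ := mul_le_mul_of_nonneg_left hkl (Nat.cast_nonneg (α := ℝ) l.label.pts.length)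
    have h₂ := mul_le_mul_of_nonneg_left hkr (Nat.cast_nonneg (α := ℝ) r.label.pts.length)
    calc (c.pts.length : ℝ) + (l.weight + r.weight)
        ≤ c.pts.length + (l.label.pts.length * Y + r.label.pts.length * Y) := by linarith
      _ = c.pts.length * (1 + Y) := by rw [← add_mul, hlen']; ring

open Classical in
/-- The clusters contained in a set form full binary trees whose leaves are disjoint. -/
lemma IsBisection.countP_subset_le {m : ℕ} (P : Set (Pt d)) : ∀ {t : Tree (Cluster d)},
    IsBisection m t → t.toList.countP (fun c => decide (∀ x ∈ c.pts, x ∈ P)) ≤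
      2 * t.label.pts.countP (fun x => decide (x ∈ P)) - 1
  | .leaf c, h => by
    simp only [Tree.toList, List.countP_cons, List.countP_nil, zero_add, decide_eq_true_eq,
      Tree.label]
    split_ifs with hP
    · obtain ⟨x, hx⟩ := List.exists_mem_of_ne_nil _ h.1
      have : 0 < c.pts.countP (fun x => decide (x ∈ P)) :=
        List.countP_pos_iff.2 ⟨x, hx, by simpa using hP x hx⟩
      omega
    · omega
  | .node c l r, h => by
    obtain ⟨hc, -, -, hperm, -, -, -, hbl, hbr⟩ := h
    have ihl := hbl.countP_subset_le P
    have ihr := hbr.countP_subset_le P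
    have hcnt := hperm.countP_eq (fun x => decide (x ∈ P))
    rw [List.countP_append] at hcnt
    simp only [Tree.toList, List.countP_cons, List.countP_append, decide_eq_true_eq, Tree.label]
    split_ifs with hP
    · have hpos : ∀ s : Tree (Cluster d), s.label.pts ≠ [] → (∀ x ∈ s.label.pts, x ∈ c.pts) →
          0 < s.label.pts.countP (fun x => decide (x ∈ P)) := by
        intro s hs hsc
        obtain ⟨x, hx⟩ := List.exists_mem_of_ne_nil _ hs
        exact List.countP_pos_iff.2 ⟨x, hx, by simpa using hP x (hsc x hx)⟩
      have h₁ := hpos l hbl.label.1 fun x hx => hperm.mem_iff.1 (List.mem_append_left _ hx)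
      have h₂ := hpos r hbr.label.1 fun x hx => hperm.mem_iff.1 (List.mem_append_right _ hx)
      omega
    · omega

lemma sum_countP_comm {α β : Type*} (p : α → β → Bool) (L' : List β) : ∀ L : List α,
    (L.map fun a => L'.countP (p a)).sum = (L'.map fun b => L.countP fun a => p a b).sum
  | [] => by simp
  | a :: L => by
    have h : L'.countP (p a) = (L'.map fun b => if p a b then 1 else 0).sum := by
      induction L' with
      | nil => rfl
      | cons b L' ih =>
        rw [List.countP_cons, ih, List.map_cons, List.sum_cons]
        omega
    simp only [List.map_cons, List.sum_cons, List.countP_cons, sum_countP_comm p L' L, h,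
      List.sum_map_add]
    omega

/-! ### Non-admissible pairs are close to each other -/

lemma gapSq_val (a b : ℝ) : (gapSq a b).val = max 0 (a - b) ^ 2 := by
  simp only [gapSq, Run.val_bind, sub_val, lt_val, decide_eq_true_eq, Run.val_ite, mul_val,
    Run.val_pure]
  split_ifs with h
  · rw [max_eq_right h.le, sq]
  · rw [max_eq_left (not_lt.1 h)]
    ring

lemma boxDiam_val (B : Box) :
    (boxDiam d B).val = √(∑ i : Fin d, (B.hi i - B.lo i) ^ 2) := by
  simp only [boxDiam, Run.val_bind, sumTo_val, edge, op_val, sub_val, mul_val, sqrt_val]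
  rw [Finset.sum_range fun i => (B.hi i - B.lo i) * (B.hi i - B.lo i)]
  simp only [sq]

lemma boxDist_val (B B' : Box) : (boxDist d B B').val =
    √(∑ i : Fin d, (max 0 (B.lo i - B'.hi i) ^ 2 + max 0 (B'.lo i - B.hi i) ^ 2)) := by
  simp only [boxDist, Run.val_bind, sumTo_val, op_val, gapSq_val, add_val, sqrt_val]
  rw [Finset.sum_range fun i => max 0 (B.lo i - B'.hi i) ^ 2 + max 0 (B'.lo i - B.hi i) ^ 2]

lemma sqrt_sum_sq_le {f : Fin d → ℝ} {w : ℝ} (hw : 0 ≤ w) (h : ∀ i, |f i| ≤ w) :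
    √(∑ i, f i ^ 2) ≤ d * w := by
  refine Real.sqrt_le_iff.2 ⟨by positivity, ?_⟩
  calc ∑ i, f i ^ 2 ≤ ∑ _i : Fin d, w ^ 2 :=
        Finset.sum_le_sum fun i _ => sq_le_sq.2 (by rw [abs_of_nonneg hw]; exact h i)
    _ = d * w ^ 2 := by simp
    _ ≤ (d * w) ^ 2 := by
        rw [mul_pow]
        gcongr
        rcases d.eq_zero_or_pos with rfl | hd
        · simp
        · have : (1 : ℝ) ≤ d := by exact_mod_cast hd
          nlinarith

lemma boxDiam_le {B : Box} {w : ℝ} (hw : 0 ≤ w)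
    (h : ∀ i : Fin d, 0 ≤ B.hi i - B.lo i ∧ B.hi i - B.lo i ≤ w) :
    (boxDiam d B).val ≤ d * w := by
  rw [boxDiam_val]
  exact sqrt_sum_sq_le hw fun i => by
    rw [abs_of_nonneg (h i).1]
    exact (h i).2

lemma gap_le_boxDist (B B' : Box) (i : Fin d) :
    B.lo i - B'.hi i ≤ (boxDist d B B').val ∧ B'.lo i - B.hi i ≤ (boxDist d B B').val := by
  rw [boxDist_val]
  have h := Finset.single_le_sum
    (f := fun i : Fin d => max 0 (B.lo i - B'.hi i) ^ 2 + max 0 (B'.lo i - B.hi i) ^ 2)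
    (fun i _ => by positivity) (Finset.mem_univ i)
  have h₁ := sq_nonneg (max 0 (B.lo i - B'.hi i))
  have h₂ := sq_nonneg (max 0 (B'.lo i - B.hi i))
  exact ⟨(le_max_right 0 _).trans (Real.le_sqrt_of_sq_le (by linarith)),
    (le_max_right 0 _).trans (Real.le_sqrt_of_sq_le (by linarith))⟩

lemma dist_le_of_nonadmissible {η : ℝ} (hη : 0 < η) {v w : Cluster d} {b : ℝ} (hb : 0 ≤ b)
    (hv : IsBoundingBox v.box v.pts) (hw : IsBoundingBox w.box w.pts)
    (hvb : ∀ i : Fin d, v.box.hi i - v.box.lo i ≤ b)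
    (hwb : ∀ i : Fin d, w.box.hi i - w.box.lo i ≤ b) (h : nonadmissible η w v = true)
    {x y : Pt d} (hx : x ∈ v.pts) (hy : y ∈ w.pts) : dist x y ≤ d * (η * d + 2) * b := by
  have hnn : ∀ {c : Cluster d}, IsBoundingBox c.box c.pts → ∀ i : Fin d,
      0 ≤ c.box.hi i - c.box.lo i := by
    intro c hc i
    obtain ⟨z, hz, hz'⟩ := hc.exists_eq_lo i
    linarith [hc.le_hi i z hz]
  have h₁ := boxDiam_le hb fun i => ⟨hnn hv i, hvb i⟩
  have h₂ := boxDiam_le hb fun i => ⟨hnn hw i, hwb i⟩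
  have hdist : (boxDist d v.box w.box).val ≤ η * (d * b) := by
    simp only [nonadmissible, admissible, Run.val_bind, lt_val, decide_eq_true_eq, mul_val, le_val,
      Bool.not_eq_true', decide_eq_false_iff_not, not_le] at h
    refine h.le.trans ?_
    gcongr
    split_ifs
    · exact h₂
    · exact h₁
  rw [mul_assoc]
  rw [dist_eq_norm, EuclideanSpace.norm_eq]
  simp only [sq_abs, Real.norm_eq_abs]
  refine sqrt_sum_sq_le (by positivity) fun i => ?_
  rw [PiLp.sub_apply]
  obtain ⟨h₃, h₄⟩ := gap_le_boxDist v.box w.box i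
  have := hv.lo_le i x hx
  have := hv.le_hi i x hx
  have := hw.lo_le i y hy
  have := hw.le_hi i y hy
  have := hvb i
  have := hwb i
  have : (η * d + 2) * b = η * (d * b) + 2 * b := by ring
  rw [abs_le, this]
  constructor <;> linarith

lemma countP_or_le {α : Type*} (p p' : α → Bool) : ∀ L : List α,
    L.countP (fun a => p a || p' a) ≤ L.countP p + L.countP p'
  | [] => by simp
  | a :: L => by
    have := countP_or_le p p' L
    simp only [List.countP_cons, Bool.or_eq_true]
    split_ifs <;> first | omega | tauto

/-! ### The number of non-admissible pairs -/

/-- Separated points in a ball whose radius is at least the separation distance. -/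
lemma card_le_of_dist_le {s : Finset (Pt d)} {g ρ : ℝ} (hg : 0 < g) (hρ : g ≤ ρ)
    (hs : ∀ x ∈ s, ∀ y ∈ s, x ≠ y → g ≤ dist x y) {y : Pt d} (hy : ∀ x ∈ s, dist x y ≤ ρ) :
    (s.card : ℝ) * g ^ d ≤ (4 * ρ) ^ d := by
  have h₁ := card_mul_le_volume hg hs (A := Metric.ball y (2 * ρ)) measure_ball_lt_top.ne (by
    intro x hx
    refine Metric.ball_subset_ball' ?_
    linarith [hy x hx])
  rw [volume_ball_eq y (by linarith), ← mul_assoc] at h₁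
  have h₂ := le_of_mul_le_mul_right h₁ unitBallVolume_pos
  calc (s.card : ℝ) * g ^ d = 2 ^ d * (s.card * (g / 2) ^ d) := by
        rw [div_pow]
        field_simp
    _ ≤ 2 ^ d * (2 * ρ) ^ d := by gcongr
    _ = (4 * ρ) ^ d := by
        rw [← mul_pow]
        ring_nf

/-- If the edges of all bounding boxes are bounded in terms of the cardinalities, then the number of
pairs that are not admissible is bounded by the sum of the cardinalities. In such a pair, the
smaller cluster is contained in a ball about any point of the larger one that contains a comparable
number of points. -/
lemma IsBisection.sum_countP_nonadmissible_le {m : ℕ} {t : Tree (Cluster d)}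
    (ht : IsBisection m t) (hd : 0 < d) {η g a : ℝ} (hη : 0 < η) (hg : 0 < g) (ha : 0 ≤ a)
    (hsep : ∀ x ∈ t.label.pts, ∀ y ∈ t.label.pts, x ≠ y → g ≤ dist x y)
    (hedge : ∀ c ∈ t.toList, ∀ i : Fin d,
      (c.box.hi i - c.box.lo i) ^ d ≤ (a * g) ^ d * c.pts.length) :
    ((t.toList.map fun w => t.toList.countP (nonadmissible η w)).sum : ℝ) ≤
      4 * (4 * (d * (η * d + 2) * a + 1)) ^ d * t.weight := by
  classical
  set R := d * (η * d + 2) * a with hR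
  have hR0 : 0 ≤ R := by positivity
  set root : Cluster d → ℝ := fun c => (c.pts.length : ℝ) ^ ((d : ℝ)⁻¹) with hroot
  have hroot_nonneg : ∀ c, 0 ≤ root c := fun c => by positivity
  have hroot_pow : ∀ c, root c ^ d = c.pts.length := fun c =>
    Real.rpow_inv_natCast_pow (Nat.cast_nonneg _) hd.ne'
  have hroot_mono : ∀ c c' : Cluster d, c.pts.length ≤ c'.pts.length → root c ≤ root c' :=
    fun c c' h => Real.rpow_le_rpow (by positivity) (by exact_mod_cast h) (by positivity)
  have hroot_one : ∀ c ∈ t.toList, 1 ≤ root c := fun c hc =>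
    Real.one_le_rpow (by exact_mod_cast List.length_pos_iff.2 (ht.mem c hc).1) (by positivity)
  have hedge' : ∀ c ∈ t.toList, ∀ i : Fin d, c.box.hi i - c.box.lo i ≤ a * g * root c := by
    intro c hc i
    have h := hedge c hc i
    rw [← hroot_pow, ← mul_pow] at h
    exact le_of_pow_le_pow_left₀ hd.ne' (mul_nonneg (by positivity) (hroot_nonneg c)) h
  -- `Q w v`: the cluster `v` is close to `w`, as measured by the cardinality of `w`.
  set Q : Cluster d → Cluster d → Bool := fun w v =>
    decide (∀ x ∈ v.pts, ∀ y ∈ w.pts, dist x y ≤ R * g * root w) with hQ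
  have hor : ∀ w ∈ t.toList, ∀ v ∈ t.toList, nonadmissible η w v = true →
      (Q w v || Q v w) = true := by
    intro w hw v hv h
    have hBv := (ht.mem v hv).2.2
    have hBw := (ht.mem w hw).2.2
    simp only [hQ, Bool.or_eq_true, decide_eq_true_eq]
    rcases le_total v.pts.length w.pts.length with hvw | hvw
    · refine Or.inl fun x hx y hy => ?_
      refine (dist_le_of_nonadmissible hη (b := a * g * root w)
        (mul_nonneg (by positivity) (hroot_nonneg w)) hBv hBw (fun i => ?_) (hedge' w hw) h hx
        hy).trans_eq (by rw [hR]; ring)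
      refine (hedge' v hv i).trans ?_
      have := hroot_mono _ _ hvw
      gcongr
    · refine Or.inr fun y hy x hx => ?_
      rw [dist_comm]
      refine (dist_le_of_nonadmissible hη (b := a * g * root v)
        (mul_nonneg (by positivity) (hroot_nonneg v)) hBv hBw (hedge' v hv) (fun i => ?_) h hx
        hy).trans_eq (by rw [hR]; ring)
      refine (hedge' w hw i).trans ?_
      have := hroot_mono _ _ hvw
      gcongr
  have hcount : ∀ w ∈ t.toList, (t.toList.countP (Q w) : ℝ) ≤
      2 * (4 * (R + 1)) ^ d * w.pts.length := by
    intro w hw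
    obtain ⟨y, hy⟩ := List.exists_mem_of_ne_nil _ (ht.mem w hw).1
    have h1 := hroot_one w hw
    set P : Set (Pt d) := {x | dist x y ≤ R * g * root w}
    have h₁ : t.toList.countP (Q w) ≤ t.toList.countP fun c => decide (∀ x ∈ c.pts, x ∈ P) := by
      refine List.countP_mono_left fun v _ h => ?_
      simp only [hQ, decide_eq_true_eq] at h ⊢
      exact fun x hx => h x hx y hy
    have h₂ := ht.countP_subset_le P
    set s := (t.label.pts.filter fun x => decide (x ∈ P)).toFinset
    have hs : s.card = t.label.pts.countP fun x => decide (x ∈ P) := by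
      rw [List.countP_eq_length_filter]
      exact List.toFinset_card_of_nodup (ht.label.2.1.filter _)
    have hmem : ∀ x ∈ s, x ∈ t.label.pts ∧ dist x y ≤ R * g * root w := fun x hx => by
      simpa [s, P] using hx
    have h₃ := card_le_of_dist_le hg (ρ := (R + 1) * g * root w) (s := s) (y := y) (by
        calc g ≤ (R + 1) * g * 1 := by nlinarith
          _ ≤ (R + 1) * g * root w := by gcongr)
      (fun x hx x' hx' => hsep x (hmem x hx).1 x' (hmem x' hx').1) (fun x hx => by
        refine (hmem x hx).2.trans ?_
        gcongr
        linarith)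
    have h₄ : (s.card : ℝ) ≤ (4 * (R + 1)) ^ d * w.pts.length := by
      refine le_of_mul_le_mul_right ?_ (pow_pos hg d)
      calc (s.card : ℝ) * g ^ d ≤ (4 * ((R + 1) * g * root w)) ^ d := h₃
        _ = (4 * (R + 1)) ^ d * root w ^ d * g ^ d := by
            rw [← mul_pow, ← mul_pow]
            ring_nf
        _ = (4 * (R + 1)) ^ d * w.pts.length * g ^ d := by rw [hroot_pow]
    have h₅ : t.toList.countP (Q w) ≤ 2 * s.card := by omega
    calc (t.toList.countP (Q w) : ℝ) ≤ 2 * s.card := by exact_mod_cast h₅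
      _ ≤ 2 * ((4 * (R + 1)) ^ d * w.pts.length) := by gcongr
      _ = 2 * (4 * (R + 1)) ^ d * w.pts.length := by ring
  have hsum : ((t.toList.map fun w => t.toList.countP (Q w)).sum : ℝ) ≤
      2 * (4 * (R + 1)) ^ d * t.weight := by
    rw [Tree.weight, Nat.cast_list_sum, Nat.cast_list_sum, List.map_map, List.map_map,
      ← List.sum_map_mul_left]
    exact List.sum_le_sum hcount
  have hle : (t.toList.map fun w => t.toList.countP (nonadmissible η w)).sum ≤
      2 * (t.toList.map fun w => t.toList.countP (Q w)).sum := by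
    calc (t.toList.map fun w => t.toList.countP (nonadmissible η w)).sum
        ≤ (t.toList.map fun w => t.toList.countP (Q w) +
            t.toList.countP fun v => Q v w).sum := by
          refine List.sum_le_sum fun w hw => ?_
          refine (List.countP_mono_left fun v hv => hor w hw v hv).trans ?_
          exact countP_or_le _ _ _
      _ = _ := by
          rw [List.sum_map_add, sum_countP_comm Q, ← sum_countP_comm Q, two_mul]
  calc ((t.toList.map fun w => t.toList.countP (nonadmissible η w)).sum : ℝ)
      ≤ 2 * ((t.toList.map fun w => t.toList.countP (Q w)).sum : ℝ) := by exact_mod_cast hle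
    _ ≤ 2 * (2 * (4 * (R + 1)) ^ d * t.weight) := by gcongr
    _ = _ := by ring

/-! ### Quasi-uniform sequences -/

/-- The constants of the sequence do not depend on `N`: `Ω` is bounded because it is covered by
finitely many balls. -/
lemma QuasiUniform.exists_isQuasiUniform {Ω : Set (Pt d)} (hΩo : IsOpen Ω) (hΩc : Convex ℝ Ω)
    {X : (N : ℕ) → Fin N → Pt d} (hXinj : ∀ N, Function.Injective (X N))
    (hXΩ : ∀ N i, X N i ∈ Ω) (hX : QuasiUniform Ω X) :
    ∃ C r D x₀, 0 < d ∧ 1 ≤ C ∧ 0 < r ∧ 0 < D ∧ ∀ N, 2 ≤ N → ∀ s : Finset (Pt d),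
      (∀ x, x ∈ s ↔ x ∈ Set.range (X N)) → ∃ g, IsQuasiUniform Ω s g C r D x₀ := by
  obtain ⟨C₀, hC₀⟩ := hX
  set C : ℝ := max 1 C₀ with hC
  have hnt : ∀ N, 2 ≤ N → (Set.range (X N)).Nontrivial := by
    intro N hN
    refine ⟨X N ⟨0, by omega⟩, ⟨_, rfl⟩, X N ⟨1, by omega⟩, ⟨_, rfl⟩, fun h => ?_⟩
    simpa using hXinj N h
  have hcover : ∀ N, 2 ≤ N → 0 < (Set.range (X N)).infsep ∧
      ∀ z ∈ Ω, ∃ x ∈ Set.range (X N), dist z x ≤ C * (Set.range (X N)).infsep := by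
    intro N hN
    have hfin := Set.finite_range (X N)
    refine ⟨(hfin.infsep_pos_iff_nontrivial).2 (hnt N hN), fun z hz => ?_⟩
    obtain ⟨x, hx, hxz⟩ := hfin.isCompact.exists_infEDist_eq_edist (hnt N hN).nonempty z
    refine ⟨x, hx, ?_⟩
    have htop : (Set.range (X N)).einfsep ≠ ∞ := by
      obtain ⟨a, ha, b, hb, hab⟩ := hnt N hN
      exact ne_top_of_le_ne_top (edist_ne_top a b) (Set.einfsep_le_edist_of_mem ha hb hab)
    have h₁ : edist z x ≤ C₀ * (Set.range (X N)).einfsep := by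
      rw [← hxz]
      refine (le_iSup₂ (f := fun y (_ : y ∈ Ω) => Metric.infEDist y (Set.range (X N))) z hz).trans
        ((hC₀ N hN).trans ?_)
      gcongr
      exact ENNReal.half_le_self
    have h₂ := ENNReal.toReal_mono (ENNReal.mul_ne_top ENNReal.coe_ne_top htop) h₁
    rw [ENNReal.toReal_mul, ← dist_edist] at h₂
    refine h₂.trans ?_
    exact mul_le_mul_of_nonneg_right (le_max_right 1 (C₀ : ℝ)) ENNReal.toReal_nonneg
  have hd : 0 < d := by
    rcases d.eq_zero_or_pos with rfl | hd
    · obtain ⟨a, -, b, -, hab⟩ := hnt 2 le_rfl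
      exact absurd (Subsingleton.elim a b) hab
    · exact hd
  obtain ⟨r, hr, hball⟩ := Metric.isOpen_iff.1 hΩo _ (hXΩ 1 0)
  obtain ⟨hg₂, hcov₂⟩ := hcover 2 le_rfl
  set g₂ := (Set.range (X 2)).infsep
  have hC1 : 1 ≤ C := le_max_left _ _
  refine ⟨C, r, 2 * (C * g₂) + Metric.diam (Set.range (X 2)), X 1 0, hd, hC1, hr, ?_, ?_⟩
  · have : 0 ≤ Metric.diam (Set.range (X 2)) := Metric.diam_nonneg
    have : 0 < C * g₂ := by positivity
    linarith
  · intro N hN s hs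
    obtain ⟨hg, hcov⟩ := hcover N hN
    refine ⟨(Set.range (X N)).infsep, hΩc, ?_, hg, hC1, ?_, ?_, hr, hball, ?_⟩
    · intro x hx
      obtain ⟨i, rfl⟩ := (hs x).1 hx
      exact hXΩ N i
    · exact fun x hx y hy hxy => Set.infsep_le_dist_of_mem ((hs x).1 hx) ((hs y).1 hy) hxy
    · intro z hz
      obtain ⟨x, hx, hxz⟩ := hcov z hz
      exact ⟨x, (hs x).2 hx, hxz⟩
    · intro x hx y hy i
      obtain ⟨a, ha, hxa⟩ := hcov₂ x hx
      obtain ⟨b, hb, hyb⟩ := hcov₂ y hy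
      have h₁ := Metric.dist_le_diam_of_mem (Set.finite_range (X 2)).isBounded ha hb
      have h₂ := dist_triangle4 x a b y
      rw [dist_comm b y] at h₂
      exact (abs_apply_sub_le_dist x y i).trans (by linarith)

/-! ### The total cost -/

/-- The constant depends on the sequence of point sets only through its quasi-uniformity. -/
lemma exists_cost_le {Ω : Set (Pt d)} (hΩo : IsOpen Ω) (hΩc : Convex ℝ Ω)
    {X : (N : ℕ) → Fin N → Pt d} (hXinj : ∀ N, Function.Injective (X N))
    (hXΩ : ∀ N i, X N i ∈ Ω) (hX : QuasiUniform Ω X) (q n : ℕ) {τ η : ℝ} (hτ₁ : 1 < τ)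
    (hτ₂ : τ < mq d q + 1) (hη : 0 < η) (k : Pt d → Pt d → ℝ)
    (ξ : ℕ → List (Pt d) → Fin n → Pt d) : ∃ K : ℝ, 0 ≤ K ∧ ∀ N : ℕ, 2 ≤ N →
      ((compressedKernelMatrix q τ η k (ξ N) (List.ofFn (X N))).cost : ℝ) ≤
        K * (N * (1 + Real.log N / Real.log (4 / 3))) := by
  obtain ⟨C, r, D, x₀, hd, hC, hr, hD, hqu⟩ :=
    hX.exists_isQuasiUniform hΩo hΩc hXinj hXΩ
  obtain ⟨K, hK⟩ := exists_compressedKernelMatrix_cost_le hd q n hτ₁ hτ₂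
  obtain ⟨l, κ, M, hc⟩ := exists_shapeConstants hd hC hr hD
  set A := (4 * C * d * D / (r * κ)) ^ d + M ^ d with hA
  have hA0 : 0 ≤ A := by
    have := hc.κ_pos hd
    have := hc.M_pos
    positivity
  set a := A ^ ((d : ℝ)⁻¹) with ha
  have ha0 : 0 ≤ a := by positivity
  have haA : a ^ d = A := Real.rpow_inv_natCast_pow hA0 hd.ne'
  set B := 4 * (4 * (d * (η * d + 2) * a + 1)) ^ d with hB
  have hB0 : 0 ≤ B := by positivity
  refine ⟨K * (1 + B), by positivity, fun N hN => ?_⟩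
  have hlen : (List.ofFn (X N)).length = N := List.length_ofFn
  obtain ⟨t, ht, hroot, hcost⟩ := hK η k (ξ N) (List.ofFn (X N))
    (List.length_pos_iff.1 (by omega)) (List.nodup_ofFn.2 (hXinj N))
  have hmem : ∀ x, x ∈ t.label.points ↔ x ∈ Set.range (X N) := fun x => by
    rw [Cluster.mem_points, hroot, List.mem_ofFn, Set.mem_range]
  obtain ⟨g, hg⟩ := hqu N hN t.label.points hmem
  have hne := Cluster.points_nonempty ht.label.1
  have hreg := ht.forall_mem (P := IsShapeRegular t.label.points g l κ M)
    (fun v v' i hv hs => hc.isShapeRegular_son hd hg hv hs) (hc.isShapeRegular_root hd hg hne)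
  have hpairs := ht.sum_countP_nonadmissible_le hd hη hg.pos ha0
    (fun x hx y hy => hg.sep x (Cluster.mem_points.2 hx) y (Cluster.mem_points.2 hy)) (by
      intro c hct i
      obtain ⟨hc₁, hc₂, hc₃⟩ := ht.mem c hct
      rw [hc₃.sub_eq_width, mul_pow, haA, mul_assoc, ← Cluster.card_points hc₂]
      exact hc.width_pow_le hd hg (hreg c hct) (Cluster.points_nonempty hc₁) i)
  have hw := ht.weight_le
  rw [hroot, hlen] at hw
  rw [← hB] at hpairs
  have hcost' : ((compressedKernelMatrix q τ η k (ξ N) (List.ofFn (X N))).cost : ℝ) ≤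
      K * (t.weight + (t.toList.map fun w => t.toList.countP (nonadmissible η w)).sum) := by
    exact_mod_cast hcost
  calc ((compressedKernelMatrix q τ η k (ξ N) (List.ofFn (X N))).cost : ℝ)
      ≤ K * (t.weight + B * t.weight) := hcost'.trans (by gcongr)
    _ = K * (1 + B) * t.weight := by ring
    _ ≤ _ := by gcongr

end Samplet

theorem proposition4p4p4 {d : ℕ} (Ω : Set (Samplet.Pt d)) (hΩo : IsOpen Ω) (hΩc : Convex ℝ Ω)
    (X : (N : ℕ) → Fin N → Samplet.Pt d) (hXinj : ∀ N, Function.Injective (X N))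
    (hXΩ : ∀ N i, X N i ∈ Ω) (hX : Samplet.QuasiUniform Ω X)
    (q n : ℕ) (τ η : ℝ) (hτ₁ : 1 < τ) (hτ₂ : τ < Samplet.mq d q + 1) (hη : 0 < η)
    (k : Samplet.Pt d → Samplet.Pt d → ℝ)
    (ξ : ℕ → List (Samplet.Pt d) → Fin n → Samplet.Pt d)
    (hξΩ : ∀ N v i, ξ N v i ∈ Ω)
    (hξ : ∀ N v i i', i ≠ i' → ∀ l, ξ N v i l ≠ ξ N v i' l) :
    ((fun N : ℕ => ((Samplet.compressedKernelMatrix q τ η k (ξ N) (List.ofFn (X N))).time : ℝ))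
        =O[atTop] fun N : ℕ => (N : ℝ) * Real.log N) ∧
      ((fun N : ℕ => ((Samplet.compressedKernelMatrix q τ η k (ξ N) (List.ofFn (X N))).cells : ℝ))
        =O[atTop] fun N : ℕ => (N : ℝ) * Real.log N) := by
  obtain ⟨K, hK0, hK⟩ := Samplet.exists_cost_le hΩo hΩc hXinj hXΩ hX q n hτ₁ hτ₂ hη k ξ
  have hL : 0 < Real.log (4 / 3) := Real.log_pos (by norm_num)
  have key : ∀ f : ℕ → ℕ,
      (∀ N, f N ≤ (Samplet.compressedKernelMatrix q τ η k (ξ N) (List.ofFn (X N))).cost) →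
      (fun N => (f N : ℝ)) =O[atTop] fun N : ℕ => (N : ℝ) * Real.log N := by
    intro f hf
    refine IsBigO.of_bound (K * (1 + 1 / Real.log (4 / 3))) ?_
    filter_upwards [eventually_ge_atTop 3] with N hN
    have hlog : 1 ≤ Real.log N := by
      rw [Real.le_log_iff_exp_le (by positivity)]
      have : (3 : ℝ) ≤ N := by exact_mod_cast hN
      linarith [Real.exp_one_lt_d9]
    rw [Real.norm_of_nonneg (Nat.cast_nonneg _),
      Real.norm_of_nonneg (mul_nonneg (Nat.cast_nonneg _) (by linarith))]
    have h₁ : (f N : ℝ) ≤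
        (Samplet.compressedKernelMatrix q τ η k (ξ N) (List.ofFn (X N))).cost := by
      exact_mod_cast hf N
    calc (f N : ℝ) ≤ K * (N * (1 + Real.log N / Real.log (4 / 3))) :=
          h₁.trans (hK N (by omega))
      _ ≤ K * (N * (Real.log N + Real.log N / Real.log (4 / 3))) := by gcongr
      _ = K * (1 + 1 / Real.log (4 / 3)) * (N * Real.log N) := by ring
  exact ⟨key _ fun N => Nat.le_add_right _ _, key _ fun N => Nat.le_add_left _ _⟩
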